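/- **Setting.** Let $G=(V\cup\{s,g\},E)$ be a finite directed acyclic graph with $s\ne g$ and $E\subseteq(V\cup\{s\})\times(V\cup\{g\})$, in which every $v\in V$ lies on some $s$-$g$ path. Write $e=(e_-,e_+)$ and $\partial_+v=\{e\in E: e_-=v\}$, and let $n=|V|$, $m=|E|$. Let $\mathcal P\subseteq\{0,1\}^E$ be the set of (indicator vectors of) $s$-$g$ paths, $\mathcal Q=\mathrm{conv}(\mathcal P)$, $L=\max_{p\in\mathcal P}\|p\|_1$, and $q(v)=\sum_{e\in\partial_+v}q(e)$ for $v\in V\cup\{s\}$. Let $T\ge 2$. In each round $t=1,\dots,T$ the player fixes a flow $q_t\in\mathcal Q$. The environment chooses $\ell_t\in\mathbb R_{\ge0}^E$ with $\langle\ell_t,p\rangle\le 1$ for all $p\in\mathcal P$; the choice may be random and may depend on the past and on $q_t$. Then, conditionally on the past, $q_t$ and $\ell_t$, the player draws a path $p_t\in\mathcal P$ by the Markovian procedure that starts at $s$ and, while at $v\neq g$, picks $e\in\partial_+v$ with probability $q_t(e)/q_t(v)$ and moves to $e_+$. The player observes only $p_t$ and $c_t\in[0,1]$, where the conditional mean of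 $c_t$ given the past, $q_t$, $\ell_t$ and $p_t$ is $\langle\ell_t,p_t\rangle$. Put $$\mathrm{Reg}_T(p^*)=\mathbf E\Big[\sum_{t=1}^T\langle\ell_t,p_t-p^*\rangle\Big]\ (p^*\in\mathcal P),\qquad \mathrm{Reg}_T=\max_{p^*\in\mathcal P}\mathrm{Reg}_T(p^*).$$ **Algorithms.** $q_t\in\arg\min_{q\in\mathcal Q}\{\langle\sum_{\tau<t}\widehat\ell_\tau,q\rangle+\psi_t(q)\}$ with $\widehat\ell_t(e)=c_t\big(\frac{p_t(e)}{q_t(e)}-\frac{p_t(e_-)}{q_t(e_-)}\big)$, where $-\ln 0=+\infty$ and either * (Tsallis) $\psi_t(q)=-\frac{2}{\eta_t}\sum_{e}\sqrt{q(e)}-2\sum_{e}\ln q(e)$ with $\eta_t=1/\sqrt t$; or * (log-barrier) $\psi_t(q)=-\sum_e\frac{1}{\eta_t(e)}\ln q(e)$ with $\eta_t(e)=\big(4+\frac1{\ln T}\sum_{\tau<t}\rho_\tau(e)\big)^{-1/2}$ and $\rho_t(e)=c_t^2\,p_t(e_-)\big(p_t(e)-\frac{q_t(e)}{q_t(e_-)}\big)^2$.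 **Self-bounding regime.** Let $p^*\in\mathcal P$, let $\pi^*:V\cup\{s\}\to E$ satisfy $\pi^*(v)\in\partial_+v$ for all $v$, and $\pi^*(e_-)=e$ whenever $p^*(e)=1$; let $E'=E\setminus\mathrm{Im}(\pi^*)$. Let $\Delta\in[0,1]^E$ with $\Delta(e)>0$ for $e\in E'$, and let $C\ge0$. The regime holds if $$\mathrm{Reg}_T(p^*)\ \ge\ \mathbf E\Big[\sum_{t=1}^T\sum_{e\in E'}\Delta(e)p_t(e)\Big]-C .$$ Let $\Delta_{\min}=\min_{e\in E'}\Delta(e)$ and $\Delta^*=\min\{\Delta(e): e\in E',\ p^*(e_-)=1\}\ (\ge\Delta_{\min})$. If $E'$ is empty, the terms below that are divided by these minima are read as $0$. **Statement.** There is a universal constant $K>0$, which depends on nothing at all, such that the following hold. 1. The Tsallis algorithm satisfies $$\mathrm{Reg}_T\le K\big(\sqrt{mL(n+T)}+n\log T\big)\quad\text{and}\quad \mathrm{Reg}_T\le K\big(\sqrt{mLT}+m\log T\big).$$ Simultaneously, in every self-bounding regime, $\mathrm{Reg}_T(p^*)\le K(U+\sqrt{UC})$ for $U=\sum_{e\in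 E'}\frac{\log T}{\Delta(e)}+\frac{n^2\log T}{\Delta_{\min}}$, and even for $U=\sum_{e\in E'}\frac{\log T}{\Delta(e)}+\frac{n^2\log T}{\Delta^*}$. 2. The log-barrier algorithm satisfies $\mathrm{Reg}_T\le K\sqrt{mL(n+T)\log T}$ and $$\mathrm{Reg}_T\le K\Big(\mathbf E\Big[\sqrt{mL\textstyle\sum_{t=1}^Tc_t^2\,\log T}\Big]+m\log T\Big),$$ $$\mathrm{Reg}_T\le K\Big(\sqrt{mL\log T\cdot\min_{p\in\mathcal P}\mathbf E\big[\textstyle\sum_{t=1}^T\langle\ell_t,p\rangle\big]}+mL\log T\Big).$$ Simultaneously, in every self-bounding regime, $\mathrm{Reg}_T(p^*)\le K\big(U+\sqrt{UC}+m\log T\big)$ with $U=\sum_{e\in E'}\frac{\log T}{\Delta(e)}$. -/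

import Mathlib

open MeasureTheory

noncomputable section

/-- `IsWalk E u v l`: the list of edges `l` is a directed walk from `u` to `v` using edges in `E`. -/
inductive IsWalk {W : Type*} (E : Finset (W × W)) : W → W → List {e // e ∈ E} → Prop
  | nil (v : W) : IsWalk E v v []
  | cons (e : {e // e ∈ E}) {w : W} {l : List {e // e ∈ E}} (h : IsWalk E e.1.2 w l) :
      IsWalk E e.1.1 w (e :: l)

/-- A finite directed acyclic graph on the vertex set `W = V ∪ {s, g}`, with source `s`, sink `g`
and edge set `E ⊆ (V ∪ {s}) × (V ∪ {g})`, in which every vertex of `V` lies on an `s`-`g` path. -/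
structure STDag (W : Type*) where
  s : W
  g : W
  edges : Finset (W × W)
  s_ne_g : s ≠ g
  src_ne : ∀ e ∈ edges, e.1 ≠ g
  tgt_ne : ∀ e ∈ edges, e.2 ≠ s
  acyclic : ∀ v l, IsWalk edges v v l → l = []
  through : ∀ v, v ≠ s → v ≠ g → ∃ l₁ l₂, IsWalk edges s v l₁ ∧ IsWalk edges v g l₂

namespace STDag

variable {W : Type*} (G : STDag W)

/-- The type of edges. -/
abbrev Edge : Type _ := {e // e ∈ G.edges}

/-- The initial vertex `e₋ ∈ V ∪ {s}` of an edge. -/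
def tail (e : G.Edge) : {v : W // v ≠ G.g} := ⟨e.1.1, G.src_ne e.1 e.2⟩

variable [DecidableEq W]

/-- The vector in `{0,1}^E` of a list of edges. -/
def pathVec (l : List G.Edge) : G.Edge → ℝ := fun e => if e ∈ l then 1 else 0

/-- `𝒫 ⊆ {0,1}^E`, the set of (vectors of) `s`-`g` paths. -/
def paths : Set (G.Edge → ℝ) := {x | ∃ l, IsWalk G.edges G.s G.g l ∧ x = G.pathVec l}

/-- `𝒬 = conv 𝒫`, the set of `s`-`g` flows of value one. -/
def flows : Set (G.Edge → ℝ) := convexHull ℝ G.paths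

/-- `q(v) = ∑_{e ∈ ∂₊ v} q(e)`. -/
def outflow (x : G.Edge → ℝ) (v : {v : W // v ≠ G.g}) : ℝ := ∑ e with G.tail e = v, x e

/-- `n = |V|`. -/
def n [Fintype W] : ℕ := Fintype.card {v : W // v ≠ G.s ∧ v ≠ G.g}

/-- `m = |E|`. -/
def m : ℕ := G.edges.card

/-- `L = max_{p ∈ 𝒫} ‖p‖₁`, the maximal number of edges of an `s`-`g` path. -/
def L : ℝ := ⨆ x : G.paths, ∑ e, x.1 e

/-- `⟨x, y⟩` for vectors indexed by the edges. -/
def dot (x y : G.Edge → ℝ) : ℝ := ∑ e, x e * y e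

/-- The probability that the Markovian procedure that starts in `s` and, while in `v ≠ g`, picks
`e ∈ ∂₊ v` with probability `q(e) / q(v)` and moves to `e₊`, traverses exactly the walk `l`. -/
def walkProb (x : G.Edge → ℝ) (l : List G.Edge) : ℝ :=
  (l.map fun e => x e / G.outflow x (G.tail e)).prod

/-- The loss estimator
`ℓ̂(e) = c (p(e) / q(e) - p(e₋) / q(e₋))`. -/
def lossEst (c : ℝ) (p q : G.Edge → ℝ) (e : G.Edge) : ℝ :=
  c * (p e / q e - G.outflow p (G.tail e) / G.outflow q (G.tail e))

/-- `x` minimizes `Φ` over `𝒬`. The regularizers contain `-ln q(e)` with positive weight for every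
edge, so they are `+∞` where some coordinate vanishes; minimizers and competitors are therefore
those flows all of whose coordinates are positive. -/
def IsArgmin (Φ : (G.Edge → ℝ) → ℝ) (x : G.Edge → ℝ) : Prop :=
  x ∈ G.flows ∧ (∀ e, 0 < x e) ∧ ∀ y ∈ G.flows, (∀ e, 0 < y e) → Φ x ≤ Φ y

/-- The learning rate `η_t = 1 / √t`. -/
def tsallisRate (t : ℕ) : ℝ := 1 / √(t : ℝ)

/-- The Tsallis-entropy regularizer
`ψ_t(q) = -(2/η_t) ∑_e √q(e) - ∑_e β ln q(e)` with `β = 2`. -/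
def tsallisReg (t : ℕ) (x : G.Edge → ℝ) : ℝ :=
  -(2 / tsallisRate t) * ∑ e, √(x e) - ∑ e, 2 * Real.log (x e)

/-- `ρ(e) = c² p(e₋) (p(e) - q(e) / q(e₋))²`. -/
def rho (c : ℝ) (p q : G.Edge → ℝ) (e : G.Edge) : ℝ :=
  c ^ 2 * G.outflow p (G.tail e) * (p e - q e / G.outflow q (G.tail e)) ^ 2

/-- The learning rate
`η_t(e) = (4 + (1 / ln T) ∑_{τ < t} ρ_τ(e))^{-1/2}` of the log-barrier algorithm. -/
def barrierRate (T : ℕ) (p q : ℕ → G.Edge → ℝ) (c : ℕ → ℝ) (t : ℕ) (e : G.Edge) : ℝ :=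
  (4 + 1 / Real.log T * ∑ τ ∈ Finset.Ico 1 t, G.rho (c τ) (p τ) (q τ) e) ^ (-(1 / 2) : ℝ)

/-- The log-barrier regularizer `ψ_t(x) = -∑_e (1/η_t(e)) ln x(e)`. -/
def barrierReg (T : ℕ) (p q : ℕ → G.Edge → ℝ) (c : ℕ → ℝ) (t : ℕ) (x : G.Edge → ℝ) : ℝ :=
  -∑ e, 1 / G.barrierRate T p q c t e * Real.log (x e)

/-- `∑_{τ < t} ℓ̂_τ`. -/
def cumLossEst (p q : ℕ → G.Edge → ℝ) (c : ℕ → ℝ) (t : ℕ) (e : G.Edge) : ℝ :=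
  ∑ τ ∈ Finset.Ico 1 t, G.lossEst (c τ) (p τ) (q τ) e

/-- The flows `q_1, …, q_T` are chosen by follow-the-regularized-leader with the Tsallis-entropy
regularizer. -/
def IsTsallisFTRL (T : ℕ) (p q : ℕ → G.Edge → ℝ) (c : ℕ → ℝ) : Prop :=
  ∀ t ∈ Finset.Icc 1 T,
    G.IsArgmin (fun x => G.dot (G.cumLossEst p q c t) x + G.tsallisReg t x) (q t)

/-- The flows `q_1, …, q_T` are chosen by follow-the-regularized-leader with the log-barrier
regularizer. -/
def IsLogBarrierFTRL (T : ℕ) (p q : ℕ → G.Edge → ℝ) (c : ℕ → ℝ) : Prop :=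
  ∀ t ∈ Finset.Icc 1 T,
    G.IsArgmin (fun x => G.dot (G.cumLossEst p q c t) x + G.barrierReg T p q c t x) (q t)

/-- The interaction of the environment with a player who samples paths from flows `q_t`, over the
rounds `1, …, T`. The σ-algebra `ℋ t` holds all that has happened (including any private randomness
of the environment) up to the moment in round `t` at which `q_t` and `ℓ_t` are fixed and `p_t` is
not yet drawn. So `ℓ_t` may depend on the whole past and on `q_t`. -/
structure IsInteraction {Ω : Type*} {mΩ : MeasurableSpace Ω} (μ : Measure Ω) (T : ℕ)
    (ℋ : Filtration ℕ mΩ) (ℓ q p : ℕ → Ω → G.Edge → ℝ) (c : ℕ → Ω → ℝ) : Prop where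
  loss_meas : ∀ t ∈ Finset.Icc 1 T, Measurable[ℋ t] (ℓ t)
  loss_nonneg : ∀ t ∈ Finset.Icc 1 T, ∀ ω e, 0 ≤ ℓ t ω e
  loss_le : ∀ t ∈ Finset.Icc 1 T, ∀ ω, ∀ x ∈ G.paths, G.dot (ℓ t ω) x ≤ 1
  flow_meas : ∀ t ∈ Finset.Icc 1 T, Measurable[ℋ t] (q t)
  path_meas : ∀ t ∈ Finset.Icc 1 T, Measurable[ℋ (t + 1)] (p t)
  path_mem : ∀ t ∈ Finset.Icc 1 T, ∀ ω, p t ω ∈ G.paths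
  path_law : ∀ t ∈ Finset.Icc 1 T, ∀ l, IsWalk G.edges G.s G.g l →
    μ[Set.indicator {ω | p t ω = G.pathVec l} (fun _ => (1 : ℝ)) | ℋ t]
      =ᵐ[μ] fun ω => G.walkProb (q t ω) l
  feedback_meas : ∀ t ∈ Finset.Icc 1 T, Measurable[ℋ (t + 1)] (c t)
  feedback_mem : ∀ t ∈ Finset.Icc 1 T, ∀ ω, c t ω ∈ Set.Icc (0 : ℝ) 1
  feedback_mean : ∀ t ∈ Finset.Icc 1 T,
    μ[c t | ℋ t ⊔ MeasurableSpace.comap (p t) inferInstance]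
      =ᵐ[μ] fun ω => G.dot (ℓ t ω) (p t ω)

section regret

variable {Ω : Type*} [MeasurableSpace Ω] (μ : Measure Ω) (T : ℕ) (ℓ p : ℕ → Ω → G.Edge → ℝ)

/-- `Reg_T(p*) = 𝔼 ∑_{t ≤ T} ⟨ℓ_t, p_t - p*⟩`. -/
def regret (pstar : G.Edge → ℝ) : ℝ :=
  ∫ ω, ∑ t ∈ Finset.Icc 1 T, G.dot (ℓ t ω) (p t ω - pstar) ∂μ

/-- `Reg_T = max_{p* ∈ 𝒫} Reg_T(p*)`. -/
def maxRegret : ℝ := ⨆ x : G.paths, G.regret μ T ℓ p x.1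

/-- `min_{p* ∈ 𝒫} 𝔼 ∑_{t ≤ T} ⟨ℓ_t, p*⟩`. -/
def bestLoss : ℝ := ⨅ x : G.paths, ∫ ω, ∑ t ∈ Finset.Icc 1 T, G.dot (ℓ t ω) x.1 ∂μ

/-- `E' = E ∖ Im π*`, that is, the union over `v ∈ V ∪ {s}` of `∂₊ v ∖ {π*(v)}`. -/
def offPolicy (π : {v : W // v ≠ G.g} → G.Edge) : Finset G.Edge :=
  Finset.univ.filter fun e => e ≠ π (G.tail e)

/-- `π* : V ∪ {s} → E` picks an outgoing edge at every vertex, and at the vertices of the path `p*`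
it picks the edge of `p*`. -/
def IsConsistent (pstar : G.Edge → ℝ) (π : {v : W // v ≠ G.g} → G.Edge) : Prop :=
  (∀ v, G.tail (π v) = v) ∧ ∀ e, pstar e = 1 → π (G.tail e) = e

/-- The `(p*, π*, Δ, C)`-self-bounding regime. -/
structure IsSelfBounding (pstar : G.Edge → ℝ) (π : {v : W // v ≠ G.g} → G.Edge)
    (Δ : G.Edge → ℝ) (C : ℝ) : Prop where
  path_mem : pstar ∈ G.paths
  consistent : G.IsConsistent pstar π
  gap_mem : ∀ e, Δ e ∈ Set.Icc (0 : ℝ) 1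
  gap_pos : ∀ e ∈ G.offPolicy π, 0 < Δ e
  corruption_nonneg : 0 ≤ C
  bound : (∫ ω, ∑ t ∈ Finset.Icc 1 T, ∑ e ∈ G.offPolicy π, Δ e * p t ω e ∂μ) - C
    ≤ G.regret μ T ℓ p pstar

end regret

/-- `Δ_min = min_{e ∈ E'} Δ(e)` (zero when `E'` is empty). -/
def gapMin (π : {v : W // v ≠ G.g} → G.Edge) (Δ : G.Edge → ℝ) : ℝ :=
  ⨅ e : {e // e ∈ G.offPolicy π}, Δ e.1

/-- `Δ^*`, the minimum of `Δ(e)` over those `e ∈ E'` that leave a vertex of the path `p*` (zero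
when there is no such edge). -/
def gapStar (pstar : G.Edge → ℝ) (π : {v : W // v ≠ G.g} → G.Edge) (Δ : G.Edge → ℝ) : ℝ :=
  ⨅ e : {e // e ∈ G.offPolicy π ∧ G.outflow pstar (G.tail e) = 1}, Δ e.1

/-- `∑_{e ∈ E'} log T / Δ(e)`. -/
def gapSum (T : ℕ) (π : {v : W // v ≠ G.g} → G.Edge) (Δ : G.Edge → ℝ) : ℝ :=
  ∑ e ∈ G.offPolicy π, Real.log T / Δ e

end STDag

end

/-! The loss estimator is a score. Paired with a flow `y` it equals `c ⟨σ, p⟩`, where `σ(e) =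
y(e)/q(e) - y(e₋)/q(e₋)` (`dot_lossEst`), and a backward recursion over the graph gives this the
conditional mean `⟨ℓ, y - q⟩` (`walkMean_score`); for `y = q` it vanishes identically. Hence the
regret against a fixed flow is exactly the expected regret of follow-the-regularized-leader on the
estimated losses (`IsInteraction.regret_eq`), and that is bounded outcome by outcome
(`ftrl_regret`).

Write `r(e) = q(e)/q(e₋)`. The product `q(e) ℓ̂(e)` lies in `[-1, 1]` and its square is `ρ(e)`. With
a log-barrier of weight at least 2 the stability cost is therefore of order `ρ(e)/w(e)`, or
`ρ(e)/(√t √q(e))` with the Tsallis part. The conditional mean of `ρ(e)` is at most `q(e)(1 - r(e))`,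
the variance of the choice made at `e₋`, and this is bounded by the mass of the siblings of `e`. So
the edges of `π*` cost no more than those of `E'`.

For Tsallis, summation by parts leaves the differences `Σ √q_t(e) - Σ p*(e)` with weights at most
`1/√t`. In the self-bounding regime, edges of `π*` on `p*` contribute nothing positive, and at each
of the at most `n` vertices off `p*` the mass is bounded by the mass that has left `p*`; this
produces the term `n²/Δ*`. In the worst case `Σ √q ≤ √(mL)` suffices.

For the log-barrier, the adaptive rate brings penalty and stability both to the order of `m log T +
Σ_e √(log T Σ_t ρ_t(e))`. The bound `Σ_e ρ_t(e) ≤ 2 L c_t²` yields the data-dependent bounds, and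
the variance bound yields the self-bounding one.

Self-bounding (and likewise the bound in the loss of the best path) ends with Cauchy–Schwarz or
Jensen and the inequality `R ≲ √(U(R + C)) + D`, which is solved for `R`. Since a path has zero
coordinates, where the regularizer is infinite, the comparator is always mixed with a positive flow
at small weight. The worst-case bounds are proved with `T` in place of `n + T`, which is stronger.
-/

set_option linter.unusedSectionVars false

namespace STDag

/-! ### Walks in an acyclic graph and means over sampled walks -/

section Graph

variable {W : Type*}

theorem IsWalk.append {E : Finset (W × W)} {u v w : W} {l₁ l₂ : List {e // e ∈ E}}
    (h₁ : IsWalk E u v l₁) (h₂ : IsWalk E v w l₂) : IsWalk E u w (l₁ ++ l₂) := by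
  induction h₁ with
  | nil v => simpa using h₂
  | cons e h ih => exact IsWalk.cons e (ih h₂)

theorem isWalk_cons_iff {E : Finset (W × W)} {u w : W} {e : {e // e ∈ E}}
    {l : List {e // e ∈ E}} : IsWalk E u w (e :: l) ↔ e.1.1 = u ∧ IsWalk E e.1.2 w l := by
  constructor
  · intro h
    cases h with
    | cons e h => exact ⟨rfl, h⟩
  · rintro ⟨rfl, h⟩
    exact IsWalk.cons e h

theorem isWalk_nil_iff {E : Finset (W × W)} {u w : W} : IsWalk E u w [] ↔ u = w := by
  constructor
  · intro h
    cases h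
    rfl
  · rintro rfl
    exact IsWalk.nil u

/-- A walk can be cut at the initial vertex of each of its edges. -/
theorem IsWalk.exists_prefix {E : Finset (W × W)} {u w : W} {l : List {e // e ∈ E}}
    (h : IsWalk E u w l) : ∀ f ∈ l, ∃ l', IsWalk E u f.1.1 l' := by
  induction h with
  | nil v => simp
  | cons e h ih =>
    intro f hf
    rcases List.mem_cons.1 hf with rfl | hf
    · exact ⟨[], IsWalk.nil _⟩
    · obtain ⟨l', hl'⟩ := ih f hf
      exact ⟨e :: l', IsWalk.cons e hl'⟩

variable (G : STDag W)

/-- No edge of the rest of a walk starts where its first edge starts. -/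
theorem fst_ne_of_mem_walk {e : G.Edge} {w : W} {l : List G.Edge}
    (h : IsWalk G.edges e.1.2 w l) : ∀ f ∈ l, f.1.1 ≠ e.1.1 := by
  intro f hf hfe
  obtain ⟨l', hl'⟩ := IsWalk.exists_prefix h f hf
  rw [hfe] at hl'
  exact absurd (G.acyclic _ _ (IsWalk.cons e hl')) (by simp)

theorem notMem_of_walk {e : G.Edge} {w : W} {l : List G.Edge}
    (h : IsWalk G.edges e.1.2 w l) : e ∉ l := fun he => G.fst_ne_of_mem_walk h e he rfl

theorem IsWalk.nodup {u w : W} {l : List G.Edge} (h : IsWalk G.edges u w l) : l.Nodup := by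
  induction h with
  | nil v => simp
  | cons e h ih => exact List.nodup_cons.2 ⟨G.notMem_of_walk h, ih⟩

theorem walk_sink {w : W} {l : List G.Edge} (h : IsWalk G.edges G.g w l) : l = [] := by
  cases l with
  | nil => rfl
  | cons e l => exact absurd (isWalk_cons_iff.1 h).1 (G.src_ne e.1 e.2)

/-- Induction along the edges, from the sink upwards. -/
theorem backward_induction [Finite W] {P : W → Prop}
    (h : ∀ v, (∀ e : G.Edge, e.1.1 = v → P e.1.2) → P v) (v : W) : P v := by
  -- Reachability by a nonempty walk is transitive, and irreflexive by acyclicity, hence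
  -- well-founded on a finite vertex set.
  let R : W → W → Prop := fun u v => ∃ l, l ≠ [] ∧ IsWalk G.edges v u l
  have : IsTrans W R := ⟨fun a b c ⟨l, hl, h1⟩ ⟨l', _, h2⟩ =>
    ⟨l' ++ l, by simp [hl], IsWalk.append h2 h1⟩⟩
  have : Std.Irrefl R := ⟨fun a ⟨l, hl, h1⟩ => hl (G.acyclic _ _ h1)⟩
  have wf : WellFounded R := Finite.wellFounded_of_trans_of_irrefl R
  refine wf.induction v fun v ih => h v fun e he => ih _ ⟨[e], by simp, ?_⟩
  rw [← he]
  exact IsWalk.cons e (IsWalk.nil _)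

variable [DecidableEq W]

theorem finite_walks (v : W) : {l | IsWalk G.edges v G.g l}.Finite := by
  have : Finite ↑{l : List G.Edge | l.Nodup} :=
    inferInstanceAs (Finite {l : List G.Edge // l.Nodup})
  refine (Set.toFinite {l : List G.Edge | l.Nodup}).subset fun l hl => ?_
  exact IsWalk.nodup G hl

/-- The walks from `v` to the sink. -/
noncomputable def walks (v : W) : Finset (List G.Edge) := (G.finite_walks v).toFinset

@[simp] theorem mem_walks {v : W} {l : List G.Edge} :
    l ∈ G.walks v ↔ IsWalk G.edges v G.g l := by simp [walks]

theorem walks_sink : G.walks G.g = {[]} := by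
  ext l
  rw [mem_walks, Finset.mem_singleton]
  exact ⟨fun h => G.walk_sink h, fun h => h ▸ IsWalk.nil _⟩

theorem pathVec_cons {e : G.Edge} {w : W} {l : List G.Edge} (h : IsWalk G.edges e.1.2 w l)
    (f : G.Edge) : G.pathVec (e :: l) f = (if f = e then 1 else 0) + G.pathVec l f := by
  have := G.notMem_of_walk h
  by_cases hf : f = e
  · subst hf
    simp [pathVec, this]
  · simp [pathVec, hf]

theorem dot_pathVec_cons {e : G.Edge} {w : W} {l : List G.Edge}
    (h : IsWalk G.edges e.1.2 w l) (a : G.Edge → ℝ) :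
    G.dot a (G.pathVec (e :: l)) = a e + G.dot a (G.pathVec l) := by
  simp only [dot, G.pathVec_cons h, mul_add, Finset.sum_add_distrib]
  simp

theorem dot_pathVec_nil (a : G.Edge → ℝ) : G.dot a (G.pathVec []) = 0 := by
  simp [dot, pathVec]

/-- The expectation of `φ` over the walk sampled from `v` on. -/
noncomputable def walkMean (x : G.Edge → ℝ) (v : W) (φ : List G.Edge → ℝ) : ℝ :=
  ∑ l ∈ G.walks v, G.walkProb x l * φ l

theorem walkMean_sink (x : G.Edge → ℝ) (φ : List G.Edge → ℝ) :
    G.walkMean x G.g φ = φ [] := by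
  simp [walkMean, walks_sink, walkProb]

theorem tail_eq_iff {e : G.Edge} {v : {v : W // v ≠ G.g}} : G.tail e = v ↔ e.1.1 = v.1 :=
  Subtype.ext_iff

theorem walks_eq_biUnion (v : {v : W // v ≠ G.g}) :
    G.walks v = (Finset.univ.filter fun e : G.Edge => G.tail e = v).biUnion
      fun e => (G.walks e.1.2).image (List.cons e) := by
  ext l
  simp only [mem_walks, Finset.mem_biUnion, Finset.mem_filter, Finset.mem_univ, true_and,
    Finset.mem_image, tail_eq_iff]
  constructor
  · intro h
    cases l with
    | nil => exact absurd (isWalk_nil_iff.1 h) v.2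
    | cons e l =>
      obtain ⟨h1, h2⟩ := isWalk_cons_iff.1 h
      exact ⟨e, h1, l, h2, rfl⟩
  · rintro ⟨e, he, l, hl, rfl⟩
    exact isWalk_cons_iff.2 ⟨he, hl⟩

/-- First-step analysis of the sampling chain. All later means are computed from this recursion by
induction from the sink. -/
theorem walkMean_step (x : G.Edge → ℝ) (v : {v : W // v ≠ G.g}) (φ : List G.Edge → ℝ) :
    G.walkMean x v φ = ∑ e : G.Edge with G.tail e = v,
      x e / G.outflow x (G.tail e) * G.walkMean x e.1.2 (fun l => φ (e :: l)) := by
  rw [walkMean, walks_eq_biUnion, Finset.sum_biUnion]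
  · refine Finset.sum_congr rfl fun e _ => ?_
    rw [Finset.sum_image (by intro a _ b _ h; simpa using h), walkMean, Finset.mul_sum]
    refine Finset.sum_congr rfl fun l _ => ?_
    simp only [walkProb, List.map_cons, List.prod_cons]
    ring
  · intro e _ f _ hef
    simp only [Function.onFun, Finset.disjoint_left, Finset.mem_image]
    rintro _ ⟨l, _, rfl⟩ ⟨l', _, h⟩
    exact hef (by simpa using (List.cons.inj h).1.symm)

theorem walkMean_congr {x : G.Edge → ℝ} {v : W} {φ φ' : List G.Edge → ℝ}
    (h : ∀ l, IsWalk G.edges v G.g l → φ l = φ' l) : G.walkMean x v φ = G.walkMean x v φ' :=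
  Finset.sum_congr rfl fun l hl => by rw [h l (G.mem_walks.1 hl)]

theorem walkMean_add (x : G.Edge → ℝ) (v : W) (φ φ' : List G.Edge → ℝ) :
    G.walkMean x v (fun l => φ l + φ' l) = G.walkMean x v φ + G.walkMean x v φ' := by
  simp [walkMean, mul_add, Finset.sum_add_distrib]

theorem walkMean_const_mul (x : G.Edge → ℝ) (v : W) (a : ℝ) (φ : List G.Edge → ℝ) :
    G.walkMean x v (fun l => a * φ l) = a * G.walkMean x v φ := by
  simp only [walkMean, Finset.mul_sum]
  exact Finset.sum_congr rfl fun l _ => by ring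

end Graph

/-! ### Flows, potentials and the score identity -/

section Flow

variable {W : Type*} (G : STDag W) [DecidableEq W]

theorem pathVec_mem_Icc (l : List G.Edge) (e : G.Edge) : G.pathVec l e ∈ Set.Icc (0 : ℝ) 1 := by
  unfold pathVec
  split_ifs <;> simp

theorem telescope_walk {u w : W} {l : List G.Edge} (h : IsWalk G.edges u w l) (V : W → ℝ) :
    ∑ e, G.pathVec l e * (V e.1.1 - V e.1.2) = V u - V w := by
  induction h with
  | nil v => simp [pathVec]
  | cons e h ih =>
    simp only [G.pathVec_cons h, add_mul, Finset.sum_add_distrib, ih]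
    simp

/-- A property of vectors that is preserved by convex combinations and holds for paths holds for
flows. -/
theorem flows_induction {P : (G.Edge → ℝ) → Prop} (hc : Convex ℝ {x | P x})
    (h : ∀ l, IsWalk G.edges G.s G.g l → P (G.pathVec l)) {x : G.Edge → ℝ} (hx : x ∈ G.flows) :
    P x := by
  have : G.flows ⊆ {x | P x} := convexHull_min (by rintro _ ⟨l, hl, rfl⟩; exact h l hl) hc
  exact this hx

theorem paths_subset_flows : G.paths ⊆ G.flows := subset_convexHull ℝ _

theorem convex_flows : Convex ℝ G.flows := convex_convexHull ℝ _

theorem mem_Icc_of_mem_flows {x : G.Edge → ℝ} (hx : x ∈ G.flows) (e : G.Edge) :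
    x e ∈ Set.Icc (0 : ℝ) 1 := by
  refine G.flows_induction (P := fun x => x e ∈ Set.Icc (0 : ℝ) 1) ?_
    (fun l _ => G.pathVec_mem_Icc l e) hx
  exact (convex_Icc (0 : ℝ) 1).is_linear_preimage (f := fun x : G.Edge → ℝ => x e)
    ⟨fun _ _ => rfl, fun _ _ => rfl⟩

/-- Every flow turns potentials into the difference between source and sink. -/
theorem telescope {x : G.Edge → ℝ} (hx : x ∈ G.flows) (V : W → ℝ) :
    ∑ e, x e * (V e.1.1 - V e.1.2) = V G.s - V G.g := by
  refine G.flows_induction (P := fun x => ∑ e, x e * (V e.1.1 - V e.1.2) = V G.s - V G.g) ?_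
    (fun l hl => G.telescope_walk hl V) hx
  exact (convex_singleton (V G.s - V G.g)).is_linear_preimage
    (f := fun x : G.Edge → ℝ => ∑ e, x e * (V e.1.1 - V e.1.2))
    ⟨fun x y => by simp [add_mul, Finset.sum_add_distrib],
      fun c x => by simp [Finset.mul_sum, mul_assoc]⟩

theorem dot_le_of_forall_paths {a : G.Edge → ℝ} {b : ℝ} (h : ∀ x ∈ G.paths, G.dot a x ≤ b)
    {x : G.Edge → ℝ} (hx : x ∈ G.flows) : G.dot a x ≤ b := by
  refine G.flows_induction (P := fun x => G.dot a x ≤ b) ?_ (fun l hl => h _ ⟨l, hl, rfl⟩) hx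
  exact (convex_Iic b).is_linear_preimage (f := fun x : G.Edge → ℝ => G.dot a x)
    ⟨fun x y => by simp [dot, mul_add, Finset.sum_add_distrib],
      fun c x => by simp [dot, Finset.mul_sum, mul_left_comm]⟩

theorem sum_eq_sum_tail [Fintype W] (f : G.Edge → ℝ) :
    ∑ e, f e = ∑ v, ∑ e with G.tail e = v, f e :=
  (Finset.sum_fiberwise _ _ _).symm

theorem sum_mul_outflow [Fintype W] (x : G.Edge → ℝ) (a : {v : W // v ≠ G.g} → ℝ) :
    ∑ e, x e * a (G.tail e) = ∑ v, G.outflow x v * a v := by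
  rw [sum_eq_sum_tail]
  refine Finset.sum_congr rfl fun v _ => ?_
  rw [outflow, Finset.sum_mul]
  refine Finset.sum_congr rfl fun e he => ?_
  rw [(Finset.mem_filter.1 he).2]

theorem outflow_nonneg {x : G.Edge → ℝ} (hx : ∀ e, 0 ≤ x e) (v : {v : W // v ≠ G.g}) :
    0 ≤ G.outflow x v := Finset.sum_nonneg fun e _ => hx e

theorem le_outflow {x : G.Edge → ℝ} (hx : ∀ e, 0 ≤ x e) (e : G.Edge) :
    x e ≤ G.outflow x (G.tail e) :=
  Finset.single_le_sum (f := x) (fun e _ => hx e) (by simp)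

theorem outflow_pathVec_mem {u w : W} {l : List G.Edge} (h : IsWalk G.edges u w l)
    (v : {v : W // v ≠ G.g}) : G.outflow (G.pathVec l) v = 0 ∨ G.outflow (G.pathVec l) v = 1 := by
  induction h with
  | nil v => simp [outflow, pathVec]
  | @cons e w l h ih =>
    have hadd : G.outflow (G.pathVec (e :: l)) v
        = (if G.tail e = v then 1 else 0) + G.outflow (G.pathVec l) v := by
      simp only [outflow, G.pathVec_cons h, Finset.sum_add_distrib]
      simp
    rw [hadd]
    split_ifs with hv
    · have : G.outflow (G.pathVec l) v = 0 := by
        refine Finset.sum_eq_zero fun f hf => ?_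
        have hfv := (Finset.mem_filter.1 hf).2
        have : f ∉ l := fun hfl => G.fst_ne_of_mem_walk h f hfl
          (congrArg Subtype.val (hfv.trans hv.symm))
        simp [pathVec, this]
      simp [this]
    · simpa using ih

theorem outflow_le_one {x : G.Edge → ℝ} (hx : x ∈ G.flows) (v : {v : W // v ≠ G.g}) :
    G.outflow x v ≤ 1 := by
  refine G.flows_induction (P := fun x => G.outflow x v ≤ 1) ?_ (fun l hl => ?_) hx
  · exact (convex_Iic (1 : ℝ)).is_linear_preimage (f := fun x : G.Edge → ℝ => G.outflow x v)
      ⟨fun x y => by simp [outflow, Finset.sum_add_distrib],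
        fun c x => by simp [outflow, Finset.mul_sum]⟩
  · rcases G.outflow_pathVec_mem hl v with h | h <;> rw [h]; norm_num

theorem exists_tail_eq (hP : G.paths.Nonempty) (v : {v : W // v ≠ G.g}) :
    ∃ e, G.tail e = v := by
  have : ∃ l, IsWalk G.edges v.1 G.g l := by
    by_cases hs : v.1 = G.s
    · obtain ⟨_, l, hl, _⟩ := hP
      exact ⟨l, hs ▸ hl⟩
    · obtain ⟨_, l, _, hl⟩ := G.through v.1 hs v.2
      exact ⟨l, hl⟩
  obtain ⟨l, hl⟩ := this
  cases l with
  | nil => exact absurd (isWalk_nil_iff.1 hl) v.2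
  | cons e l => exact ⟨e, G.tail_eq_iff.2 (isWalk_cons_iff.1 hl).1⟩

theorem outflow_pos (hP : G.paths.Nonempty) {x : G.Edge → ℝ} (hx : ∀ e, 0 < x e)
    (v : {v : W // v ≠ G.g}) : 0 < G.outflow x v := by
  obtain ⟨e, rfl⟩ := G.exists_tail_eq hP v
  exact (hx e).trans_le (G.le_outflow (fun e => (hx e).le) e)

/-- The estimated loss of `y` is the score of the sampled path in the direction `y`. -/
theorem dot_lossEst [Fintype W] (c : ℝ) (p q y : G.Edge → ℝ) :
    G.dot (G.lossEst c p q) y = c * G.dot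
      (fun e => y e / q e - G.outflow y (G.tail e) / G.outflow q (G.tail e)) p := by
  have h1 := G.sum_mul_outflow y (fun v => G.outflow p v / G.outflow q v)
  have h2 := G.sum_mul_outflow p (fun v => G.outflow y v / G.outflow q v)
  have h3 : ∑ v, G.outflow y v * (G.outflow p v / G.outflow q v)
      = ∑ v, G.outflow p v * (G.outflow y v / G.outflow q v) :=
    Finset.sum_congr rfl fun v _ => by ring
  simp only [dot, lossEst, mul_sub, sub_mul, Finset.sum_sub_distrib]
  simp only [mul_assoc, ← Finset.mul_sum, ← mul_sub]
  congr 2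
  · exact Finset.sum_congr rfl fun e _ => by ring
  · calc _ = ∑ e, y e * (G.outflow p (G.tail e) / G.outflow q (G.tail e)) :=
        Finset.sum_congr rfl fun e _ => by ring
      _ = _ := by rw [h1, h3, ← h2]; exact Finset.sum_congr rfl fun e _ => by ring

theorem dot_lossEst_self [Fintype W] {q : G.Edge → ℝ} (hq : ∀ e, 0 < q e) (c : ℝ)
    (p : G.Edge → ℝ) : G.dot (G.lossEst c p q) q = 0 := by
  have h0 : ∀ e, G.outflow q (G.tail e) ≠ 0 := fun e =>
    ((hq e).trans_le (G.le_outflow (fun e => (hq e).le) e)).ne'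
  rw [dot_lossEst]
  simp [dot, div_self (hq _).ne', div_self (h0 _)]

section Mean

variable [Fintype W] {q : G.Edge → ℝ}

theorem sum_ratio (hP : G.paths.Nonempty) (hq : ∀ e, 0 < q e) (v : {v : W // v ≠ G.g}) :
    ∑ e with G.tail e = v, q e / G.outflow q (G.tail e) = 1 := by
  have : ∑ e with G.tail e = v, q e / G.outflow q (G.tail e)
      = ∑ e with G.tail e = v, q e / G.outflow q v :=
    Finset.sum_congr rfl fun e he => by rw [(Finset.mem_filter.1 he).2]
  rw [this, ← Finset.sum_div]
  exact div_self (G.outflow_pos hP hq v).ne'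

theorem walkMean_one (hP : G.paths.Nonempty) (hq : ∀ e, 0 < q e) (v : W) :
    G.walkMean q v (fun _ => 1) = 1 := by
  induction v using G.backward_induction with
  | h v ih =>
    by_cases hv : v = G.g
    · subst hv
      rw [walkMean_sink]
    · refine (G.walkMean_step q ⟨v, hv⟩ _).trans
        ((Finset.sum_congr rfl fun e he => ?_).trans (G.sum_ratio hP hq ⟨v, hv⟩))
      rw [ih e (G.tail_eq_iff.1 (Finset.mem_filter.1 he).2), mul_one]

theorem walkMean_const (hP : G.paths.Nonempty) (hq : ∀ e, 0 < q e) (v : W) (a : ℝ) :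
    G.walkMean q v (fun _ => a) = a := by
  simpa only [walkMean_one G hP hq, mul_one] using G.walkMean_const_mul q v a (fun _ => 1)

/-- A solution of the backward recursion with edge costs `a` has the value `⟨a, q⟩` at the
source. -/
theorem value_eq_dot (hP : G.paths.Nonempty) (hq : ∀ e, 0 < q e) (hf : q ∈ G.flows)
    {J : W → ℝ} {a : G.Edge → ℝ} (hg : J G.g = 0)
    (hJ : ∀ v : {v : W // v ≠ G.g}, J v = ∑ e with G.tail e = v,
      q e / G.outflow q (G.tail e) * (a e + J e.1.2)) : J G.s = G.dot a q := by
  have h1 := G.telescope hf J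
  rw [hg, sub_zero] at h1
  -- The recursion at `v` is weighted by `q(v)` and summed over `v`; telescoping the potential `J`
  -- along `q` then leaves only the edge costs.
  have h2 : ∑ e, q e * J e.1.1 = ∑ e, q e * (a e + J e.1.2) := by
    rw [show ∑ e, q e * J e.1.1 = _ from G.sum_mul_outflow q (fun v => J v),
      G.sum_eq_sum_tail (fun e => q e * (a e + J e.1.2))]
    refine Finset.sum_congr rfl fun v _ => ?_
    rw [hJ v, Finset.mul_sum]
    refine Finset.sum_congr rfl fun e he => ?_
    rw [(Finset.mem_filter.1 he).2]
    have := (G.outflow_pos hP hq v).ne'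
    field_simp
  rw [← h1, dot]
  simp only [mul_sub, Finset.sum_sub_distrib, h2, mul_add, Finset.sum_add_distrib]
  rw [add_sub_cancel_right]
  exact Finset.sum_congr rfl fun e _ => mul_comm _ _

theorem walkMean_dot_step (hP : G.paths.Nonempty) (hq : ∀ e, 0 < q e) (a : G.Edge → ℝ)
    (v : {v : W // v ≠ G.g}) :
    G.walkMean q v (fun l => G.dot a (G.pathVec l)) = ∑ e with G.tail e = v,
      q e / G.outflow q (G.tail e) *
        (a e + G.walkMean q e.1.2 (fun l => G.dot a (G.pathVec l))) := by
  rw [walkMean_step]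
  refine Finset.sum_congr rfl fun e _ => ?_
  rw [G.walkMean_congr (φ' := fun l => a e + G.dot a (G.pathVec l))
    (fun l hl => G.dot_pathVec_cons hl a), walkMean_add, G.walkMean_const hP hq]

/-- The flow `q` is the mean of the path that is sampled from it. -/
theorem walkMean_dot (hP : G.paths.Nonempty) (hq : ∀ e, 0 < q e) (hf : q ∈ G.flows)
    (a : G.Edge → ℝ) : G.walkMean q G.s (fun l => G.dot a (G.pathVec l)) = G.dot a q :=
  G.value_eq_dot hP hq hf (J := fun v => G.walkMean q v (fun l => G.dot a (G.pathVec l)))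
    (by simp only [walkMean_sink, dot_pathVec_nil]) (G.walkMean_dot_step hP hq a)

/-- The score in the direction `y`, weighted with the loss of the sampled path, has the mean
`⟨a, y - q⟩`. -/
theorem walkMean_score (hP : G.paths.Nonempty) (hq : ∀ e, 0 < q e) (hf : q ∈ G.flows)
    {y : G.Edge → ℝ} (hy : y ∈ G.flows) (a : G.Edge → ℝ) :
    G.walkMean q G.s (fun l => G.dot a (G.pathVec l) * G.dot
      (fun e => y e / q e - G.outflow y (G.tail e) / G.outflow q (G.tail e)) (G.pathVec l))
      = G.dot a y - G.dot a q := by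
  set σ : G.Edge → ℝ := fun e => y e / q e - G.outflow y (G.tail e) / G.outflow q (G.tail e)
    with hσ
  set V : W → ℝ := fun v => G.walkMean q v (fun l => G.dot a (G.pathVec l)) with hV
  have hVg : V G.g = 0 := by simp only [hV, walkMean_sink, dot_pathVec_nil]
  have hσq : ∀ e, q e / G.outflow q (G.tail e) * σ e =
      y e / G.outflow q (G.tail e) - q e / G.outflow q (G.tail e) *
        (G.outflow y (G.tail e) / G.outflow q (G.tail e)) := fun e => by
    have := (hq e).ne'
    have := (G.outflow_pos hP hq (G.tail e)).ne'
    simp only [hσ]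
    field_simp
  have hσ0 : ∀ v, ∑ e with G.tail e = v, q e / G.outflow q (G.tail e) * σ e = 0 := by
    intro v
    have h1 := G.sum_ratio hP hq v
    have h2 : ∑ e with G.tail e = v, q e / G.outflow q (G.tail e) * σ e
        = ∑ e with G.tail e = v, (y e / G.outflow q v - q e / G.outflow q (G.tail e) *
          (G.outflow y v / G.outflow q v)) :=
      Finset.sum_congr rfl fun e he => by rw [hσq, (Finset.mem_filter.1 he).2]
    rw [h2, Finset.sum_sub_distrib, ← Finset.sum_mul, h1, ← Finset.sum_div, one_mul]
    exact sub_self _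
  -- The score increments average to zero at each vertex, so the future score has mean zero from
  -- every vertex, not only from the source.
  have hN : ∀ v, G.walkMean q v (fun l => G.dot σ (G.pathVec l)) = 0 := by
    intro v
    induction v using G.backward_induction with
    | h v ih =>
      by_cases hv : v = G.g
      · subst hv
        simp only [walkMean_sink, dot_pathVec_nil]
      · rw [G.walkMean_dot_step hP hq σ ⟨v, hv⟩, ← hσ0 ⟨v, hv⟩]
        refine Finset.sum_congr rfl fun e he => ?_
        rw [ih e (G.tail_eq_iff.1 (Finset.mem_filter.1 he).2), add_zero]
  -- In the recursion for the product of the two path sums, `a(e)` times the future score averages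
  -- to zero. What remains is the product from `e₊` on and the edge cost `σ(e)(a(e) + V(e₊))`.
  have key := G.value_eq_dot hP hq hf
    (J := fun v => G.walkMean q v
      (fun l => G.dot a (G.pathVec l) * G.dot σ (G.pathVec l)))
    (a := fun e => σ e * (a e + V e.1.2))
    (by simp only [walkMean_sink, dot_pathVec_nil, mul_zero]) (by
      intro v
      rw [walkMean_step]
      refine Finset.sum_congr rfl fun e _ => ?_
      rw [G.walkMean_congr (φ' := fun l => (a e * σ e + σ e * G.dot a (G.pathVec l))
        + (a e * G.dot σ (G.pathVec l) + G.dot a (G.pathVec l) * G.dot σ (G.pathVec l)))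
        (fun l hl => by rw [G.dot_pathVec_cons hl a, G.dot_pathVec_cons hl σ]; ring),
        walkMean_add, walkMean_add, walkMean_add, walkMean_const_mul, walkMean_const_mul,
        walkMean_const_mul, G.walkMean_const hP hq, hN]
      simp only [hV]
      ring)
  rw [key, dot]
  have h1 : ∀ e, σ e * (a e + V e.1.2) * q e = y e * (a e + V e.1.2)
      - q e / G.outflow q (G.tail e) * (a e + V e.1.2) * G.outflow y (G.tail e) := fun e => by
    have := (hq e).ne'
    have := (G.outflow_pos hP hq (G.tail e)).ne'
    simp only [hσ]
    field_simp
  -- This is the Bellman equation of `V` averaged over the vertex masses of `y`. Telescoping `V`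
  -- along `y` then turns the sum into `⟨a, y⟩ - ⟨a, q⟩`, a performance-difference identity.
  have h2 : ∑ e, q e / G.outflow q (G.tail e) * (a e + V e.1.2) * G.outflow y (G.tail e)
      = ∑ e, y e * V e.1.1 := by
    rw [show ∑ e, y e * V e.1.1 = _ from G.sum_mul_outflow y (fun v => V v), G.sum_eq_sum_tail]
    refine Finset.sum_congr rfl fun v _ => ?_
    rw [show V v = _ from G.walkMean_dot_step hP hq a v, Finset.mul_sum]
    refine Finset.sum_congr rfl fun e he => ?_
    rw [(Finset.mem_filter.1 he).2]
    ring
  have h3 := G.telescope hy V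
  have h4 : V G.s = G.dot a q := G.walkMean_dot hP hq hf a
  simp only [h1, Finset.sum_sub_distrib, h2]
  rw [hVg, sub_zero, h4] at h3
  rw [← h3]
  simp only [dot, mul_add, mul_sub, Finset.sum_add_distrib, Finset.sum_sub_distrib]
  simp only [mul_comm (a _)]
  ring

end Mean

end Flow

/-! ### Combinatorics of paths relative to `p*` and `π*` -/

section Policy

variable {W : Type*} (G : STDag W) [DecidableEq W]

/-- By acyclicity the first edge is the only edge of a walk that starts at its initial vertex, so
the edge set determines the walk step by step. This makes the indicator vectors faithful. -/
theorem walk_eq_of_mem_iff {u : W} {l l' : List G.Edge} (h : IsWalk G.edges u G.g l)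
    (h' : IsWalk G.edges u G.g l') (hl : ∀ e, e ∈ l ↔ e ∈ l') : l = l' := by
  induction l generalizing u l' with
  | nil =>
    cases l' with
    | nil => rfl
    | cons f l' => exact absurd ((hl f).2 (by simp)) (by simp)
  | cons e l ih =>
    cases l' with
    | nil => exact absurd ((hl e).1 (by simp)) (by simp)
    | cons f l' =>
      obtain ⟨rfl, h1⟩ := isWalk_cons_iff.1 h
      obtain ⟨h2, h3⟩ := isWalk_cons_iff.1 h'
      have hef : e = f := by
        rcases List.mem_cons.1 ((hl e).1 (by simp)) with hm | hm
        · exact hm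
        · exact absurd h2.symm (G.fst_ne_of_mem_walk h3 e hm)
      subst hef
      rw [ih h1 h3 fun d => ?_]
      have hd := hl d
      simp only [List.mem_cons] at hd
      by_cases hde : d = e
      · subst hde
        exact iff_of_false (G.notMem_of_walk h1) (G.notMem_of_walk h3)
      · simpa [hde] using hd

theorem pathVec_injOn {l l' : List G.Edge} (h : IsWalk G.edges G.s G.g l)
    (h' : IsWalk G.edges G.s G.g l') (hl : G.pathVec l = G.pathVec l') : l = l' := by
  refine G.walk_eq_of_mem_iff h h' fun e => ?_
  have := congrFun hl e
  simp only [pathVec] at this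
  split_ifs at this <;> simp_all

theorem finite_paths : G.paths.Finite := by
  refine ((G.walks G.s).finite_toSet.image G.pathVec).subset ?_
  rintro _ ⟨l, hl, rfl⟩
  exact ⟨l, by simpa using hl, rfl⟩

theorem zero_or_one_of_mem_paths {x : G.Edge → ℝ} (hx : x ∈ G.paths) (e : G.Edge) :
    x e = 0 ∨ x e = 1 := by
  obtain ⟨l, _, rfl⟩ := hx
  unfold pathVec
  split_ifs <;> simp

theorem sum_le_L {x : G.Edge → ℝ} (hx : x ∈ G.flows) : ∑ e, x e ≤ G.L := by
  have hfin := G.finite_paths.to_subtype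
  have := G.dot_le_of_forall_paths (a := fun _ => 1) (b := G.L) (fun x hx => ?_) hx
  · simpa [dot] using this
  · have := le_ciSup (f := fun x : G.paths => ∑ e, x.1 e) (Set.finite_range _).bddAbove ⟨x, hx⟩
    simpa [dot, L] using this

theorem outflow_source {x : G.Edge → ℝ} (hx : x ∈ G.flows) :
    G.outflow x ⟨G.s, G.s_ne_g⟩ = 1 := by
  have h := G.telescope hx (fun v => if v = G.s then 1 else 0)
  rw [outflow, Finset.sum_filter]
  simp only [if_true, if_neg G.s_ne_g.symm, sub_zero] at h
  rw [← h]
  refine Finset.sum_congr rfl fun e _ => ?_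
  rw [if_neg (G.tgt_ne e.1 e.2), sub_zero, mul_ite, mul_one, mul_zero]
  simp only [tail_eq_iff]

/-- Flow conservation: telescoping the indicator of `e₊` equates inflow and outflow there. -/
theorem le_outflow_tgt {x : G.Edge → ℝ} (hx : x ∈ G.flows) (e : G.Edge) (he : e.1.2 ≠ G.g) :
    x e ≤ G.outflow x ⟨e.1.2, he⟩ := by
  have h := G.telescope hx (fun v => if v = e.1.2 then 1 else 0)
  rw [if_neg (G.tgt_ne e.1 e.2).symm, if_neg he.symm, sub_zero] at h
  simp only [mul_sub, Finset.sum_sub_distrib, mul_ite, mul_one, mul_zero] at h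
  rw [outflow, Finset.sum_filter]
  simp only [tail_eq_iff]
  rw [sub_eq_zero.1 h]
  have := Finset.single_le_sum (f := fun f : G.Edge => if f.1.2 = e.1.2 then x f else 0)
    (fun f _ => by split_ifs; exacts [(G.mem_Icc_of_mem_flows hx f).1, le_rfl])
    (Finset.mem_univ e)
  simpa using this

theorem one_le_L (hP : G.paths.Nonempty) : 1 ≤ G.L := by
  obtain ⟨x, hx⟩ := hP
  have hx := G.paths_subset_flows hx
  rw [← G.outflow_source hx]
  refine le_trans ?_ (G.sum_le_L hx)
  exact Finset.sum_le_sum_of_subset_of_nonneg (Finset.subset_univ _)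
    fun e _ _ => (G.mem_Icc_of_mem_flows hx e).1

theorem exists_path_through (e : G.Edge) :
    ∃ x ∈ G.paths, x e = 1 := by
  have h1 : ∃ l, IsWalk G.edges G.s e.1.1 l := by
    by_cases hs : e.1.1 = G.s
    · exact ⟨[], hs ▸ IsWalk.nil _⟩
    · obtain ⟨l, _, hl, _⟩ := G.through _ hs (G.src_ne e.1 e.2)
      exact ⟨l, hl⟩
  have h2 : ∃ l, IsWalk G.edges e.1.2 G.g l := by
    by_cases hg : e.1.2 = G.g
    · exact ⟨[], hg ▸ IsWalk.nil _⟩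
    · obtain ⟨_, l, _, hl⟩ := G.through _ (G.tgt_ne e.1 e.2) hg
      exact ⟨l, hl⟩
  obtain ⟨l₁, h1⟩ := h1
  obtain ⟨l₂, h2⟩ := h2
  exact ⟨_, ⟨l₁ ++ e :: l₂, IsWalk.append h1 (IsWalk.cons e h2), rfl⟩, by simp [pathVec]⟩

theorem card_edge : Fintype.card G.Edge = G.m := by
  rw [m, Fintype.card_coe]

theorem m_pos (hP : G.paths.Nonempty) : 0 < G.m := by
  obtain ⟨e, _⟩ := G.exists_tail_eq hP ⟨G.s, G.s_ne_g⟩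
  exact Finset.card_pos.2 ⟨e.1, e.2⟩

/-- Average, over all edges, a path through each of them. This positive flow later regularizes the
comparator of the log-barrier algorithm. -/
theorem exists_flow_ge (hP : G.paths.Nonempty) :
    ∃ x ∈ G.flows, ∀ e, 1 / (G.m : ℝ) ≤ x e := by
  choose y hy hye using G.exists_path_through
  have hm : (0 : ℝ) < G.m := by exact_mod_cast G.m_pos hP
  refine ⟨∑ e, (1 / (G.m : ℝ)) • y e, ?_, fun e => ?_⟩
  · refine G.convex_flows.sum_mem (fun _ _ => by positivity) ?_
      (fun e _ => G.paths_subset_flows (hy e))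
    rw [Finset.sum_const, Finset.card_univ, card_edge, nsmul_eq_mul]
    field_simp
  · rw [Finset.sum_apply]
    have := Finset.single_le_sum (f := fun f => ((1 / (G.m : ℝ)) • y f) e)
      (fun f _ => by
        have := (G.mem_Icc_of_mem_flows (G.paths_subset_flows (hy f)) e).1
        simp only [Pi.smul_apply, smul_eq_mul]
        positivity) (Finset.mem_univ e)
    simpa [hye] using this

theorem le_one_of_dot_le {a : G.Edge → ℝ} (h0 : ∀ e, 0 ≤ a e)
    (h1 : ∀ x ∈ G.paths, G.dot a x ≤ 1) (e : G.Edge) : a e ≤ 1 := by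
  obtain ⟨x, hx, hxe⟩ := G.exists_path_through e
  refine le_trans ?_ (h1 x hx)
  have := Finset.single_le_sum (f := fun f => a f * x f) (fun f _ => mul_nonneg (h0 f)
    (G.mem_Icc_of_mem_flows (G.paths_subset_flows hx) f).1) (Finset.mem_univ e)
  rwa [hxe, mul_one] at this

theorem exists_eq_one_of_outflow {x : G.Edge → ℝ} (hx : x ∈ G.paths)
    {v : {v : W // v ≠ G.g}} (hv : G.outflow x v ≠ 0) : ∃ e, G.tail e = v ∧ x e = 1 := by
  obtain ⟨e, he, h⟩ := Finset.exists_ne_zero_of_sum_ne_zero hv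
  exact ⟨e, (Finset.mem_filter.1 he).2, (G.zero_or_one_of_mem_paths hx e).resolve_left h⟩

theorem outflow_mem_of_mem_paths {x : G.Edge → ℝ} (hx : x ∈ G.paths)
    (v : {v : W // v ≠ G.g}) : G.outflow x v = 0 ∨ G.outflow x v = 1 := by
  obtain ⟨l, hl, rfl⟩ := hx
  exact G.outflow_pathVec_mem hl v

variable {pstar : G.Edge → ℝ} {π : {v : W // v ≠ G.g} → G.Edge}

theorem mem_offPolicy {e : G.Edge} : e ∈ G.offPolicy π ↔ e ≠ π (G.tail e) := by
  simp [offPolicy]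

/-- The edges of `E'` at the vertices of the path `p*`. -/
noncomputable def exits (pstar : G.Edge → ℝ) (π : {v : W // v ≠ G.g} → G.Edge) : Finset G.Edge :=
  {e ∈ G.offPolicy π | G.outflow pstar (G.tail e) = 1}

theorem eq_one_of_onPolicy (hp : pstar ∈ G.paths) (hc : G.IsConsistent pstar π) {e : G.Edge}
    (he : e ∉ G.offPolicy π) (ho : G.outflow pstar (G.tail e) = 1) : pstar e = 1 := by
  obtain ⟨f, hf, hf1⟩ := G.exists_eq_one_of_outflow hp (v := G.tail e) (by rw [ho]; simp)
  have h := hc.2 f hf1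
  rw [mem_offPolicy, not_not] at he
  rw [hf, ← he] at h
  rwa [h]

/-- A path visits a vertex off `p*` only after it has left `p*`. -/
theorem outflow_walk_le_exits (hp : pstar ∈ G.paths) (hc : G.IsConsistent pstar π)
    {v : {v : W // v ≠ G.g}} (hv : G.outflow pstar v = 0) {u : W} {l : List G.Edge}
    (h : IsWalk G.edges u G.g l) (hu : ∀ h : u ≠ G.g, G.outflow pstar ⟨u, h⟩ = 1) :
    G.outflow (G.pathVec l) v ≤ ∑ e ∈ G.exits pstar π, G.pathVec l e := by
  induction l generalizing u with
  | nil => simp [outflow, pathVec]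
  | cons e l ih =>
    obtain ⟨rfl, h'⟩ := isWalk_cons_iff.1 h
    have hte : G.outflow pstar (G.tail e) = 1 := hu (G.src_ne e.1 e.2)
    have hnn : ∀ f ∈ G.exits pstar π, 0 ≤ G.pathVec (e :: l) f :=
      fun f _ => (G.pathVec_mem_Icc _ f).1
    by_cases he : e ∈ G.offPolicy π
    · have h1 : G.outflow (G.pathVec (e :: l)) v ≤ 1 := by
        rcases G.outflow_pathVec_mem h v with h | h <;> rw [h]; norm_num
      have h2 := Finset.single_le_sum hnn (Finset.mem_filter.2 ⟨he, hte⟩)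
      refine h1.trans (le_trans (le_of_eq ?_) h2)
      simp [pathVec]
    · have hte' : G.tail e ≠ v := by
        rintro rfl
        rw [hv] at hte
        exact zero_ne_one hte
      have hadd : G.outflow (G.pathVec (e :: l)) v = G.outflow (G.pathVec l) v := by
        simp only [outflow, G.pathVec_cons h', Finset.sum_add_distrib]
        simp [hte']
      rw [hadd]
      refine (ih h' fun hg => ?_).trans (Finset.sum_le_sum fun f _ => ?_)
      · have hfl := G.paths_subset_flows hp
        refine le_antisymm (G.outflow_le_one hfl _) ?_
        rw [← G.eq_one_of_onPolicy hp hc he hte]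
        exact G.le_outflow_tgt hfl e hg
      · rw [G.pathVec_cons h']
        split_ifs <;> simp

theorem outflow_le_exits (hp : pstar ∈ G.paths) (hc : G.IsConsistent pstar π)
    {v : {v : W // v ≠ G.g}} (hv : G.outflow pstar v = 0) {x : G.Edge → ℝ} (hx : x ∈ G.flows) :
    G.outflow x v ≤ ∑ e ∈ G.exits pstar π, x e := by
  have key : ∀ x : G.Edge → ℝ, G.dot (fun e => (if G.tail e = v then 1 else 0)
      - (if e ∈ G.exits pstar π then 1 else 0)) x
      = G.outflow x v - ∑ e ∈ G.exits pstar π, x e := fun x => by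
    simp only [dot, sub_mul, Finset.sum_sub_distrib, ite_mul, one_mul, zero_mul, outflow]
    rw [Finset.sum_filter, Finset.sum_ite_mem, Finset.univ_inter]
  have := G.dot_le_of_forall_paths (b := 0) (a := fun e => (if G.tail e = v then 1 else 0)
      - (if e ∈ G.exits pstar π then 1 else 0)) (fun x hx => ?_) hx
  · rwa [key, sub_nonpos] at this
  · obtain ⟨l, hl, rfl⟩ := hx
    rw [key, sub_nonpos]
    exact G.outflow_walk_le_exits hp hc hv hl
      fun _ => G.outflow_source (G.paths_subset_flows hp)

/-- If every vertex has one outgoing edge only, there is one path only. -/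
theorem eq_of_offPolicy_eq_empty (hE : G.offPolicy π = ∅) {x y : G.Edge → ℝ}
    (hx : x ∈ G.paths) (hy : y ∈ G.paths) : x = y := by
  have hπ : ∀ e, e = π (G.tail e) := fun e => by
    by_contra h
    exact absurd (G.mem_offPolicy.2 h) (by simp [hE])
  have key : ∀ (l l' : List G.Edge) (u : W), IsWalk G.edges u G.g l →
      IsWalk G.edges u G.g l' → l = l' := by
    intro l
    induction l with
    | nil =>
      intro l' u h h'
      rw [isWalk_nil_iff.1 h] at h'
      exact (G.walk_sink h').symm
    | cons e l ih =>
      intro l' u h h'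
      obtain ⟨rfl, h1⟩ := isWalk_cons_iff.1 h
      cases l' with
      | nil => exact absurd (isWalk_nil_iff.1 h') (G.src_ne e.1 e.2)
      | cons f l' =>
        obtain ⟨h2, h3⟩ := isWalk_cons_iff.1 h'
        have hef : e = f := by
          rw [hπ e, hπ f, show G.tail e = G.tail f from Subtype.ext h2.symm]
        subst hef
        rw [ih l' _ h1 h3]
  obtain ⟨l, hl, rfl⟩ := hx
  obtain ⟨l', hl', rfl⟩ := hy
  rw [key l l' _ hl hl']

/-- Some path uses the given edge of `E'`; if that edge is not itself at a vertex of `p*`, the path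
must have left `p*` before. So the minimum defining `Δ*` is over a nonempty set whenever `E'` is
nonempty. -/
theorem exits_nonempty (hp : pstar ∈ G.paths) (hc : G.IsConsistent pstar π)
    (hE : (G.offPolicy π).Nonempty) : (G.exits pstar π).Nonempty := by
  by_contra hne
  rw [Finset.not_nonempty_iff_eq_empty] at hne
  obtain ⟨e, he⟩ := hE
  obtain ⟨x, hx, hxe⟩ := G.exists_path_through e
  have h0 : G.outflow pstar (G.tail e) = 0 := by
    refine (G.outflow_mem_of_mem_paths hp _).resolve_right fun h => ?_
    have : e ∈ G.exits pstar π := Finset.mem_filter.2 ⟨he, h⟩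
    simp [hne] at this
  have hxf := G.paths_subset_flows hx
  have h1 := G.outflow_le_exits hp hc h0 hxf
  rw [hne, Finset.sum_empty] at h1
  have h2 := G.le_outflow (fun e => (G.mem_Icc_of_mem_flows hxf e).1) e
  linarith

theorem tail_injOn_onPolicy {e f : G.Edge} (he : e ∉ G.offPolicy π) (hf : f ∉ G.offPolicy π)
    (h : G.tail e = G.tail f) : e = f := by
  rw [mem_offPolicy, not_not] at he hf
  rw [he, hf, h]

theorem card_onPolicy_le [Fintype W] (S : Finset {v : W // v ≠ G.g}) :
    (Finset.univ.filter fun e : G.Edge => e ∉ G.offPolicy π ∧ G.tail e ∈ S).card ≤ S.card := by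
  refine Finset.card_le_card_of_injOn G.tail (fun e he => ?_) fun e he f hf h => ?_
  · exact (Finset.mem_filter.1 he).2.2
  · exact G.tail_injOn_onPolicy (Finset.mem_filter.1 he).2.1 (Finset.mem_filter.1 hf).2.1 h

theorem card_erase_source [Fintype W] :
    ((Finset.univ : Finset {v : W // v ≠ G.g}).erase ⟨G.s, G.s_ne_g⟩).card ≤ G.n := by
  rw [n, ← Finset.card_univ]
  refine Finset.card_le_card_of_surjOn (fun v => ⟨v.1, v.2.2⟩) fun v hv => ?_
  have hv' := Finset.ne_of_mem_erase (Finset.mem_coe.1 hv)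
  exact ⟨⟨v.1, fun h => hv' (Subtype.ext h), v.2⟩, by simp, rfl⟩

theorem m_le [Fintype W] : (G.m : ℝ) ≤ (G.offPolicy π).card + (G.n + 1) := by
  have h1 := G.card_onPolicy_le (π := π) Finset.univ
  have h2 := Finset.card_filter_add_card_filter_not (s := (Finset.univ : Finset G.Edge))
    (fun e => e ∈ G.offPolicy π)
  have h3 := G.card_erase_source
  rw [Finset.card_erase_of_mem (Finset.mem_univ _)] at h3
  rw [Finset.card_univ, card_edge] at h2
  simp only [Finset.mem_univ, and_true, Finset.filter_univ_mem] at h1 h2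
  norm_cast
  omega

/-- A sum over the edges in which each edge of `π*` is charged to its siblings. -/
theorem sum_le_two_mul_offPolicy {f b : G.Edge → ℝ} (hb : ∀ e, 0 ≤ b e) (hf : ∀ e, f e ≤ b e)
    (hf' : ∀ e, f e ≤ ∑ e' with G.tail e' = G.tail e ∧ e' ≠ e, b e') :
    ∑ e, f e ≤ 2 * ∑ e ∈ G.offPolicy π, b e := by
  rw [← Finset.sum_filter_add_sum_filter_not Finset.univ (fun e => e ∈ G.offPolicy π), two_mul,
    Finset.filter_univ_mem]
  refine add_le_add (Finset.sum_le_sum fun e _ => hf e) ?_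
  calc ∑ e with e ∉ G.offPolicy π, f e
      ≤ ∑ e with e ∉ G.offPolicy π, ∑ e' ∈ G.offPolicy π,
          (if G.tail e' = G.tail e then b e' else 0) := by
        refine Finset.sum_le_sum fun e he => (hf' e).trans ?_
        rw [← Finset.sum_filter]
        refine Finset.sum_le_sum_of_subset_of_nonneg (fun e' he' => ?_) fun e _ _ => hb e
        obtain ⟨_, h1, h2⟩ := Finset.mem_filter.1 he'
        refine Finset.mem_filter.2 ⟨?_, h1⟩
        by_contra h3
        exact h2 (G.tail_injOn_onPolicy h3 (Finset.mem_filter.1 he).2 h1)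
    _ = ∑ e' ∈ G.offPolicy π, ∑ e with e ∉ G.offPolicy π,
          (if G.tail e' = G.tail e then b e' else 0) := Finset.sum_comm
    _ ≤ ∑ e' ∈ G.offPolicy π, b e' := by
        -- After the exchange of sums, each edge of `E'` is charged by at most one edge of `π*`, the
        -- one at its own vertex.
        refine Finset.sum_le_sum fun e' _ => ?_
        rw [← Finset.sum_filter, Finset.filter_filter, Finset.sum_const, nsmul_eq_mul]
        refine mul_le_of_le_one_left (hb e') ?_
        norm_cast
        refine Finset.card_le_one.2 fun e he f hf => ?_
        obtain ⟨_, h1, h2⟩ := Finset.mem_filter.1 he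
        obtain ⟨_, h3, h4⟩ := Finset.mem_filter.1 hf
        exact G.tail_injOn_onPolicy h1 h3 (h2.symm.trans h4)

/-- Edges of `π*` at vertices of `p*` have `p*(e) = 1` and contribute at most zero. At a vertex off
`p*`, the edge of `π*` carries at most the mass of that vertex, which has passed through an exit. -/
theorem sum_sqrt_sub_le [Fintype W] (hp : pstar ∈ G.paths) (hc : G.IsConsistent pstar π)
    {x : G.Edge → ℝ} (hx : x ∈ G.flows) :
    ∑ e, √(x e) - ∑ e, pstar e ≤
      ∑ e ∈ G.offPolicy π, √(x e) + G.n * √(∑ e ∈ G.exits pstar π, x e) := by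
  have hx01 := G.mem_Icc_of_mem_flows hx
  have hp0 : ∀ e, 0 ≤ pstar e := fun e => (G.mem_Icc_of_mem_flows (G.paths_subset_flows hp) e).1
  rw [← Finset.sum_sub_distrib,
    ← Finset.sum_filter_add_sum_filter_not Finset.univ (fun e => e ∈ G.offPolicy π),
    Finset.filter_univ_mem]
  refine add_le_add (Finset.sum_le_sum fun e _ => sub_le_self _ (hp0 e)) ?_
  set A := √(∑ e ∈ G.exits pstar π, x e)
  have hs : ∀ e ∈ Finset.univ.filter (fun e => e ∉ G.offPolicy π),
      √(x e) - pstar e ≤ if G.outflow pstar (G.tail e) = 0 then A else 0 := by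
    intro e he
    split_ifs with h0
    · refine (sub_le_self _ (hp0 e)).trans (Real.sqrt_le_sqrt ?_)
      exact (G.le_outflow (fun e => (hx01 e).1) e).trans (G.outflow_le_exits hp hc h0 hx)
    · have h1 := (G.outflow_mem_of_mem_paths hp _).resolve_left h0
      rw [G.eq_one_of_onPolicy hp hc (Finset.mem_filter.1 he).2 h1, sub_nonpos]
      exact Real.sqrt_le_one.2 (hx01 e).2
  refine (Finset.sum_le_sum hs).trans ?_
  rw [← Finset.sum_filter, Finset.filter_filter, Finset.sum_const, nsmul_eq_mul]
  refine mul_le_mul_of_nonneg_right ?_ (Real.sqrt_nonneg _)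
  norm_cast
  -- The source lies on `p*` and is excluded, so the factor is `n` rather than `n + 1`.
  refine le_trans (Finset.card_le_card fun e he => ?_) ((G.card_onPolicy_le (π := π)
    (Finset.univ.erase ⟨G.s, G.s_ne_g⟩)).trans G.card_erase_source)
  obtain ⟨_, h1, h2⟩ := Finset.mem_filter.1 he
  refine Finset.mem_filter.2 ⟨Finset.mem_univ _, h1, Finset.mem_erase.2 ⟨fun h => ?_, by simp⟩⟩
  rw [h, G.outflow_source (G.paths_subset_flows hp)] at h2
  exact one_ne_zero h2

end Policy

end STDag

/-! ### Follow-the-regularized-leader with Tsallis and log-barrier parts -/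

section FTRL

variable {ι : Type*} [Fintype ι]

/-- A mixture of the Tsallis entropy with weight `a` and log-barriers with weights `w`. -/
noncomputable def hybridReg (a : ℝ) (w x : ι → ℝ) : ℝ :=
  -(2 * a) * ∑ e, √(x e) - ∑ e, w e * Real.log (x e)

/-- The Bregman divergence of `hybridReg`. -/
noncomputable def hybridBreg (a : ℝ) (w x q : ι → ℝ) : ℝ :=
  ∑ e, (a * (√(x e) - √(q e)) ^ 2 / √(q e) + w e * (x e / q e - 1 - Real.log (x e / q e)))

/-- Coordinatewise, `-2√x` has the Bregman divergence `(√x - √q)²/√q`, and `-ln x` has `x/q - 1 -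
ln(x/q)`. -/
theorem hybridReg_eq (a : ℝ) (w : ι → ℝ) {x q : ι → ℝ} (hx : ∀ e, 0 < x e) (hq : ∀ e, 0 < q e) :
    hybridReg a w x = hybridReg a w q + ∑ e, (-(a / √(q e)) - w e / q e) * (x e - q e)
      + hybridBreg a w x q := by
  simp only [hybridReg, hybridBreg, Finset.mul_sum]
  rw [← Finset.sum_sub_distrib, ← Finset.sum_sub_distrib, ← Finset.sum_add_distrib,
    ← Finset.sum_add_distrib]
  refine Finset.sum_congr rfl fun e _ => ?_
  have h1 := Real.sqrt_pos.2 (hq e)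
  have h2 := hq e
  rw [Real.log_div (hx e).ne' h2.ne']
  have h3 : a * (√(x e) - √(q e)) ^ 2 / √(q e) - a / √(q e) * (x e - q e)
      = 2 * a * (√(q e) - √(x e)) := by
    field_simp
    linear_combination a * Real.sq_sqrt (hx e).le - a * Real.sq_sqrt h2.le
  have h4 : w e * (x e / q e - 1) - w e / q e * (x e - q e) = 0 := by
    field_simp
    ring
  linear_combination -h3 - h4

/-- `x` minimizes the linear function `b` plus the regularizer among the positive points of
`S`. -/
def IsHybridArgmin (S : Set (ι → ℝ)) (b : ι → ℝ) (a : ℝ) (w q : ι → ℝ) : Prop :=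
  q ∈ S ∧ (∀ e, 0 < q e) ∧ ∀ y ∈ S, (∀ e, 0 < y e) →
    ∑ e, b e * q e + hybridReg a w q ≤ ∑ e, b e * y e + hybridReg a w y

variable {S : Set (ι → ℝ)} {b w q : ι → ℝ} {a : ℝ}

/-- The objective restricted to the segment from `q` to `x` is minimal at its left end, so its
derivative there is nonnegative. -/
theorem IsHybridArgmin.first_order (hS : Convex ℝ S) (h : IsHybridArgmin S b a w q)
    {x : ι → ℝ} (hx : x ∈ S) (hx0 : ∀ e, 0 < x e) :
    0 ≤ ∑ e, (b e + (-(a / √(q e)) - w e / q e)) * (x e - q e) := by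
  obtain ⟨hqS, hq0, hmin⟩ := h
  set f : ℝ → ℝ := fun t => ∑ e, (b e * (q e + t * (x e - q e))
    + (-(2 * a) * √(q e + t * (x e - q e)) - w e * Real.log (q e + t * (x e - q e)))) with hf
  have hf' : ∀ t, f t = ∑ e, b e * (q e + t * (x e - q e))
      + hybridReg a w (fun e => q e + t * (x e - q e)) := fun t => by
    simp only [hf, hybridReg, Finset.mul_sum, Finset.sum_add_distrib, Finset.sum_sub_distrib]
  have hd : HasDerivAt f (∑ e, (b e + (-(a / √(q e)) - w e / q e)) * (x e - q e)) 0 := by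
    refine HasDerivAt.fun_sum fun e _ => ?_
    have h1 : HasDerivAt (fun t : ℝ => q e + t * (x e - q e)) (x e - q e) 0 := by
      simpa using ((hasDerivAt_id (0 : ℝ)).mul_const (x e - q e)).const_add (q e)
    have h0 : q e + 0 * (x e - q e) ≠ 0 := by simpa using (hq0 e).ne'
    have h2 := (h1.const_mul (b e)).add
      (((h1.sqrt h0).const_mul (-(2 * a))).sub ((h1.log h0).const_mul (w e)))
    refine h2.congr_deriv ?_
    have := Real.sqrt_pos.2 (hq0 e)
    have := hq0 e
    simp only [zero_mul, add_zero]
    field_simp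
  have hmin' : IsLocalMinOn f (Set.Icc 0 1) 0 := by
    refine IsMinOn.localize fun t ht => ?_
    change f 0 ≤ f t
    rw [hf', hf']
    simp only [zero_mul, add_zero]
    have hcomb : (fun e => q e + t * (x e - q e)) = (1 - t) • q + t • x := by
      ext e
      simp only [Pi.add_apply, Pi.smul_apply, smul_eq_mul]
      ring
    refine hmin _ ?_ fun e => ?_
    · rw [hcomb]
      exact hS hqS hx (by linarith [ht.2]) ht.1 (by ring)
    · have h3 := congrFun hcomb e
      simp only [Pi.add_apply, Pi.smul_apply, smul_eq_mul] at h3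
      rw [h3]
      rcases ht.1.eq_or_lt with rfl | ht0
      · simpa using hq0 e
      · have := mul_pos ht0 (hx0 e)
        have := mul_nonneg (by linarith [ht.2] : 0 ≤ 1 - t) (hq0 e).le
        linarith
  have := hmin'.hasFDerivWithinAt_nonneg hd.hasFDerivAt.hasFDerivWithinAt (y := (1 : ℝ))
    (mem_posTangentConeAt_of_segment_subset (by rw [segment_eq_Icc (by norm_num)]; simp))
  simpa using this

/-- The linear part of the Bregman expansion is nonnegative by first-order optimality, so the whole
divergence is gained. This gain pays for the instability of the leader. -/
theorem IsHybridArgmin.add_breg_le (hS : Convex ℝ S) (h : IsHybridArgmin S b a w q)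
    {x : ι → ℝ} (hx : x ∈ S) (hx0 : ∀ e, 0 < x e) :
    ∑ e, b e * q e + hybridReg a w q + hybridBreg a w x q
      ≤ ∑ e, b e * x e + hybridReg a w x := by
  have h1 := h.first_order hS hx hx0
  rw [hybridReg_eq a w hx0 h.2.1]
  simp only [add_mul, Finset.sum_add_distrib, mul_sub, Finset.sum_sub_distrib] at h1 ⊢
  linarith

/-- The regret of follow-the-regularized-leader with a time-dependent regularizer. -/
theorem ftrl_regret (hS : Convex ℝ S) {T : ℕ} (hT : 1 ≤ T) {g q w : ℕ → ι → ℝ} {a st : ℕ → ℝ}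
    (hq : ∀ t ∈ Finset.Icc 1 T,
      IsHybridArgmin S (fun e => ∑ τ ∈ Finset.Ico 1 t, g τ e) (a t) (w t) (q t))
    (hst : ∀ t ∈ Finset.Icc 1 T, ∀ x : ι → ℝ, (∀ e, 0 < x e) →
      ∑ e, g t e * (q t e - x e) - hybridBreg (a t) (w t) x (q t) ≤ st t)
    {y : ι → ℝ} (hy : y ∈ S) (hy0 : ∀ e, 0 < y e) :
    ∑ t ∈ Finset.Icc 1 T, ∑ e, g t e * (q t e - y e) ≤
      hybridReg (a T) (w T) y - hybridReg (a 1) (w 1) (q 1)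
      + ∑ t ∈ Finset.Ico 1 T, (hybridReg (a t) (w t) (q (t + 1))
          - hybridReg (a (t + 1)) (w (t + 1)) (q (t + 1)))
      + ∑ t ∈ Finset.Icc 1 T, st t := by
  -- One round against an arbitrary point: the optimality gap of `q t` absorbs the change from `q t`
  -- to `x` up to `st t`. It is used with `x = q (t + 1)` before the last round and with `x = y` in
  -- the last round.
  have step : ∀ t ∈ Finset.Icc 1 T, ∀ x ∈ S, (∀ e, 0 < x e) →
      ∑ e, g t e * q t e + (∑ e, (∑ τ ∈ Finset.Ico 1 t, g τ e) * q t e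
        + hybridReg (a t) (w t) (q t))
      ≤ ∑ e, (∑ τ ∈ Finset.Ico 1 (t + 1), g τ e) * x e + hybridReg (a t) (w t) x + st t := by
    intro t ht x hx hx0
    have h1 := (hq t ht).add_breg_le hS hx hx0
    have h2 := hst t ht x hx0
    simp only [Finset.sum_Ico_succ_top (Finset.mem_Icc.1 ht).1, add_mul, mul_sub,
      Finset.sum_add_distrib, Finset.sum_sub_distrib] at h1 h2 ⊢
    linarith
  have main : ∀ k, 1 ≤ k → k ≤ T → ∑ t ∈ Finset.Ico 1 k, ∑ e, g t e * q t e
      + hybridReg (a 1) (w 1) (q 1)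
      ≤ ∑ e, (∑ τ ∈ Finset.Ico 1 k, g τ e) * q k e + hybridReg (a k) (w k) (q k)
      + ∑ t ∈ Finset.Ico 1 k, (hybridReg (a t) (w t) (q (t + 1))
          - hybridReg (a (t + 1)) (w (t + 1)) (q (t + 1)))
      + ∑ t ∈ Finset.Ico 1 k, st t := by
    intro k hk
    induction k, hk using Nat.le_induction with
    | base => simp
    | succ k hk ih =>
      intro hkT
      have h1 := ih (by omega)
      have hk1 := hq (k + 1) (Finset.mem_Icc.2 ⟨by omega, hkT⟩)
      have h2 := step k (Finset.mem_Icc.2 ⟨hk, by omega⟩) _ hk1.1 hk1.2.1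
      rw [Finset.sum_Ico_succ_top hk, Finset.sum_Ico_succ_top (f := st) hk,
        Finset.sum_Ico_succ_top (f := fun t => hybridReg (a t) (w t) (q (t + 1))
          - hybridReg (a (t + 1)) (w (t + 1)) (q (t + 1))) hk]
      linarith
  have h1 := main T hT le_rfl
  have h2 := step T (Finset.mem_Icc.2 ⟨hT, le_rfl⟩) y hy hy0
  have h3 : ∑ e, (∑ τ ∈ Finset.Ico 1 (T + 1), g τ e) * y e
      = ∑ t ∈ Finset.Icc 1 T, ∑ e, g t e * y e := by
    rw [Finset.sum_comm, Finset.Ico_add_one_right_eq_Icc]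
    exact Finset.sum_congr rfl fun e _ => Finset.sum_mul _ _ _
  simp only [mul_sub, Finset.sum_sub_distrib] at h1 h2 ⊢
  rw [← Finset.Ico_add_one_right_eq_Icc] at h3 ⊢
  rw [Finset.sum_Ico_succ_top hT, Finset.sum_Ico_succ_top (f := st) hT, ← h3]
  linarith

theorem sub_one_sub_log_nonneg {z : ℝ} (hz : 0 < z) : 0 ≤ z - 1 - Real.log z := by
  linarith [Real.log_le_sub_one_of_pos hz]

/-- Here `z = x/q` and `u = q ℓ̂`. The left side is maximal at `z = 1/(1 + u/w)`; the tangent bound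
for the logarithm at that point, with `1/(1 + v) ≤ 1 - v + 2v²` for `v ≥ -1/2`, gives the claim. The
weight 2 is what ensures `|u/w| ≤ 1/2`. -/
theorem barrier_stability {u w z : ℝ} (hu : |u| ≤ 1) (hw : 2 ≤ w) (hz : 0 < z) :
    -u * (z - 1) - w * (z - 1 - Real.log z) ≤ 2 * u ^ 2 / w := by
  have hw0 : 0 < w := by linarith
  obtain ⟨h1, h2⟩ := abs_le.1 hu
  have ha : 1 / 2 ≤ 1 + u / w := by
    have : -(1 / 2) ≤ u / w := by rw [le_div_iff₀ hw0]; linarith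
    linarith
  have ha0 : 0 < 1 + u / w := by linarith
  have l1 := Real.log_le_sub_one_of_pos (mul_pos hz ha0)
  have l2 := Real.log_le_sub_one_of_pos (inv_pos.2 ha0)
  rw [Real.log_mul hz.ne' ha0.ne'] at l1
  rw [Real.log_inv] at l2
  have h3 : w * (u / w) = u := by field_simp
  have h4 : (1 + u / w)⁻¹ ≤ 1 - u / w + 2 * (u / w) ^ 2 := by
    rw [inv_le_iff_one_le_mul₀ ha0]
    nlinarith [sq_nonneg (u / w)]
  have h5 : Real.log z ≤ z * (1 + u / w) - 1 - u / w + 2 * (u / w) ^ 2 := by linarith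
  have h6 := mul_le_mul_of_nonneg_left h5 hw0.le
  have h7 : w * (z * (1 + u / w) - 1 - u / w + 2 * (u / w) ^ 2)
      = z * (w + u) - w - u + 2 * u ^ 2 / w := by
    field_simp
  linarith

/-- For `z ≤ 4` the Tsallis divergence dominates `(z - 1)²/9` and a square is completed. For `z ≥ 4`
the barrier of weight 2 alone exceeds `z - 1 ≥ -u(z - 1)`, so no lower bound on the estimated loss
is needed. -/
theorem tsallis_stability {u a z : ℝ} (hu : |u| ≤ 1) (ha : 0 < a) (hz : 0 < z) :
    -u * (z - 1) - a * (√z - 1) ^ 2 - 2 * (z - 1 - Real.log z) ≤ 9 / 4 * u ^ 2 / a := by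
  have hpos : 0 ≤ 9 / 4 * u ^ 2 / a := by positivity
  obtain ⟨h1, h2⟩ := abs_le.1 hu
  rcases le_total z 4 with h4 | h4
  · have hs : √z ≤ 2 := Real.sqrt_le_iff.2 ⟨by norm_num, by linarith⟩
    have hs0 := Real.sqrt_nonneg z
    have hh := sub_one_sub_log_nonneg hz
    have e1 : z - 1 = (√z - 1) * (√z + 1) := by
      nth_rewrite 1 [← Real.sq_sqrt hz.le]
      ring
    have e2 : (z - 1) ^ 2 ≤ 9 * (√z - 1) ^ 2 := by
      rw [e1, mul_pow, mul_comm]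
      refine mul_le_mul_of_nonneg_right ?_ (sq_nonneg _)
      nlinarith
    have e3 : -u * (z - 1) - a / 9 * (z - 1) ^ 2 ≤ 9 / 4 * u ^ 2 / a := by
      rw [le_div_iff₀ ha]
      nlinarith [sq_nonneg (a * (z - 1) / 3 + 3 / 2 * u)]
    nlinarith
  · have l1 := Real.log_le_sub_one_of_pos (by positivity : 0 < z / 4)
    rw [Real.log_div hz.ne' (by norm_num), show (4 : ℝ) = 2 ^ 2 by norm_num, Real.log_pow] at l1
    have l2 := Real.log_two_lt_d9
    have l3 : -u * (z - 1) ≤ z - 1 := by nlinarith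
    have l4 : 0 ≤ a * (√z - 1) ^ 2 := by positivity
    push_cast at l1
    linarith

theorem barrier_stability_sum {g w q x : ι → ℝ} (hq : ∀ e, 0 < q e) (hx : ∀ e, 0 < x e)
    (hu : ∀ e, |q e * g e| ≤ 1) (hw : ∀ e, 2 ≤ w e) :
    ∑ e, g e * (q e - x e) - hybridBreg 0 w x q ≤ ∑ e, 2 * (q e * g e) ^ 2 / w e := by
  rw [hybridBreg, ← Finset.sum_sub_distrib]
  refine Finset.sum_le_sum fun e _ => ?_
  refine le_trans (le_of_eq ?_) (barrier_stability (hu e) (hw e) (div_pos (hx e) (hq e)))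
  have := (hq e).ne'
  have h : -(q e * g e) * (x e / q e - 1) = g e * (q e - x e) := by
    field_simp
    ring
  rw [h]
  ring

theorem tsallis_stability_sum {g q x : ι → ℝ} {a : ℝ} (ha : 0 < a) (hq : ∀ e, 0 < q e)
    (hx : ∀ e, 0 < x e) (hu : ∀ e, |q e * g e| ≤ 1) :
    ∑ e, g e * (q e - x e) - hybridBreg a (fun _ => 2) x q
      ≤ ∑ e, 9 / 4 * (q e * g e) ^ 2 / (a * √(q e)) := by
  rw [hybridBreg, ← Finset.sum_sub_distrib]
  refine Finset.sum_le_sum fun e _ => ?_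
  have hs := Real.sqrt_pos.2 (hq e)
  refine le_trans (le_of_eq ?_)
    (tsallis_stability (hu e) (mul_pos ha hs) (div_pos (hx e) (hq e)))
  have := (hq e).ne'
  have h : -(q e * g e) * (x e / q e - 1) = g e * (q e - x e) := by
    field_simp
    ring
  have h' : a * √(q e) * (√(x e / q e) - 1) ^ 2 = a * (√(x e) - √(q e)) ^ 2 / √(q e) := by
    rw [Real.sqrt_div (hx e).le]
    field_simp
  rw [h, h']
  ring

/-- The coordinates of the leader are bounded from below in terms of the linear function. -/
theorem IsHybridArgmin.exists_le {B A M : ℝ} (hS : ∀ x ∈ S, ∀ e, x e ∈ Set.Icc (0 : ℝ) 1)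
    {y : ι → ℝ} (hy : y ∈ S) (hy0 : ∀ e, 0 < y e) :
    ∃ δ > 0, ∀ (b w q : ι → ℝ) (a : ℝ), (∀ e, |b e| ≤ B) → a ∈ Set.Icc 0 A →
      (∀ e, w e ∈ Set.Icc 1 M) → IsHybridArgmin S b a w q → ∀ e, δ ≤ q e := by
  -- Comparison with `y` bounds `Σ w(e)(-ln q(e))` by the sum in the exponent; all summands are
  -- nonnegative and `w(e) ≥ 1`, so each `-ln q(e)` obeys the same bound.
  refine ⟨Real.exp (-(∑ e : ι, (2 * B + 2 * A - M * Real.log (y e)))), Real.exp_pos _, ?_⟩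
  rintro b w q a hb ⟨ha0, haA⟩ hw ⟨hqS, hq0, hmin⟩ e
  have h := hmin y hy hy0
  have hlq : ∀ e, Real.log (q e) ≤ 0 := fun e => Real.log_nonpos (hq0 e).le (hS q hqS e).2
  have hly : ∀ e, Real.log (y e) ≤ 0 := fun e => Real.log_nonpos (hy0 e).le (hS y hy e).2
  have key : ∑ e, w e * -Real.log (q e) ≤ ∑ e, (2 * B + 2 * A - M * Real.log (y e)) := by
    have h1 : ∑ e, w e * -Real.log (q e) ≤
        ∑ e, (b e * y e - b e * q e + 2 * a * √(q e) - 2 * a * √(y e)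
          - w e * Real.log (y e)) := by
      simp only [hybridReg, Finset.mul_sum] at h
      simp only [mul_neg, Finset.sum_neg_distrib, Finset.sum_sub_distrib, Finset.sum_add_distrib,
        neg_mul] at h ⊢
      linarith
    refine h1.trans (Finset.sum_le_sum fun e _ => ?_)
    have hy1 := hS y hy e
    have hq1 := hS q hqS e
    have b1 : b e * y e ≤ B := by
      refine (le_abs_self _).trans ?_
      rw [abs_mul, abs_of_nonneg hy1.1]
      exact (mul_le_of_le_one_right (abs_nonneg _) hy1.2).trans (hb e)
    have b2 : -(b e * q e) ≤ B := by
      refine (neg_le_abs _).trans ?_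
      rw [abs_mul, abs_of_nonneg hq1.1]
      exact (mul_le_of_le_one_right (abs_nonneg _) hq1.2).trans (hb e)
    have b3 : 2 * a * √(q e) ≤ 2 * A := by
      have := mul_le_of_le_one_right (by linarith : 0 ≤ 2 * a) (Real.sqrt_le_one.2 hq1.2)
      linarith
    have b4 : 0 ≤ 2 * a * √(y e) := by positivity
    have b5 : -(w e * Real.log (y e)) ≤ -(M * Real.log (y e)) := by
      nlinarith [(hw e).2, hly e]
    linarith
  rw [← Real.le_log_iff_exp_le (hq0 e), neg_le]
  refine le_trans ?_ key
  have h2 := Finset.single_le_sum (f := fun e => w e * -Real.log (q e))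
    (fun e _ => mul_nonneg (by linarith [(hw e).1]) (by linarith [hlq e])) (Finset.mem_univ e)
  refine le_trans ?_ h2
  nlinarith [(hw e).1, hlq e]

end FTRL

namespace STDag

/-! ### Size and variance of the loss estimator -/

section Estimator

variable {W : Type*} (G : STDag W) [DecidableEq W]

/-- The probability that the sampling procedure at `e₋` picks `e`. -/
noncomputable def ratio (q : G.Edge → ℝ) (e : G.Edge) : ℝ := q e / G.outflow q (G.tail e)

variable {p q : G.Edge → ℝ}

theorem outflow_tail_pos (hq : ∀ e, 0 < q e) (e : G.Edge) : 0 < G.outflow q (G.tail e) :=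
  (hq e).trans_le (G.le_outflow (fun e => (hq e).le) e)

theorem ratio_mem (hq : ∀ e, 0 < q e) (e : G.Edge) : G.ratio q e ∈ Set.Icc (0 : ℝ) 1 :=
  ⟨div_nonneg (hq e).le (G.outflow_tail_pos hq e).le,
    (div_le_one (G.outflow_tail_pos hq e)).2 (G.le_outflow (fun e => (hq e).le) e)⟩

/-- For a path `p(e) ≤ p(e₋)` and both are 0 or 1. The point is that the right side is linear in
`p`, so its mean follows from that of the path. -/
theorem outflow_mul_sq (hp : p ∈ G.paths) (e : G.Edge) (r : ℝ) :
    G.outflow p (G.tail e) * (p e - r) ^ 2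
      = (1 - 2 * r) * p e + r ^ 2 * G.outflow p (G.tail e) := by
  have h1 := G.outflow_mem_of_mem_paths hp (G.tail e)
  have h2 := G.zero_or_one_of_mem_paths hp e
  have h3 := G.le_outflow (fun e => (G.mem_Icc_of_mem_flows (G.paths_subset_flows hp) e).1) e
  rcases h1 with h1 | h1 <;> rcases h2 with h2 | h2 <;> rw [h1, h2] at h3 ⊢ <;>
    first | (exfalso; linarith) | ring

/-- `q(e) ℓ̂(e) = c (p(e) - p(e₋) q(e)/q(e₋))`, where `p(e₋)` may be moved outside the bracket
because `p` is 0/1-valued. So the local norm in the stability bounds is exactly the quantity that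
drives the adaptive rate. -/
theorem sq_mul_lossEst (hq : ∀ e, 0 < q e) (hp : p ∈ G.paths) (c : ℝ) (e : G.Edge) :
    (q e * G.lossEst c p q e) ^ 2 = G.rho c p q e := by
  have h0 := (hq e).ne'
  have h : q e * G.lossEst c p q e
      = c * (p e - G.outflow p (G.tail e) * (q e / G.outflow q (G.tail e))) := by
    rw [lossEst]
    field_simp
  have h1 := G.outflow_mem_of_mem_paths hp (G.tail e)
  have h2 := G.zero_or_one_of_mem_paths hp e
  have h3 := G.le_outflow (fun e => (G.mem_Icc_of_mem_flows (G.paths_subset_flows hp) e).1) e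
  rw [h, rho]
  rcases h1 with h1 | h1 <;> rcases h2 with h2 | h2 <;> rw [h1, h2] at h3 ⊢ <;>
    first | (exfalso; linarith) | ring

theorem rho_nonneg (hp : p ∈ G.paths) (c : ℝ) (e : G.Edge) : 0 ≤ G.rho c p q e := by
  have := G.outflow_nonneg
    (fun e => (G.mem_Icc_of_mem_flows (G.paths_subset_flows hp) e).1) (G.tail e)
  unfold rho
  positivity

theorem rho_le (hp : p ∈ G.paths) {c : ℝ} (hc : c ∈ Set.Icc (0 : ℝ) 1) (e : G.Edge) :
    G.rho c p q e ≤ G.outflow p (G.tail e) * (p e - G.ratio q e) ^ 2 := by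
  have := G.outflow_nonneg
    (fun e => (G.mem_Icc_of_mem_flows (G.paths_subset_flows hp) e).1) (G.tail e)
  rw [rho, mul_assoc]
  exact mul_le_of_le_one_left (by positivity) (pow_le_one₀ hc.1 hc.2)

theorem rho_le_one (hq : ∀ e, 0 < q e) (hp : p ∈ G.paths) {c : ℝ} (hc : c ∈ Set.Icc (0 : ℝ) 1)
    (e : G.Edge) : G.rho c p q e ≤ 1 := by
  refine (G.rho_le hp hc e).trans ?_
  have hpf := G.paths_subset_flows hp
  have h1 := G.mem_Icc_of_mem_flows hpf e
  have h2 := G.ratio_mem hq e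
  refine mul_le_one₀ (G.outflow_le_one hpf _) (sq_nonneg _) ?_
  rw [sq_le_one_iff_abs_le_one, abs_le]
  constructor <;> linarith [h1.1, h1.2, h2.1, h2.2]

theorem abs_mul_lossEst_le_one (hq : ∀ e, 0 < q e) (hp : p ∈ G.paths) {c : ℝ}
    (hc : c ∈ Set.Icc (0 : ℝ) 1) (e : G.Edge) : |q e * G.lossEst c p q e| ≤ 1 := by
  rw [← sq_le_one_iff_abs_le_one, G.sq_mul_lossEst hq hp]
  exact G.rho_le_one hq hp hc e

/-- Each `ρ(e)` is at most `c²(p(e) + r(e) p(e₋))`. The ratios at a vertex sum to one, so both parts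
sum to the length of the path. -/
theorem sum_rho_le [Fintype W] (hP : G.paths.Nonempty) (hq : ∀ e, 0 < q e) (hp : p ∈ G.paths)
    (c : ℝ) : ∑ e, G.rho c p q e ≤ 2 * G.L * c ^ 2 := by
  have hpf := G.paths_subset_flows hp
  have hp0 := fun e => (G.mem_Icc_of_mem_flows hpf e).1
  have h1 : ∑ e, G.ratio q e * G.outflow p (G.tail e) = ∑ e, p e := by
    have e1 := G.sum_mul_outflow q (fun v => G.outflow p v / G.outflow q v)
    have e2 := G.sum_mul_outflow p (fun _ => 1)
    simp only [mul_one] at e2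
    rw [e2]
    calc _ = ∑ e, q e * (G.outflow p (G.tail e) / G.outflow q (G.tail e)) :=
          Finset.sum_congr rfl fun e _ => by rw [ratio]; ring
      _ = _ := e1
      _ = _ := Finset.sum_congr rfl fun v _ => by
          have := (G.outflow_pos hP hq v).ne'
          field_simp
  calc ∑ e, G.rho c p q e
      ≤ ∑ e, c ^ 2 * (p e + G.ratio q e * G.outflow p (G.tail e)) := by
        refine Finset.sum_le_sum fun e _ => ?_
        rw [rho, mul_assoc, G.outflow_mul_sq hp]
        refine mul_le_mul_of_nonneg_left ?_ (sq_nonneg c)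
        have hr := G.ratio_mem hq e
        change (1 - 2 * G.ratio q e) * p e + G.ratio q e ^ 2 * _ ≤ _
        refine add_le_add ?_ ?_
        · nlinarith [hr.1, hp0 e]
        · refine mul_le_mul_of_nonneg_right ?_ (G.outflow_nonneg hp0 _)
          nlinarith [hr.1, hr.2]
    _ = 2 * (∑ e, p e) * c ^ 2 := by
        rw [← Finset.mul_sum, Finset.sum_add_distrib, h1]
        ring
    _ ≤ 2 * G.L * c ^ 2 := by
        have := G.sum_le_L hpf
        gcongr

theorem sub_eq_sum_siblings (e : G.Edge) :
    G.outflow q (G.tail e) - q e = ∑ e' with G.tail e' = G.tail e ∧ e' ≠ e, q e' := by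
  rw [outflow, ← Finset.filter_filter, Finset.filter_ne', sub_eq_iff_eq_add']
  exact (Finset.add_sum_erase _ _ (by simp)).symm

theorem mul_one_sub_ratio_le (hq : ∀ e, 0 < q e) (e : G.Edge) :
    q e * (1 - G.ratio q e) ≤ ∑ e' with G.tail e' = G.tail e ∧ e' ≠ e, q e' := by
  rw [← sub_eq_sum_siblings]
  have h := G.ratio_mem hq e
  have h0 := (G.outflow_tail_pos hq e).ne'
  have h1 : q e * (1 - G.ratio q e) = G.ratio q e * (G.outflow q (G.tail e) - q e) := by
    rw [ratio]
    field_simp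
  rw [h1]
  exact mul_le_of_le_one_left (sub_nonneg.2 (G.le_outflow (fun e => (hq e).le) e)) h.2

/-- The left side is `√q(e)/q(e₋)` times the total mass of the siblings, and `√q(e) √q(e') ≤ q(e₋)`
for each sibling `e'`. -/
theorem sqrt_mul_one_sub_ratio_le (hq : ∀ e, 0 < q e) (e : G.Edge) :
    √(q e) * (1 - G.ratio q e) ≤ ∑ e' with G.tail e' = G.tail e ∧ e' ≠ e, √(q e') := by
  have h0 := G.outflow_tail_pos hq e
  have h1 : √(q e) * (1 - G.ratio q e)
      = √(q e) / G.outflow q (G.tail e) * (G.outflow q (G.tail e) - q e) := by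
    rw [ratio]
    field_simp
  rw [h1, sub_eq_sum_siblings, Finset.mul_sum]
  refine Finset.sum_le_sum fun e' he' => ?_
  have ht := (Finset.mem_filter.1 he').2.1
  rw [div_mul_eq_mul_div, div_le_iff₀ h0]
  have h2 := Real.sqrt_le_sqrt (G.le_outflow (fun e => (hq e).le) e)
  have h3 := Real.sqrt_le_sqrt (G.le_outflow (fun e => (hq e).le) e')
  rw [ht] at h3
  have h4 : √(q e) * √(q e') ≤ G.outflow q (G.tail e) :=
    (mul_le_mul h2 h3 (Real.sqrt_nonneg _) (Real.sqrt_nonneg _)).trans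
      (Real.mul_self_sqrt h0.le).le
  calc √(q e) * q e' = √(q e') * (√(q e) * √(q e')) := by
        nth_rewrite 1 [← Real.mul_self_sqrt (hq e').le]
        ring
    _ ≤ _ := mul_le_mul_of_nonneg_left h4 (Real.sqrt_nonneg _)

theorem abs_ratio_sub_le {δ : ℝ} (hδ : 0 < δ) (hq : ∀ e, δ ≤ q e) {y : G.Edge → ℝ}
    (hy : y ∈ G.flows) (e : G.Edge) :
    |y e / q e - G.outflow y (G.tail e) / G.outflow q (G.tail e)| ≤ 1 / δ := by
  have hq0 : ∀ e, 0 < q e := fun e => hδ.trans_le (hq e)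
  have hy1 := G.mem_Icc_of_mem_flows hy e
  have hy2 := G.outflow_nonneg (fun e => (G.mem_Icc_of_mem_flows hy e).1) (G.tail e)
  have a1 : y e / q e ≤ 1 / δ := div_le_div₀ zero_le_one hy1.2 hδ (hq e)
  have a2 : 0 ≤ y e / q e := div_nonneg hy1.1 (hq0 e).le
  have a3 : G.outflow y (G.tail e) / G.outflow q (G.tail e) ≤ 1 / δ :=
    div_le_div₀ zero_le_one (G.outflow_le_one hy _) hδ
      ((hq e).trans (G.le_outflow (fun e => (hq0 e).le) e))
  have a4 : 0 ≤ G.outflow y (G.tail e) / G.outflow q (G.tail e) :=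
    div_nonneg hy2 (G.outflow_tail_pos hq0 e).le
  rw [abs_le]
  constructor <;> linarith

theorem abs_lossEst_le {δ : ℝ} (hδ : 0 < δ) (hq : ∀ e, δ ≤ q e) (hp : p ∈ G.paths) {c : ℝ}
    (hc : c ∈ Set.Icc (0 : ℝ) 1) (e : G.Edge) : |G.lossEst c p q e| ≤ 1 / δ := by
  rw [lossEst, abs_mul, abs_of_nonneg hc.1]
  exact (mul_le_of_le_one_left (abs_nonneg _) hc.2).trans
    (G.abs_ratio_sub_le hδ hq (G.paths_subset_flows hp) e)

theorem abs_dot_le {a x : G.Edge → ℝ} {B : ℝ} (ha : ∀ e, |a e| ≤ B) (hx : x ∈ G.flows) :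
    |G.dot a x| ≤ G.m * B := by
  refine (Finset.abs_sum_le_sum_abs _ _).trans ?_
  refine (Finset.sum_le_card_nsmul _ _ B fun e _ => ?_).trans ?_
  · have h := G.mem_Icc_of_mem_flows hx e
    rw [abs_mul, abs_of_nonneg h.1]
    exact (mul_le_of_le_one_right (abs_nonneg _) h.2).trans (ha e)
  · rw [Finset.card_univ, card_edge, nsmul_eq_mul]

end Estimator

/-! ### Conditional means under the Markovian sampling -/

section Sampling

variable {W : Type*} [Fintype W] [DecidableEq W] {G : STDag W} {Ω : Type*} {mΩ : MeasurableSpace Ω}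
  {μ : Measure Ω} {T : ℕ} {ℋ : Filtration ℕ mΩ} {ℓ q p : ℕ → Ω → G.Edge → ℝ} {c : ℕ → Ω → ℝ}

/-- Injectivity of the indicator vectors on source-to-sink walks lets the law of the path, given
walk by walk, determine means of functions of the path vector. -/
theorem eq_sum_indicator {x : G.Edge → ℝ} (hx : x ∈ G.paths) (f : (G.Edge → ℝ) → ℝ) :
    f x = ∑ l ∈ G.walks G.s, (if x = G.pathVec l then 1 else 0) * f (G.pathVec l) := by
  obtain ⟨l, hl, rfl⟩ := hx
  rw [Finset.sum_eq_single_of_mem l (by simpa using hl)]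
  · simp
  · intro l' hl' hne
    rw [if_neg fun h => hne (G.pathVec_injOn hl ((G.mem_walks).1 hl') h).symm, zero_mul]

theorem measurable_comp_path {Ω' : Type*} {m : MeasurableSpace Ω'} {x : Ω' → G.Edge → ℝ}
    (hx : Measurable x) (hmem : ∀ ω, x ω ∈ G.paths) {F : (G.Edge → ℝ) → Ω' → ℝ}
    (hF : ∀ y ∈ G.paths, Measurable (F y)) : Measurable fun ω => F (x ω) ω := by
  simp_rw [fun ω => eq_sum_indicator (hmem ω) (fun y => F y ω)]
  refine Finset.measurable_sum _ fun l hl => Measurable.mul ?_ ?_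
  · exact Measurable.ite (hx (measurableSet_singleton _)) measurable_const measurable_const
  · exact hF _ ⟨l, (G.mem_walks).1 hl, rfl⟩

theorem integrable_of_abs_le [IsFiniteMeasure μ] {f : Ω → ℝ} (hf : Measurable f) {B : ℝ}
    (hB : ∀ ω, |f ω| ≤ B) : Integrable f μ :=
  Integrable.of_bound hf.aestronglyMeasurable B (Filter.Eventually.of_forall hB)

variable [IsProbabilityMeasure μ]

/-- The mean of a bounded function of the sampled path and of the past. -/
theorem IsInteraction.integral_comp_path (h : G.IsInteraction μ T ℋ ℓ q p c) {t : ℕ}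
    (ht : t ∈ Finset.Icc 1 T) {F : (G.Edge → ℝ) → Ω → ℝ}
    (hF : ∀ x ∈ G.paths, Measurable[ℋ t] (F x)) {B : ℝ} (hB : ∀ x ∈ G.paths, ∀ ω, |F x ω| ≤ B) :
    ∫ ω, F (p t ω) ω ∂μ = ∫ ω, G.walkMean (q t ω) G.s (fun l => F (G.pathVec l) ω) ∂μ := by
  have hpm : Measurable (p t) := (h.path_meas t ht).mono (ℋ.le _) le_rfl
  have hind : ∀ l, Integrable
      (Set.indicator {ω | p t ω = G.pathVec l} (fun _ => (1 : ℝ))) μ := fun l =>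
    (integrable_const 1).indicator (hpm (measurableSet_singleton _))
  have key : ∀ l ∈ G.walks G.s,
      Integrable (fun ω => F (G.pathVec l) ω
        * Set.indicator {ω | p t ω = G.pathVec l} (fun _ => (1 : ℝ)) ω) μ ∧
      Integrable (fun ω => F (G.pathVec l) ω * G.walkProb (q t ω) l) μ ∧
      ∫ ω, F (G.pathVec l) ω * Set.indicator {ω | p t ω = G.pathVec l} (fun _ => (1 : ℝ)) ω ∂μ
        = ∫ ω, F (G.pathVec l) ω * G.walkProb (q t ω) l ∂μ := by
    intro l hl
    rw [mem_walks] at hl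
    have hx : G.pathVec l ∈ G.paths := ⟨l, hl, rfl⟩
    have hsm : StronglyMeasurable[ℋ t] (F (G.pathVec l)) := (hF _ hx).stronglyMeasurable
    have h1 := condExp_stronglyMeasurable_mul_of_bound (ℋ.le t) hsm (hind l) B
      (Filter.Eventually.of_forall (hB _ hx))
    have h2 : μ[F (G.pathVec l) * Set.indicator {ω | p t ω = G.pathVec l} (fun _ => (1 : ℝ)) | ℋ t]
        =ᵐ[μ] fun ω => F (G.pathVec l) ω * G.walkProb (q t ω) l := by
      filter_upwards [h1, h.path_law t ht l hl] with ω e1 e2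
      rw [e1, Pi.mul_apply, e2]
    refine ⟨?_, integrable_condExp.congr h2, ?_⟩
    · exact (hind l).bdd_mul (hsm.mono (ℋ.le t)).aestronglyMeasurable
        (Filter.Eventually.of_forall (hB _ hx))
    · rw [← integral_congr_ae h2, integral_condExp (ℋ.le t)]
      rfl
  calc ∫ ω, F (p t ω) ω ∂μ = ∫ ω, ∑ l ∈ G.walks G.s, F (G.pathVec l) ω
        * Set.indicator {ω | p t ω = G.pathVec l} (fun _ => (1 : ℝ)) ω ∂μ := by
        refine integral_congr_ae (Filter.Eventually.of_forall fun ω => ?_)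
        simp only
        rw [eq_sum_indicator (h.path_mem t ht ω) (fun y => F y ω)]
        refine Finset.sum_congr rfl fun l _ => ?_
        rw [Set.indicator_apply, mul_comm]
        rfl
    _ = ∫ ω, ∑ l ∈ G.walks G.s, F (G.pathVec l) ω * G.walkProb (q t ω) l ∂μ := by
        rw [integral_finsetSum _ fun l hl => (key l hl).1,
          integral_finsetSum _ fun l hl => (key l hl).2.1]
        exact Finset.sum_congr rfl fun l hl => (key l hl).2.2
    _ = _ := by
        refine integral_congr_ae (Filter.Eventually.of_forall fun ω => ?_)
        simp only [walkMean]
        exact Finset.sum_congr rfl fun l _ => mul_comm _ _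

/-- The feedback can be replaced by its conditional mean. -/
theorem IsInteraction.integral_feedback_mul (h : G.IsInteraction μ T ℋ ℓ q p c) {t : ℕ}
    (ht : t ∈ Finset.Icc 1 T) {F : (G.Edge → ℝ) → Ω → ℝ}
    (hF : ∀ x ∈ G.paths, Measurable[ℋ t] (F x)) {B : ℝ} (hB : ∀ x ∈ G.paths, ∀ ω, |F x ω| ≤ B) :
    ∫ ω, c t ω * F (p t ω) ω ∂μ = ∫ ω, G.dot (ℓ t ω) (p t ω) * F (p t ω) ω ∂μ := by
  have hpm : Measurable (p t) := (h.path_meas t ht).mono (ℋ.le _) le_rfl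
  have hle : ℋ t ⊔ MeasurableSpace.comap (p t) inferInstance ≤ mΩ :=
    sup_le (ℋ.le t) hpm.comap_le
  have hcm : Measurable (c t) := (h.feedback_meas t ht).mono (ℋ.le _) le_rfl
  have hci : Integrable (c t) μ := integrable_of_abs_le hcm (B := 1) fun ω => by
    have := h.feedback_mem t ht ω
    rw [abs_of_nonneg this.1]
    exact this.2
  have hsm : StronglyMeasurable[ℋ t ⊔ MeasurableSpace.comap (p t) inferInstance]
      (fun ω => F (p t ω) ω) := by
    refine Measurable.stronglyMeasurable (measurable_comp_path ?_ (h.path_mem t ht) fun y hy => ?_)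
    · exact (comap_measurable (p t)).mono le_sup_right le_rfl
    · exact (hF y hy).mono le_sup_left le_rfl
  have h1 := condExp_stronglyMeasurable_mul_of_bound hle hsm hci B
    (Filter.Eventually.of_forall fun ω => hB _ (h.path_mem t ht ω) ω)
  have h2 : μ[(fun ω => F (p t ω) ω) * c t |
      ℋ t ⊔ MeasurableSpace.comap (p t) inferInstance]
      =ᵐ[μ] fun ω => G.dot (ℓ t ω) (p t ω) * F (p t ω) ω := by
    filter_upwards [h1, h.feedback_mean t ht] with ω e1 e2
    rw [e1, Pi.mul_apply, e2, mul_comm]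
  rw [← integral_congr_ae h2, integral_condExp hle]
  simp only [Pi.mul_apply, mul_comm]

theorem IsInteraction.paths_nonempty (h : G.IsInteraction μ T ℋ ℓ q p c) (hT : 1 ≤ T) :
    G.paths.Nonempty := by
  obtain ⟨ω⟩ : Nonempty Ω := nonempty_of_isProbabilityMeasure μ
  exact ⟨_, h.path_mem 1 (Finset.mem_Icc.2 ⟨le_rfl, hT⟩) ω⟩

theorem measurable_dot {Ω' : Type*} {m : MeasurableSpace Ω'} {a x : Ω' → G.Edge → ℝ}
    (ha : Measurable a) (hx : Measurable x) : Measurable fun ω => G.dot (a ω) (x ω) :=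
  Finset.measurable_sum _ fun e _ =>
    ((measurable_pi_apply e).comp ha).mul ((measurable_pi_apply e).comp hx)

theorem measurable_outflow {Ω' : Type*} {m : MeasurableSpace Ω'} {x : Ω' → G.Edge → ℝ}
    (hx : Measurable x) (v : {v : W // v ≠ G.g}) : Measurable fun ω => G.outflow (x ω) v :=
  Finset.measurable_sum _ fun e _ => (measurable_pi_apply e).comp hx

theorem IsInteraction.loss_le_one (h : G.IsInteraction μ T ℋ ℓ q p c) {t : ℕ}
    (ht : t ∈ Finset.Icc 1 T) (ω : Ω) (e : G.Edge) : |ℓ t ω e| ≤ 1 := by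
  rw [abs_of_nonneg (h.loss_nonneg t ht ω e)]
  exact G.le_one_of_dot_le (h.loss_nonneg t ht ω) (h.loss_le t ht ω) e

/-- The played flow is the conditional mean of the sampled path. -/
theorem IsInteraction.integral_dot_path (h : G.IsInteraction μ T ℋ ℓ q p c) {t : ℕ}
    (ht : t ∈ Finset.Icc 1 T) (hqf : ∀ ω, q t ω ∈ G.flows) (hq0 : ∀ ω e, 0 < q t ω e)
    {a : Ω → G.Edge → ℝ} (ha : Measurable[ℋ t] a) {B : ℝ} (hB : ∀ ω e, |a ω e| ≤ B) :
    ∫ ω, G.dot (a ω) (p t ω) ∂μ = ∫ ω, G.dot (a ω) (q t ω) ∂μ := by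
  rw [h.integral_comp_path ht (F := fun x ω => G.dot (a ω) x)
    (fun x _ => measurable_dot ha measurable_const)
    (fun x hx ω => G.abs_dot_le (hB ω) (G.paths_subset_flows hx))]
  refine integral_congr_ae (Filter.Eventually.of_forall fun ω => ?_)
  exact G.walkMean_dot ⟨_, h.path_mem t ht ω⟩ (hq0 ω) (hqf ω) (a ω)

/-- On flows, the estimator differs from an unbiased one by a constant. -/
theorem IsInteraction.integral_dot_lossEst (h : G.IsInteraction μ T ℋ ℓ q p c) {t : ℕ}
    (ht : t ∈ Finset.Icc 1 T) (hqf : ∀ ω, q t ω ∈ G.flows) {δ : ℝ} (hδ : 0 < δ)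
    (hq : ∀ ω e, δ ≤ q t ω e) {y : G.Edge → ℝ} (hy : y ∈ G.flows) :
    ∫ ω, G.dot (G.lossEst (c t ω) (p t ω) (q t ω)) y ∂μ
      = ∫ ω, (G.dot (ℓ t ω) y - G.dot (ℓ t ω) (q t ω)) ∂μ := by
  set σ : Ω → G.Edge → ℝ := fun ω e =>
    y e / q t ω e - G.outflow y (G.tail e) / G.outflow (q t ω) (G.tail e) with hσ
  have hqm : ∀ e, Measurable[ℋ t] fun ω => q t ω e := fun e =>
    (measurable_pi_apply e).comp (h.flow_meas t ht)
  have hσm : Measurable[ℋ t] σ := by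
    refine @measurable_pi_lambda _ _ _ (ℋ t) _ _ fun e => ?_
    exact (measurable_const.div (hqm e)).sub
      (measurable_const.div (measurable_outflow (h.flow_meas t ht) _))
  have hσB : ∀ ω e, |σ ω e| ≤ 1 / δ := fun ω e => G.abs_ratio_sub_le hδ (hq ω) hy e
  simp_rw [fun ω => G.dot_lossEst (c t ω) (p t ω) (q t ω) y]
  rw [h.integral_feedback_mul ht (F := fun x ω => G.dot (σ ω) x)
    (fun x _ => measurable_dot hσm measurable_const)
    (fun x hx ω => G.abs_dot_le (hσB ω) (G.paths_subset_flows hx)),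
    h.integral_comp_path ht (F := fun x ω => G.dot (ℓ t ω) x * G.dot (σ ω) x)
    (fun x _ => (measurable_dot (h.loss_meas t ht) measurable_const).mul
      (measurable_dot hσm measurable_const)) (B := G.m * 1 * (G.m * (1 / δ)))
    (fun x hx ω => by
      rw [abs_mul]
      exact mul_le_mul (G.abs_dot_le (h.loss_le_one ht ω) (G.paths_subset_flows hx))
        (G.abs_dot_le (hσB ω) (G.paths_subset_flows hx)) (abs_nonneg _) (by positivity))]
  refine integral_congr_ae (Filter.Eventually.of_forall fun ω => ?_)
  exact G.walkMean_score ⟨_, h.path_mem t ht ω⟩ (fun e => hδ.trans_le (hq ω e)) (hqf ω) hy _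

/-- The conditional variance of the choice at `e₋`. -/
theorem IsInteraction.integral_mul_sq (h : G.IsInteraction μ T ℋ ℓ q p c) {t : ℕ}
    (ht : t ∈ Finset.Icc 1 T) (hqf : ∀ ω, q t ω ∈ G.flows) (hq0 : ∀ ω e, 0 < q t ω e)
    {a : Ω → ℝ} (ha : Measurable[ℋ t] a) {B : ℝ} (hB : ∀ ω, |a ω| ≤ B) (e : G.Edge) :
    ∫ ω, a ω * (G.outflow (p t ω) (G.tail e) * (p t ω e - G.ratio (q t ω) e) ^ 2) ∂μ
      = ∫ ω, a ω * (q t ω e * (1 - G.ratio (q t ω) e)) ∂μ := by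
  -- Coefficients of the linear form into which `outflow_mul_sq` turns the square; they are known
  -- before the path is drawn.
  set d : Ω → G.Edge → ℝ := fun ω f => (1 - 2 * G.ratio (q t ω) e) * (if f = e then 1 else 0)
    + G.ratio (q t ω) e ^ 2 * (if G.tail f = G.tail e then 1 else 0) with hd
  have hdot : ∀ ω x, G.dot (fun f => a ω * d ω f) x = a ω * ((1 - 2 * G.ratio (q t ω) e) * x e
      + G.ratio (q t ω) e ^ 2 * G.outflow x (G.tail e)) := fun ω x => by
    simp only [dot, hd, mul_assoc, add_mul, ← Finset.mul_sum, Finset.sum_add_distrib, outflow,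
      Finset.sum_filter, ite_mul, one_mul, zero_mul]
    simp
  have hrm : Measurable[ℋ t] fun ω => G.ratio (q t ω) e :=
    ((measurable_pi_apply e).comp (h.flow_meas t ht)).div
      (measurable_outflow (h.flow_meas t ht) _)
  have h1 : ∀ ω, a ω * (G.outflow (p t ω) (G.tail e) * (p t ω e - G.ratio (q t ω) e) ^ 2)
      = G.dot (fun f => a ω * d ω f) (p t ω) := fun ω => by
    rw [hdot, G.outflow_mul_sq (h.path_mem t ht ω)]
  have h2 : ∀ ω, a ω * (q t ω e * (1 - G.ratio (q t ω) e))
      = G.dot (fun f => a ω * d ω f) (q t ω) := fun ω => by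
    rw [hdot]
    have : G.ratio (q t ω) e * G.outflow (q t ω) (G.tail e) = q t ω e :=
      div_mul_cancel₀ _ (G.outflow_tail_pos (hq0 ω) e).ne'
    linear_combination (-(a ω * G.ratio (q t ω) e)) * this
  simp_rw [h1, h2]
  refine h.integral_dot_path ht hqf hq0 (a := fun ω f => a ω * d ω f) ?_ (B := B * 4) ?_
  · refine @measurable_pi_lambda _ _ _ (ℋ t) _ _ fun f => ha.mul ?_
    exact ((measurable_const.sub (measurable_const.mul hrm)).mul measurable_const).add
      ((hrm.pow_const 2).mul measurable_const)
  · intro ω f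
    rw [abs_mul]
    have hr := G.ratio_mem (hq0 ω) e
    refine mul_le_mul (hB ω) ?_ (abs_nonneg _) ((abs_nonneg _).trans (hB ω))
    have hr2 : G.ratio (q t ω) e ^ 2 ≤ 1 := pow_le_one₀ hr.1 hr.2
    have hr3 := sq_nonneg (G.ratio (q t ω) e)
    simp only [hd]
    rw [abs_le]
    split_ifs <;> constructor <;> nlinarith [hr.1, hr.2]

end Sampling

end STDag

/-! ### Elementary inequalities -/

section Estimates

/-- Solves the inequality of the self-bounding technique for the regret. -/
theorem le_of_le_mul_sqrt {R U C D k : ℝ} (hU : 0 ≤ U) (hC : 0 ≤ C) (hD : 0 ≤ D) (hk : 1 ≤ k)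
    (h : R ≤ k * (√(U * (R + C)) + D)) : R ≤ 2 * k ^ 2 * (U + √(U * C) + D) := by
  have hUC := Real.sqrt_nonneg (U * C)
  rcases le_total R 0 with hR | hR
  · exact hR.trans (by positivity)
  have h1 : √(U * (R + C)) ≤ √(U * R) + √(U * C) := by
    rw [mul_add]
    have := mul_nonneg (Real.sqrt_nonneg (U * R)) hUC
    rw [Real.sqrt_le_iff]
    refine ⟨by positivity, ?_⟩
    nlinarith [Real.sq_sqrt (by positivity : 0 ≤ U * R), Real.sq_sqrt (by positivity : 0 ≤ U * C)]
  -- The arithmetic-geometric mean inequality leaves only half of `R` on the right, to be absorbed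
  -- on the left.
  have h2 : k * √(U * R) ≤ k ^ 2 * U / 2 + R / 2 := by
    rw [Real.sqrt_mul hU]
    nlinarith [sq_nonneg (k * √U - √R), Real.sq_sqrt hU, Real.sq_sqrt hR]
  have h3 : k * √(U * C) ≤ k ^ 2 * √(U * C) := by
    nlinarith [mul_nonneg (mul_nonneg (by linarith : 0 ≤ k) (by linarith : 0 ≤ k - 1)) hUC]
  have h4 : k * D ≤ k ^ 2 * D := by
    nlinarith [mul_nonneg (mul_nonneg (by linarith : 0 ≤ k) (by linarith : 0 ≤ k - 1)) hD]
  have h5 : 0 ≤ k ^ 2 * U := by positivity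
  nlinarith [mul_le_mul_of_nonneg_left h1 (by linarith : 0 ≤ k)]

theorem sum_mul_sqrt_le {ι : Type*} (s : Finset ι) {a b : ι → ℝ} (ha : ∀ i ∈ s, 0 ≤ a i)
    (hb : ∀ i ∈ s, 0 ≤ b i) : ∑ i ∈ s, √(a i) * √(b i) ≤ √(∑ i ∈ s, a i) * √(∑ i ∈ s, b i) := by
  have := Real.sum_mul_le_sqrt_mul_sqrt s (fun i => √(a i)) (fun i => √(b i))
  rwa [Finset.sum_congr rfl fun i hi => Real.sq_sqrt (ha i hi),
    Finset.sum_congr rfl fun i hi => Real.sq_sqrt (hb i hi)] at this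

theorem sum_sqrt_le {ι : Type*} (s : Finset ι) {b : ι → ℝ}
    (hb : ∀ i ∈ s, 0 ≤ b i) : ∑ i ∈ s, √(b i) ≤ √(s.card * ∑ i ∈ s, b i) := by
  have := sum_mul_sqrt_le s (a := fun _ => 1) (fun _ _ => zero_le_one) hb
  rw [Real.sqrt_mul (by positivity)]
  simpa using this

theorem integral_sqrt_le {Ω : Type*} {mΩ : MeasurableSpace Ω} {μ : Measure Ω}
    [IsProbabilityMeasure μ] {f : Ω → ℝ} (hf : Measurable f) {B : ℝ}
    (hB : ∀ ω, f ω ∈ Set.Icc 0 B) : ∫ ω, √(f ω) ∂μ ≤ √(∫ ω, f ω ∂μ) := by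
  refine Real.strictConcaveOn_sqrt.concaveOn.le_map_integral Real.continuous_sqrt.continuousOn
    isClosed_Ici (Filter.Eventually.of_forall fun ω => (hB ω).1) ?_ ?_
  · exact Integrable.of_bound hf.aestronglyMeasurable B (Filter.Eventually.of_forall fun ω => by
      rw [Real.norm_of_nonneg (hB ω).1]
      exact (hB ω).2)
  · exact Integrable.of_bound hf.sqrt.aestronglyMeasurable √B
      (Filter.Eventually.of_forall fun ω => by
        rw [Function.comp_apply, Real.norm_of_nonneg (Real.sqrt_nonneg _)]
        exact Real.sqrt_le_sqrt (hB ω).2)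

theorem one_le_two_mul_log {T : ℕ} (hT : 2 ≤ T) : 1 ≤ 2 * Real.log T := by
  have h1 := Real.log_two_gt_d9
  have h2 : Real.log 2 ≤ Real.log T :=
    Real.log_le_log (by norm_num) (by exact_mod_cast hT)
  linarith

theorem sum_one_div_le {T : ℕ} (hT : 2 ≤ T) :
    ∑ t ∈ Finset.Icc 1 T, 1 / (t : ℝ) ≤ 3 * Real.log T := by
  have h1 := harmonic_le_one_add_log T
  rw [harmonic_eq_sum_Icc] at h1
  push_cast at h1
  simp only [one_div]
  linarith [one_le_two_mul_log hT]

theorem sqrt_sub_sqrt_mem (t : ℕ) (ht : 1 ≤ t) :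
    √(t : ℝ) - √((t : ℝ) - 1) ∈ Set.Icc 0 (1 / √(t : ℝ)) := by
  have ht' : (1 : ℝ) ≤ t := by exact_mod_cast ht
  have h0 : 0 < √(t : ℝ) := Real.sqrt_pos.2 (by linarith)
  have h1 : √((t : ℝ) - 1) ≤ √(t : ℝ) := Real.sqrt_le_sqrt (by linarith)
  refine ⟨sub_nonneg.2 h1, ?_⟩
  rw [le_div_iff₀ h0]
  nlinarith [Real.sq_sqrt (by linarith : (0 : ℝ) ≤ t),
    Real.sq_sqrt (by linarith : (0 : ℝ) ≤ (t : ℝ) - 1), Real.sqrt_nonneg ((t : ℝ) - 1)]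

theorem sum_sqrt_sub_sqrt (T : ℕ) :
    ∑ t ∈ Finset.Icc 1 T, (√(t : ℝ) - √((t : ℝ) - 1)) = √(T : ℝ) := by
  induction T with
  | zero => simp
  | succ T ih =>
    rw [Finset.sum_Icc_succ_top (by omega), ih]
    push_cast
    rw [add_sub_cancel_right]
    ring

theorem sum_one_div_sqrt_le (T : ℕ) : ∑ t ∈ Finset.Icc 1 T, 1 / √(t : ℝ) ≤ 2 * √(T : ℝ) := by
  rw [← sum_sqrt_sub_sqrt, Finset.mul_sum]
  refine Finset.sum_le_sum fun t ht => ?_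
  have ht' : (1 : ℝ) ≤ t := by exact_mod_cast (Finset.mem_Icc.1 ht).1
  have h0 : 0 < √(t : ℝ) := Real.sqrt_pos.2 (by linarith)
  rw [div_le_iff₀ h0]
  nlinarith [Real.sq_sqrt (by linarith : (0 : ℝ) ≤ t), sq_nonneg (√(t : ℝ) - √((t : ℝ) - 1)),
    Real.sq_sqrt (by linarith : (0 : ℝ) ≤ (t : ℝ) - 1)]

/-- Abel summation, with `√0 = 0` supplying the first increment. It pairs the entropy of every
leader with that of the comparator, so the penalty is small whenever the leader is close to `p*`. -/
theorem sum_sqrt_parts {T : ℕ} (hT : 1 ≤ T) (S : ℕ → ℝ) (Y : ℝ) :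
    -√(T : ℝ) * Y + S 1 + ∑ t ∈ Finset.Ico 1 T, (√((t + 1 : ℕ) : ℝ) - √(t : ℝ)) * S (t + 1)
      = ∑ t ∈ Finset.Icc 1 T, (√(t : ℝ) - √((t : ℝ) - 1)) * (S t - Y) := by
  induction T, hT using Nat.le_induction with
  | base => simp; ring
  | succ T hT ih =>
    rw [Finset.sum_Icc_succ_top (by omega), ← ih, Finset.sum_Ico_succ_top hT]
    push_cast
    rw [add_sub_cancel_right]
    ring

end Estimates

namespace STDag

/-! ### Regret as expected regret on the estimated losses -/

section Game

variable {W : Type*} [Fintype W] [DecidableEq W] {G : STDag W} {Ω : Type*} {mΩ : MeasurableSpace Ω}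
  {μ : Measure Ω} {T : ℕ} {ℋ : Filtration ℕ mΩ} {ℓ q p : ℕ → Ω → G.Edge → ℝ} {c : ℕ → Ω → ℝ}

theorem dot_sub (a x y : G.Edge → ℝ) : G.dot a (x - y) = G.dot a x - G.dot a y := by
  simp [dot, mul_sub, Finset.sum_sub_distrib]

theorem dot_mix (a x y : G.Edge → ℝ) (ε : ℝ) :
    G.dot a ((1 - ε) • x + ε • y) = (1 - ε) * G.dot a x + ε * G.dot a y := by
  simp only [dot, Finset.mul_sum, ← Finset.sum_add_distrib]
  refine Finset.sum_congr rfl fun e _ => ?_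
  simp only [Pi.add_apply, Pi.smul_apply, smul_eq_mul]
  ring

theorem dot_nonneg {a x : G.Edge → ℝ} (ha : ∀ e, 0 ≤ a e) (hx : x ∈ G.flows) : 0 ≤ G.dot a x :=
  Finset.sum_nonneg fun e _ => mul_nonneg (ha e) (G.mem_Icc_of_mem_flows hx e).1

theorem IsInteraction.dot_mem (h : G.IsInteraction μ T ℋ ℓ q p c) {t : ℕ}
    (ht : t ∈ Finset.Icc 1 T) (ω : Ω) {x : G.Edge → ℝ} (hx : x ∈ G.flows) :
    G.dot (ℓ t ω) x ∈ Set.Icc (0 : ℝ) 1 :=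
  ⟨dot_nonneg (h.loss_nonneg t ht ω) hx, G.dot_le_of_forall_paths (h.loss_le t ht ω) hx⟩

theorem IsInteraction.path_measurable (h : G.IsInteraction μ T ℋ ℓ q p c) {t : ℕ}
    (ht : t ∈ Finset.Icc 1 T) : Measurable (p t) := (h.path_meas t ht).mono (ℋ.le _) le_rfl

theorem IsInteraction.flow_measurable (h : G.IsInteraction μ T ℋ ℓ q p c) {t : ℕ}
    (ht : t ∈ Finset.Icc 1 T) : Measurable (q t) := (h.flow_meas t ht).mono (ℋ.le _) le_rfl

theorem IsInteraction.loss_measurable (h : G.IsInteraction μ T ℋ ℓ q p c) {t : ℕ}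
    (ht : t ∈ Finset.Icc 1 T) : Measurable (ℓ t) := (h.loss_meas t ht).mono (ℋ.le _) le_rfl

theorem IsInteraction.feedback_measurable (h : G.IsInteraction μ T ℋ ℓ q p c) {t : ℕ}
    (ht : t ∈ Finset.Icc 1 T) : Measurable (c t) := (h.feedback_meas t ht).mono (ℋ.le _) le_rfl

variable [IsProbabilityMeasure μ]

theorem IsInteraction.integrable_dot (h : G.IsInteraction μ T ℋ ℓ q p c) {t : ℕ}
    (ht : t ∈ Finset.Icc 1 T) {x : Ω → G.Edge → ℝ} (hx : Measurable x)
    (hxf : ∀ ω, x ω ∈ G.flows) : Integrable (fun ω => G.dot (ℓ t ω) (x ω)) μ :=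
  integrable_of_abs_le (measurable_dot (h.loss_measurable ht) hx) (B := 1) fun ω => by
    have := h.dot_mem ht ω (hxf ω)
    rw [abs_of_nonneg this.1]
    exact this.2

theorem IsInteraction.integrable_regret (h : G.IsInteraction μ T ℋ ℓ q p c) {y : G.Edge → ℝ}
    (hy : y ∈ G.flows) :
    ∀ t ∈ Finset.Icc 1 T, Integrable (fun ω => G.dot (ℓ t ω) (p t ω - y)) μ := fun t ht => by
  simp only [dot_sub]
  exact (h.integrable_dot ht (h.path_measurable ht)
    fun ω => G.paths_subset_flows (h.path_mem t ht ω)).sub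
    (h.integrable_dot ht measurable_const fun _ => hy)

theorem IsInteraction.regret_le_horizon (h : G.IsInteraction μ T ℋ ℓ q p c) {y : G.Edge → ℝ}
    (hy : y ∈ G.flows) : G.regret μ T ℓ p y ≤ T := by
  have h1 : G.regret μ T ℓ p y ≤ ∫ _, (T : ℝ) ∂μ := by
    refine integral_mono (integrable_finsetSum _ (h.integrable_regret hy))
      (integrable_const _) fun ω => ?_
    refine (Finset.sum_le_card_nsmul _ _ 1 fun t ht => ?_).trans (by simp)
    have h1 := h.dot_mem ht ω (G.paths_subset_flows (h.path_mem t ht ω))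
    have h2 := h.dot_mem ht ω hy
    rw [dot_sub]
    linarith [h1.2, h2.1]
  simpa using h1

/-- The loss of a flow lies in `[0, 1]`, so mixing costs at most `ε` per round. It allows
comparators with positive coordinates only. -/
theorem IsInteraction.regret_le_regret_mix (h : G.IsInteraction μ T ℋ ℓ q p c)
    {x y : G.Edge → ℝ} (hx : x ∈ G.flows) (hy : y ∈ G.flows) {ε : ℝ} (hε : ε ∈ Set.Icc (0 : ℝ) 1) :
    G.regret μ T ℓ p x ≤ G.regret μ T ℓ p ((1 - ε) • x + ε • y) + ε * T := by
  have hm : (1 - ε) • x + ε • y ∈ G.flows :=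
    G.convex_flows hx hy (by linarith [hε.2]) hε.1 (by ring)
  have hint := integrable_finsetSum _ (h.integrable_regret hm)
  have h1 : G.regret μ T ℓ p x ≤
      ∫ ω, (∑ t ∈ Finset.Icc 1 T, G.dot (ℓ t ω) (p t ω - ((1 - ε) • x + ε • y)) + ε * T) ∂μ := by
    refine integral_mono (integrable_finsetSum _ (h.integrable_regret hx))
      (hint.add (integrable_const _)) fun ω => ?_
    have h2 : ∑ t ∈ Finset.Icc 1 T, ε = ε * T := by simp [mul_comm]
    simp only
    rw [← h2, ← Finset.sum_add_distrib]
    refine Finset.sum_le_sum fun t ht => ?_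
    have h3 := h.dot_mem ht ω hx
    have h4 := h.dot_mem ht ω hy
    rw [dot_sub, dot_sub, dot_mix]
    nlinarith [hε.1, h3.1, h4.2]
  rw [integral_add hint (integrable_const _)] at h1
  simpa [regret] using h1

/-- The coordinates of the played flows are bounded away from zero, uniformly over the
outcomes. -/
theorem IsInteraction.exists_lower_bound (h : G.IsInteraction μ T ℋ ℓ q p c) {a : ℕ → ℝ}
    {w : ℕ → Ω → G.Edge → ℝ} {A M : ℝ} (ha : ∀ t ∈ Finset.Icc 1 T, a t ∈ Set.Icc 0 A)
    (hw : ∀ t ∈ Finset.Icc 1 T, ∀ ω e, w t ω e ∈ Set.Icc 1 M)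
    (hq : ∀ t ∈ Finset.Icc 1 T, ∀ ω, IsHybridArgmin G.flows
      (G.cumLossEst (fun t => p t ω) (fun t => q t ω) (fun t => c t ω) t) (a t) (w t ω) (q t ω)) :
    ∀ t ∈ Finset.Icc 1 T, ∃ δ > 0, ∀ ω e, δ ≤ q t ω e := by
  intro t
  induction t using Nat.strong_induction_on with
  | _ t ih =>
    intro ht
    -- Lower bounds in the earlier rounds make the past estimates bounded uniformly in the outcome,
    -- which in turn keeps the next leader away from the boundary.
    have hB : ∀ τ, ∃ B : ℝ, τ ∈ Finset.Ico 1 t →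
        ∀ ω e, |G.lossEst (c τ ω) (p τ ω) (q τ ω) e| ≤ B := by
      intro τ
      by_cases hτ : τ ∈ Finset.Ico 1 t
      · have hτ' := Finset.mem_Ico.1 hτ
        have hτT : τ ∈ Finset.Icc 1 T :=
          Finset.mem_Icc.2 ⟨hτ'.1, hτ'.2.le.trans (Finset.mem_Icc.1 ht).2⟩
        obtain ⟨δ, hδ, hδq⟩ := ih τ hτ'.2 hτT
        exact ⟨1 / δ, fun _ ω e => G.abs_lossEst_le hδ (hδq ω) (h.path_mem τ hτT ω)
          (h.feedback_mem τ hτT ω) e⟩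
      · exact ⟨0, fun h => absurd h hτ⟩
    choose B hB using hB
    -- The leader at one fixed outcome serves as the positive reference point for all outcomes.
    obtain ⟨ω₀⟩ : Nonempty Ω := nonempty_of_isProbabilityMeasure μ
    obtain ⟨δ, hδ, hδq⟩ := IsHybridArgmin.exists_le (S := G.flows)
      (B := ∑ τ ∈ Finset.Ico 1 t, B τ) (A := A) (M := M)
      (fun x hx => G.mem_Icc_of_mem_flows hx) (hq t ht ω₀).1 (hq t ht ω₀).2.1
    refine ⟨δ, hδ, fun ω e => hδq _ _ _ _ (fun e => ?_) (ha t ht) (hw t ht ω) (hq t ht ω) e⟩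
    exact (Finset.abs_sum_le_sum_abs _ _).trans (Finset.sum_le_sum fun τ hτ => hB τ hτ ω e)

theorem IsInteraction.integrable_dot_lossEst (h : G.IsInteraction μ T ℋ ℓ q p c)
    (hlow : ∀ t ∈ Finset.Icc 1 T, ∃ δ > 0, ∀ ω e, δ ≤ q t ω e) {y : G.Edge → ℝ}
    (hy : y ∈ G.flows) : ∀ t ∈ Finset.Icc 1 T,
      Integrable (fun ω => G.dot (G.lossEst (c t ω) (p t ω) (q t ω)) y) μ := fun t ht => by
  obtain ⟨δ, hδ, hδq⟩ := hlow t ht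
  refine integrable_of_abs_le (measurable_dot ?_ measurable_const) (B := G.m * (1 / δ))
    fun ω => G.abs_dot_le (fun e => G.abs_lossEst_le hδ (hδq ω) (h.path_mem t ht ω)
      (h.feedback_mem t ht ω) e) hy
  have hp := h.path_measurable ht
  have hq := h.flow_measurable ht
  refine measurable_pi_lambda _ fun e => (h.feedback_measurable ht).mul ?_
  exact (((measurable_pi_apply e).comp hp).div ((measurable_pi_apply e).comp hq)).sub
    ((measurable_outflow hp _).div (measurable_outflow hq _))

/-- The regret in terms of the estimated losses. -/
theorem IsInteraction.regret_eq (h : G.IsInteraction μ T ℋ ℓ q p c)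
    (hqf : ∀ t ∈ Finset.Icc 1 T, ∀ ω, q t ω ∈ G.flows)
    (hlow : ∀ t ∈ Finset.Icc 1 T, ∃ δ > 0, ∀ ω e, δ ≤ q t ω e) {y : G.Edge → ℝ}
    (hy : y ∈ G.flows) : G.regret μ T ℓ p y =
      ∫ ω, ∑ t ∈ Finset.Icc 1 T, -G.dot (G.lossEst (c t ω) (p t ω) (q t ω)) y ∂μ := by
  have hneg : ∀ t ∈ Finset.Icc 1 T,
      Integrable (fun ω => -G.dot (G.lossEst (c t ω) (p t ω) (q t ω)) y) μ :=
    fun t ht => (h.integrable_dot_lossEst hlow hy t ht).neg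
  rw [regret, integral_finsetSum _ (h.integrable_regret hy), integral_finsetSum _ hneg]
  refine Finset.sum_congr rfl fun t ht => ?_
  obtain ⟨δ, hδ, hδq⟩ := hlow t ht
  have hq0 : ∀ ω e, 0 < q t ω e := fun ω e => hδ.trans_le (hδq ω e)
  have i1 := h.integrable_dot ht (h.path_measurable ht)
    fun ω => G.paths_subset_flows (h.path_mem t ht ω)
  have i2 := h.integrable_dot ht (measurable_const (a := y)) fun _ => hy
  have i3 := h.integrable_dot ht (h.flow_measurable ht) (hqf t ht)
  rw [integral_neg, h.integral_dot_lossEst ht (hqf t ht) hδ hδq hy, integral_sub i2 i3]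
  simp only [dot_sub]
  rw [integral_sub i1 i2, h.integral_dot_path ht (hqf t ht) hq0 (h.loss_meas t ht)
    (h.loss_le_one ht)]
  ring

end Game

end STDag

/-- Two minimizers have Bregman divergence zero, and its Tsallis part separates points as `a > 0`.
It makes the first Tsallis flow deterministic. -/
theorem IsHybridArgmin.unique {ι : Type*} [Fintype ι] {S : Set (ι → ℝ)} {b w x y : ι → ℝ} {a : ℝ}
    (hS : Convex ℝ S) (ha : 0 < a) (hw : ∀ e, 0 ≤ w e) (hx : IsHybridArgmin S b a w x)
    (hy : IsHybridArgmin S b a w y) : x = y := by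
  have h1 := hy.add_breg_le hS hx.1 hx.2.1
  have h2 := hx.2.2 y hy.1 hy.2.1
  have h3 : hybridBreg a w x y ≤ 0 := by linarith
  have hnn : ∀ e, 0 ≤ a * (√(x e) - √(y e)) ^ 2 / √(y e) := fun e => by positivity
  have hnn' : ∀ e, 0 ≤ w e * (x e / y e - 1 - Real.log (x e / y e)) := fun e =>
    mul_nonneg (hw e) (sub_one_sub_log_nonneg (div_pos (hx.2.1 e) (hy.2.1 e)))
  have h4 := (Finset.sum_eq_zero_iff_of_nonneg fun e _ => add_nonneg (hnn e) (hnn' e)).1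
    (le_antisymm h3 (Finset.sum_nonneg fun e _ => add_nonneg (hnn e) (hnn' e)))
  ext e
  have h5 := h4 e (Finset.mem_univ e)
  have h6 : a * (√(x e) - √(y e)) ^ 2 / √(y e) = 0 := by linarith [hnn e, hnn' e]
  have h7 := (Real.sqrt_pos.2 (hy.2.1 e)).ne'
  have h8 : √(x e) = √(y e) := by
    simpa [ha.ne', h7, sub_eq_zero] using h6
  rwa [Real.sqrt_inj (hx.2.1 e).le (hy.2.1 e).le] at h8

namespace STDag

/-! ### The self-bounding regime -/

section SelfBounding

variable {W : Type*} [Fintype W] [DecidableEq W] {G : STDag W} {Ω : Type*} {mΩ : MeasurableSpace Ω}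
  {μ : Measure Ω} {T : ℕ} {ℋ : Filtration ℕ mΩ} {ℓ q p : ℕ → Ω → G.Edge → ℝ} {c : ℕ → Ω → ℝ}
  {pstar : G.Edge → ℝ} {π : {v : W // v ≠ G.g} → G.Edge} {Δ : G.Edge → ℝ} {C : ℝ}

theorem IsSelfBounding.gapStar_le (e : G.Edge) (he : e ∈ G.exits pstar π) :
    G.gapStar pstar π Δ ≤ Δ e :=
  ciInf_le (f := fun e : {e // e ∈ G.offPolicy π ∧ G.outflow pstar (G.tail e) = 1} => Δ e.1)
    (Set.finite_range _).bddBelow ⟨e, Finset.mem_filter.1 he⟩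

theorem IsSelfBounding.gapStar_pos (h : G.IsSelfBounding μ T ℓ p pstar π Δ C)
    (hE : (G.offPolicy π).Nonempty) : 0 < G.gapStar pstar π Δ := by
  obtain ⟨e, he⟩ := G.exits_nonempty h.path_mem h.consistent hE
  have : Nonempty {e // e ∈ G.offPolicy π ∧ G.outflow pstar (G.tail e) = 1} :=
    ⟨⟨e, Finset.mem_filter.1 he⟩⟩
  obtain ⟨f, hf⟩ := exists_eq_ciInf_of_finite
    (f := fun e : {e // e ∈ G.offPolicy π ∧ G.outflow pstar (G.tail e) = 1} => Δ e.1)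
  rw [gapStar, ← hf]
  exact h.gap_pos _ f.2.1

theorem IsSelfBounding.gapMin_pos (h : G.IsSelfBounding μ T ℓ p pstar π Δ C)
    (hE : (G.offPolicy π).Nonempty) : 0 < G.gapMin π Δ := by
  obtain ⟨e, he⟩ := hE
  have : Nonempty {e // e ∈ G.offPolicy π} := ⟨⟨e, he⟩⟩
  obtain ⟨f, hf⟩ := exists_eq_ciInf_of_finite (f := fun e : {e // e ∈ G.offPolicy π} => Δ e.1)
  rw [gapMin, ← hf]
  exact h.gap_pos _ f.2

theorem IsSelfBounding.gapMin_le_gapStar (h : G.IsSelfBounding μ T ℓ p pstar π Δ C)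
    (hE : (G.offPolicy π).Nonempty) : G.gapMin π Δ ≤ G.gapStar pstar π Δ := by
  obtain ⟨e, he⟩ := G.exits_nonempty h.path_mem h.consistent hE
  have : Nonempty {e // e ∈ G.offPolicy π ∧ G.outflow pstar (G.tail e) = 1} :=
    ⟨⟨e, Finset.mem_filter.1 he⟩⟩
  exact le_ciInf fun f => ciInf_le (f := fun e : {e // e ∈ G.offPolicy π} => Δ e.1)
    (Set.finite_range _).bddBelow ⟨f.1, f.2.1⟩

theorem IsSelfBounding.regret_eq_zero (h : G.IsSelfBounding μ T ℓ p pstar π Δ C)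
    (hE : G.offPolicy π = ∅) (hp : ∀ t ∈ Finset.Icc 1 T, ∀ ω, p t ω ∈ G.paths) :
    G.regret μ T ℓ p pstar = 0 := by
  have : ∀ ω, ∑ t ∈ Finset.Icc 1 T, G.dot (ℓ t ω) (p t ω - pstar) = 0 := fun ω =>
    Finset.sum_eq_zero fun t ht => by
      rw [G.eq_of_offPolicy_eq_empty hE (hp t ht ω) h.path_mem, sub_self]
      simp [dot]
  simp [regret, this]

theorem IsSelfBounding.gapSum_nonneg (h : G.IsSelfBounding μ T ℓ p pstar π Δ C) :
    0 ≤ G.gapSum T π Δ :=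
  Finset.sum_nonneg fun e he => div_nonneg (Real.log_natCast_nonneg T) (h.gap_pos e he).le

/-- `m ≤ |E'| + n + 1 ≤ 2|E'| + n²` when `E'` is nonempty, and all gaps are at most 1. So additive
terms of order `m log T` are absorbed by `U`. -/
theorem IsSelfBounding.m_mul_log_le (h : G.IsSelfBounding μ T ℓ p pstar π Δ C)
    (hE : (G.offPolicy π).Nonempty) {d : ℝ} (hd : 0 < d) (hd1 : d ≤ 1) :
    G.m * Real.log T ≤ 2 * (G.gapSum T π Δ + (G.n : ℝ) ^ 2 * Real.log T / d) := by
  have hl := Real.log_natCast_nonneg T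
  have h1 : ((G.offPolicy π).card : ℝ) * Real.log T ≤ G.gapSum T π Δ := by
    rw [← nsmul_eq_mul, ← Finset.sum_const]
    refine Finset.sum_le_sum fun e he => ?_
    rw [le_div_iff₀ (h.gap_pos e he)]
    exact mul_le_of_le_one_right hl (h.gap_mem e).2
  have h2 : (G.n : ℝ) ^ 2 * Real.log T ≤ (G.n : ℝ) ^ 2 * Real.log T / d := by
    rw [le_div_iff₀ hd]
    exact mul_le_of_le_one_right (by positivity) hd1
  have h3 : (G.n : ℝ) ≤ (G.n : ℝ) ^ 2 := by exact_mod_cast Nat.le_self_pow two_ne_zero G.n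
  have h4 : (1 : ℝ) ≤ (G.offPolicy π).card := by exact_mod_cast Finset.card_pos.2 hE
  have h5 := G.m_le (π := π)
  have h6 : (G.m : ℝ) ≤ 2 * (G.offPolicy π).card + (G.n : ℝ) ^ 2 := by linarith
  have h7 := mul_le_mul_of_nonneg_right h6 hl
  have h8 : 0 ≤ (G.n : ℝ) ^ 2 * Real.log T := by positivity
  linarith

variable [IsProbabilityMeasure μ]

/-- The self-bounding property in terms of the played flows. -/
theorem IsSelfBounding.integral_le (hs : G.IsSelfBounding μ T ℓ p pstar π Δ C)
    (h : G.IsInteraction μ T ℋ ℓ q p c) (hqf : ∀ t ∈ Finset.Icc 1 T, ∀ ω, q t ω ∈ G.flows)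
    (hq0 : ∀ t ∈ Finset.Icc 1 T, ∀ ω e, 0 < q t ω e) :
    ∫ ω, ∑ t ∈ Finset.Icc 1 T, ∑ e ∈ G.offPolicy π, Δ e * q t ω e ∂μ
      ≤ G.regret μ T ℓ p pstar + C := by
  have hdot : ∀ x : G.Edge → ℝ, ∑ e ∈ G.offPolicy π, Δ e * x e
      = G.dot (fun e => if e ∈ G.offPolicy π then Δ e else 0) x := fun x => by
    simp [dot, ite_mul, Finset.sum_ite_mem, -Finset.univ_eq_attach]
  have hb := hs.bound
  simp only [hdot] at hb ⊢
  have hB : ∀ e, |if e ∈ G.offPolicy π then Δ e else 0| ≤ 1 := fun e => by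
    split_ifs
    · rw [abs_of_nonneg (hs.gap_mem e).1]
      exact (hs.gap_mem e).2
    · simp
  rw [integral_finsetSum] at hb ⊢
  · rw [Finset.sum_congr rfl fun t ht => h.integral_dot_path ht (hqf t ht) (hq0 t ht)
      measurable_const fun _ => hB] at hb
    linarith
  · exact fun t ht => integrable_of_abs_le (measurable_dot measurable_const (h.flow_measurable ht))
      fun ω => G.abs_dot_le hB (hqf t ht ω)
  · exact fun t ht => integrable_of_abs_le (measurable_dot measurable_const (h.path_measurable ht))
      fun ω => G.abs_dot_le hB (G.paths_subset_flows (h.path_mem t ht ω))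

theorem IsInteraction.integrable_mul_sq (h : G.IsInteraction μ T ℋ ℓ q p c) {t : ℕ}
    (ht : t ∈ Finset.Icc 1 T) (hq0 : ∀ ω e, 0 < q t ω e)
    {a : Ω → ℝ} (ha : Measurable a) {B : ℝ} (hB : ∀ ω, |a ω| ≤ B) (e : G.Edge) :
    Integrable (fun ω =>
      a ω * (G.outflow (p t ω) (G.tail e) * (p t ω e - G.ratio (q t ω) e) ^ 2)) μ := by
  have hp := h.path_measurable ht
  have hq := h.flow_measurable ht
  refine integrable_of_abs_le (B := B * 1) (ha.mul ((measurable_outflow hp _).mul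
    ((((measurable_pi_apply e).comp hp).sub (((measurable_pi_apply e).comp hq).div
      (measurable_outflow hq _))).pow_const 2))) fun ω => ?_
  rw [abs_mul]
  refine mul_le_mul (hB ω) ?_ (abs_nonneg _) ((abs_nonneg _).trans (hB ω))
  have hpf := G.paths_subset_flows (h.path_mem t ht ω)
  have h1 := G.mem_Icc_of_mem_flows hpf e
  have h2 := G.ratio_mem (hq0 ω) e
  have h3 := G.outflow_nonneg (fun e => (G.mem_Icc_of_mem_flows hpf e).1) (G.tail e)
  rw [abs_of_nonneg (by positivity)]
  refine mul_le_one₀ (G.outflow_le_one hpf _) (sq_nonneg _) ?_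
  rw [sq_le_one_iff_abs_le_one, abs_le]
  constructor <;> linarith [h1.1, h1.2, h2.1, h2.2]

end SelfBounding

/-! ### General regret bound for the Tsallis algorithm -/

section Tsallis

variable {W : Type*} [Fintype W] [DecidableEq W] {G : STDag W} {T : ℕ}

theorem IsTsallisFTRL.isHybridArgmin {p q : ℕ → G.Edge → ℝ} {c : ℕ → ℝ}
    (h : G.IsTsallisFTRL T p q c) {t : ℕ} (ht : t ∈ Finset.Icc 1 T) :
    IsHybridArgmin G.flows (G.cumLossEst p q c t) √(t : ℝ) (fun _ => 2) (q t) := by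
  obtain ⟨h1, h2, h3⟩ := h t ht
  have hreg : ∀ x, G.tsallisReg t x = hybridReg √(t : ℝ) (fun _ => 2) x := fun x => by
    rw [tsallisReg, hybridReg, tsallisRate, div_div_eq_mul_div, div_one]
  refine ⟨h1, h2, fun y hy hy0 => ?_⟩
  have := h3 y hy hy0
  simp only [hreg] at this
  exact this

/-- The barrier part has constant weight and contributes only its values at the two ends. The
Tsallis part is summed by parts, and the last sum is stability. -/
theorem IsTsallisFTRL.sum_neg_dot_le {p q : ℕ → G.Edge → ℝ} {c : ℕ → ℝ}
    (h : G.IsTsallisFTRL T p q c) (hT : 1 ≤ T) (hp : ∀ t ∈ Finset.Icc 1 T, p t ∈ G.paths)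
    (hc : ∀ t ∈ Finset.Icc 1 T, c t ∈ Set.Icc (0 : ℝ) 1)
    {y : G.Edge → ℝ} (hy : y ∈ G.flows) (hy0 : ∀ e, 0 < y e) :
    ∑ t ∈ Finset.Icc 1 T, -G.dot (G.lossEst (c t) (p t) (q t)) y ≤
      2 * ∑ e, (Real.log (q 1 e) - Real.log (y e))
      + ∑ t ∈ Finset.Icc 1 T, 2 * (√(t : ℝ) - √((t : ℝ) - 1)) * (∑ e, √(q t e) - ∑ e, √(y e))
      + ∑ t ∈ Finset.Icc 1 T, ∑ e, 9 / 4 * G.rho (c t) (p t) (q t) e / (√(t : ℝ) * √(q t e)) := by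
  have hpos : ∀ t ∈ Finset.Icc 1 T, ∀ e, 0 < q t e := fun t ht => (h.isHybridArgmin ht).2.1
  have key := ftrl_regret G.convex_flows hT (g := fun t => G.lossEst (c t) (p t) (q t)) (q := q)
    (a := fun t => √(t : ℝ)) (w := fun _ _ => 2)
    (st := fun t => ∑ e, 9 / 4 * G.rho (c t) (p t) (q t) e / (√(t : ℝ) * √(q t e)))
    (fun t ht => h.isHybridArgmin ht) (fun t ht x hx => by
      have ht0 : 0 < √(t : ℝ) := Real.sqrt_pos.2 (by exact_mod_cast (Finset.mem_Icc.1 ht).1)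
      have := tsallis_stability_sum ht0 (hpos t ht) hx
        (fun e => G.abs_mul_lossEst_le_one (hpos t ht) (hp t ht) (hc t ht) e)
      simpa only [G.sq_mul_lossEst (hpos t ht) (hp t ht)] using this) hy hy0
  have h1 : ∑ t ∈ Finset.Icc 1 T, -G.dot (G.lossEst (c t) (p t) (q t)) y
      = ∑ t ∈ Finset.Icc 1 T, ∑ e, G.lossEst (c t) (p t) (q t) e * (q t e - y e) := by
    refine Finset.sum_congr rfl fun t ht => ?_
    have := G.dot_lossEst_self (hpos t ht) (c t) (p t)
    simp only [dot, mul_sub, Finset.sum_sub_distrib] at this ⊢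
    rw [this, zero_sub]
  have h2 := sum_sqrt_parts hT (fun t => ∑ e, √(q t e)) (∑ e, √(y e))
  have h3 : ∑ t ∈ Finset.Icc 1 T, 2 * (√(t : ℝ) - √((t : ℝ) - 1)) * (∑ e, √(q t e) - ∑ e, √(y e))
      = 2 * ∑ t ∈ Finset.Icc 1 T, (√(t : ℝ) - √((t : ℝ) - 1)) *
        (∑ e, √(q t e) - ∑ e, √(y e)) := by
    rw [Finset.mul_sum]
    exact Finset.sum_congr rfl fun t _ => by ring
  rw [h1, h3, ← h2]
  refine key.trans (le_of_eq ?_)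
  congr 1
  have h4 : ∑ t ∈ Finset.Ico 1 T, (hybridReg √(t : ℝ) (fun _ => 2) (q (t + 1))
      - hybridReg √((t + 1 : ℕ) : ℝ) (fun _ => 2) (q (t + 1)))
      = 2 * ∑ t ∈ Finset.Ico 1 T, (√((t + 1 : ℕ) : ℝ) - √(t : ℝ)) * ∑ e, √(q (t + 1) e) := by
    rw [Finset.mul_sum]
    refine Finset.sum_congr rfl fun t _ => ?_
    simp only [hybridReg]
    ring
  rw [h4]
  simp only [hybridReg, Nat.cast_one, Real.sqrt_one, Finset.sum_sub_distrib, ← Finset.mul_sum]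
  ring

variable {Ω : Type*} {mΩ : MeasurableSpace Ω}
  {μ : Measure Ω} {ℋ : Filtration ℕ mΩ} {ℓ q p : ℕ → Ω → G.Edge → ℝ} {c : ℕ → Ω → ℝ}
  [IsProbabilityMeasure μ] {pstar : G.Edge → ℝ} {π : {v : W // v ≠ G.g} → G.Edge}
  {Δ : G.Edge → ℝ} {C : ℝ}

/-- The bound on the contribution of round `t` to the regret of the Tsallis algorithm. -/
noncomputable def tsallisTerm (G : STDag W) (t : ℕ) (b : ℝ) (x : G.Edge → ℝ) : ℝ :=
  2 * (√(t : ℝ) - √((t : ℝ) - 1)) * (∑ e, √(x e) - b)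
    + ∑ e, 9 / 4 / √(t : ℝ) * (√(x e) * (1 - G.ratio x e))

theorem IsInteraction.tsallis_lower_bound (h : G.IsInteraction μ T ℋ ℓ q p c)
    (hF : ∀ ω, G.IsTsallisFTRL T (fun t => p t ω) (fun t => q t ω) (fun t => c t ω)) :
    ∀ t ∈ Finset.Icc 1 T, ∃ δ > 0, ∀ ω e, δ ≤ q t ω e := by
  refine h.exists_lower_bound (A := √(T : ℝ)) (M := 2) (a := fun t => √(t : ℝ))
    (w := fun _ _ _ => 2) (fun t ht => ⟨Real.sqrt_nonneg _, Real.sqrt_le_sqrt ?_⟩)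
    (fun _ _ _ _ => ⟨one_le_two, le_rfl⟩) fun t ht ω => (hF ω).isHybridArgmin ht
  exact_mod_cast (Finset.mem_Icc.1 ht).2

theorem IsInteraction.integrable_sqrt_flow (h : G.IsInteraction μ T ℋ ℓ q p c)
    {t : ℕ} (ht : t ∈ Finset.Icc 1 T) (hqf : ∀ ω, q t ω ∈ G.flows) (e : G.Edge) :
    Integrable (fun ω => √(q t ω e)) μ := by
  refine integrable_of_abs_le ((measurable_pi_apply e).comp (h.flow_measurable ht)).sqrt (B := 1)
    fun ω => ?_
  rw [abs_of_nonneg (Real.sqrt_nonneg _)]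
  exact Real.sqrt_le_one.2 (G.mem_Icc_of_mem_flows (hqf ω) e).2

theorem IsInteraction.integrable_sqrt_mul_one_sub_ratio (h : G.IsInteraction μ T ℋ ℓ q p c)
    {t : ℕ} (ht : t ∈ Finset.Icc 1 T) (hqf : ∀ ω, q t ω ∈ G.flows) (hq0 : ∀ ω e, 0 < q t ω e)
    (e : G.Edge) : Integrable (fun ω => √(q t ω e) * (1 - G.ratio (q t ω) e)) μ := by
  have hq := h.flow_measurable ht
  refine integrable_of_abs_le (((measurable_pi_apply e).comp hq).sqrt.mul (measurable_const.sub
    (((measurable_pi_apply e).comp hq).div (measurable_outflow hq _)))) (B := 1) fun ω => ?_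
  have hr := G.ratio_mem (hq0 ω) e
  change |√(q t ω e) * (1 - G.ratio (q t ω) e)| ≤ 1
  rw [abs_of_nonneg (mul_nonneg (Real.sqrt_nonneg _) (by linarith [hr.2]))]
  exact mul_le_one₀ (Real.sqrt_le_one.2 (G.mem_Icc_of_mem_flows (hqf ω) e).2)
    (by linarith [hr.2]) (by linarith [hr.1])

theorem IsInteraction.integrable_tsallisTerm (h : G.IsInteraction μ T ℋ ℓ q p c)
    (hqf : ∀ t ∈ Finset.Icc 1 T, ∀ ω, q t ω ∈ G.flows)
    (hq0 : ∀ t ∈ Finset.Icc 1 T, ∀ ω e, 0 < q t ω e) (b : ℝ) :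
    ∀ t ∈ Finset.Icc 1 T, Integrable (fun ω => G.tsallisTerm t b (q t ω)) μ := by
  intro t ht
  exact Integrable.add (Integrable.const_mul (Integrable.sub
    (integrable_finsetSum _ fun e _ => h.integrable_sqrt_flow ht (hqf t ht) e)
    (integrable_const _)) _) (integrable_finsetSum _ fun e _ =>
      (h.integrable_sqrt_mul_one_sub_ratio ht (hqf t ht) (hq0 t ht) e).const_mul _)

/-- The general regret bound for the Tsallis algorithm. -/
theorem IsInteraction.tsallis_regret_le (h : G.IsInteraction μ T ℋ ℓ q p c) (hT : 1 ≤ T)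
    (hF : ∀ ω, G.IsTsallisFTRL T (fun t => p t ω) (fun t => q t ω) (fun t => c t ω))
    (hp : pstar ∈ G.paths) {ε : ℝ} (hε : 0 < ε) (hε1 : ε ≤ 1) :
    G.regret μ T ℓ p pstar ≤ ε * T + 2 * (G.m * Real.log (1 / ε))
      + ∫ ω, ∑ t ∈ Finset.Icc 1 T, G.tsallisTerm t ((1 - ε) * ∑ e, pstar e) (q t ω) ∂μ := by
  have hlow := h.tsallis_lower_bound hF
  have hqf : ∀ t ∈ Finset.Icc 1 T, ∀ ω, q t ω ∈ G.flows :=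
    fun t ht ω => ((hF ω).isHybridArgmin ht).1
  have hq0 : ∀ t ∈ Finset.Icc 1 T, ∀ ω e, 0 < q t ω e :=
    fun t ht ω => ((hF ω).isHybridArgmin ht).2.1
  have h1T : 1 ∈ Finset.Icc 1 T := Finset.mem_Icc.2 ⟨le_rfl, hT⟩
  obtain ⟨ω₀⟩ : Nonempty Ω := nonempty_of_isProbabilityMeasure μ
  -- The first objective contains no estimates. The comparator may thus be mixed with `q 1` and stay
  -- deterministic, which makes the barrier penalty at most `ln(1/ε)` per edge.
  have huniq : ∀ ω, q 1 ω = q 1 ω₀ := fun ω => by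
    have h1 := (hF ω).isHybridArgmin h1T
    have h2 := (hF ω₀).isHybridArgmin h1T
    have h3 : ∀ ω, G.cumLossEst (fun t => p t ω) (fun t => q t ω) (fun t => c t ω) 1
        = fun _ => 0 := fun ω => by
      ext e
      simp [cumLossEst]
    rw [h3] at h1 h2
    exact IsHybridArgmin.unique G.convex_flows (by simp) (fun _ => zero_le_two) h1 h2
  have hpf := G.paths_subset_flows hp
  set y := (1 - ε) • pstar + ε • q 1 ω₀ with hydef
  have hye : ∀ e, y e = (1 - ε) * pstar e + ε * q 1 ω₀ e := fun e => rfl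
  have hp01 := G.mem_Icc_of_mem_flows hpf
  have hy : y ∈ G.flows := G.convex_flows hpf (hqf 1 h1T ω₀) (by linarith) hε.le (by ring)
  have hyq : ∀ e, ε * q 1 ω₀ e ≤ y e := fun e => by
    rw [hye]
    nlinarith [(hp01 e).1]
  have hεq : ∀ e, 0 < ε * q 1 ω₀ e := fun e => mul_pos hε (hq0 1 h1T ω₀ e)
  have hy0 : ∀ e, 0 < y e := fun e => (hεq e).trans_le (hyq e)
  have hlog : ∀ ω, ∑ e, (Real.log (q 1 ω e) - Real.log (y e)) ≤ G.m * Real.log (1 / ε) := by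
    intro ω
    rw [huniq ω]
    refine (Finset.sum_le_card_nsmul _ _ (Real.log (1 / ε)) fun e _ => ?_).trans ?_
    · have := Real.log_le_log (hεq e) (hyq e)
      rw [Real.log_mul hε.ne' (hq0 1 h1T ω₀ e).ne'] at this
      rw [one_div, Real.log_inv]
      linarith
    · rw [Finset.card_univ, card_edge, nsmul_eq_mul]
  -- `z ≤ √z` on `[0, 1]`.
  have hsy : (1 - ε) * ∑ e, pstar e ≤ ∑ e, √(y e) := by
    rw [Finset.mul_sum]
    refine Finset.sum_le_sum fun e _ => ?_
    have h0 : 0 ≤ (1 - ε) * pstar e := mul_nonneg (by linarith) (hp01 e).1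
    have h1 : (1 - ε) * pstar e ≤ 1 := mul_le_one₀ (by linarith) (hp01 e).1 (hp01 e).2
    refine Real.le_sqrt_of_sq_le ?_
    rw [hye]
    nlinarith [hεq e]
  have hsqpos : ∀ t ∈ Finset.Icc 1 T, 0 < √(t : ℝ) := fun t ht =>
    Real.sqrt_pos.2 (by exact_mod_cast (Finset.mem_Icc.1 ht).1)
  set b := (1 - ε) * ∑ e, pstar e with hb
  -- The stability weights are fixed before the path is drawn, so the squares they multiply can be
  -- replaced by the conditional variance `q(e)(1 - r(e))`.
  set a : ℕ → G.Edge → Ω → ℝ := fun t e ω => 9 / 4 / (√(t : ℝ) * √(q t ω e)) with ha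
  set X : ℕ → G.Edge → Ω → ℝ := fun t e ω =>
    G.outflow (p t ω) (G.tail e) * (p t ω e - G.ratio (q t ω) e) ^ 2 with hX
  have hint : ∀ t ∈ Finset.Icc 1 T, ∀ e, Integrable (fun ω => a t e ω * X t e ω) μ ∧
      ∫ ω, a t e ω * X t e ω ∂μ
        = ∫ ω, 9 / 4 / √(t : ℝ) * (√(q t ω e) * (1 - G.ratio (q t ω) e)) ∂μ := by
    intro t ht e
    obtain ⟨δ, hδ, hδq⟩ := hlow t ht
    have hm : Measurable[ℋ t] (a t e) :=
      measurable_const.div (measurable_const.mul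
        (((measurable_pi_apply e).comp (h.flow_meas t ht)).sqrt))
    have hB : ∀ ω, |a t e ω| ≤ 9 / 4 / (√(t : ℝ) * √δ) := fun ω => by
      have h1 := Real.sqrt_pos.2 hδ
      have h2 := Real.sqrt_le_sqrt (hδq ω e)
      have h3 := hsqpos t ht
      rw [abs_of_nonneg (by simp only [ha]; positivity)]
      simp only [ha]
      gcongr
    refine ⟨h.integrable_mul_sq ht (hq0 t ht) (hm.mono (ℋ.le t) le_rfl) hB e, ?_⟩
    rw [h.integral_mul_sq ht (hqf t ht) (hq0 t ht) hm hB e]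
    refine integral_congr_ae (Filter.Eventually.of_forall fun ω => ?_)
    have h1 := Real.sqrt_pos.2 (hq0 t ht ω e)
    have h3 := hsqpos t ht
    simp only [ha]
    nth_rewrite 2 [← Real.mul_self_sqrt (hq0 t ht ω e).le]
    field_simp
  set P : ℕ → Ω → ℝ := fun t ω =>
    2 * (√(t : ℝ) - √((t : ℝ) - 1)) * (∑ e, √(q t ω e) - b) with hPdef
  have hPint : ∀ t ∈ Finset.Icc 1 T, Integrable (P t) μ := fun t ht => by
    exact Integrable.const_mul (Integrable.sub (integrable_finsetSum _ fun e _ =>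
      h.integrable_sqrt_flow ht (hqf t ht) e) (integrable_const _)) _
  have hXint : ∀ t ∈ Finset.Icc 1 T, Integrable (fun ω => ∑ e, a t e ω * X t e ω) μ :=
    fun t ht => integrable_finsetSum _ fun e _ => (hint t ht e).1
  have hPX : ∀ t ∈ Finset.Icc 1 T, Integrable (fun ω => P t ω + ∑ e, a t e ω * X t e ω) μ :=
    fun t ht => (hPint t ht).add (hXint t ht)
  have hneg : ∀ t ∈ Finset.Icc 1 T,
      Integrable (fun ω => -G.dot (G.lossEst (c t ω) (p t ω) (q t ω)) y) μ :=
    fun t ht => (h.integrable_dot_lossEst hlow hy t ht).neg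
  have main : G.regret μ T ℓ p y ≤ ∫ ω, (2 * (G.m * Real.log (1 / ε))
      + ∑ t ∈ Finset.Icc 1 T, (P t ω + ∑ e, a t e ω * X t e ω)) ∂μ := by
    rw [h.regret_eq hqf hlow hy]
    refine integral_mono (integrable_finsetSum _ hneg)
      ((integrable_const _).add (integrable_finsetSum _ hPX)) fun ω => ?_
    refine ((hF ω).sum_neg_dot_le hT (fun t ht => h.path_mem t ht ω)
      (fun t ht => h.feedback_mem t ht ω) hy hy0).trans ?_
    rw [Finset.sum_add_distrib, add_assoc]
    refine add_le_add (mul_le_mul_of_nonneg_left (hlog ω) zero_le_two)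
      (add_le_add (Finset.sum_le_sum fun t ht => ?_) (Finset.sum_le_sum fun t ht =>
        Finset.sum_le_sum fun e _ => ?_))
    · have := (sqrt_sub_sqrt_mem t (Finset.mem_Icc.1 ht).1).1
      exact mul_le_mul_of_nonneg_left (by linarith) (by linarith)
    · have := mul_le_mul_of_nonneg_left (G.rho_le (q := q t ω) (h.path_mem t ht ω)
        (h.feedback_mem t ht ω) e) (by simp only [ha]; positivity : 0 ≤ a t e ω)
      refine le_trans (le_of_eq ?_) this
      simp only [ha]
      ring
  have hsum : ∫ ω, ∑ t ∈ Finset.Icc 1 T, (P t ω + ∑ e, a t e ω * X t e ω) ∂μ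
      = ∫ ω, ∑ t ∈ Finset.Icc 1 T, G.tsallisTerm t b (q t ω) ∂μ := by
    rw [integral_finsetSum _ hPX, integral_finsetSum _ (h.integrable_tsallisTerm hqf hq0 b)]
    refine Finset.sum_congr rfl fun t ht => ?_
    have hYint : ∀ e ∈ (Finset.univ : Finset G.Edge), Integrable
        (fun ω => 9 / 4 / √(t : ℝ) * (√(q t ω e) * (1 - G.ratio (q t ω) e))) μ :=
      fun e _ => (h.integrable_sqrt_mul_one_sub_ratio ht (hqf t ht) (hq0 t ht) e).const_mul _
    simp only [tsallisTerm]
    rw [integral_add (hPint t ht) (hXint t ht),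
      integral_add (hPint t ht) (integrable_finsetSum _ hYint),
      integral_finsetSum _ fun e _ => (hint t ht e).1, integral_finsetSum _ hYint]
    congr 1
    exact Finset.sum_congr rfl fun e _ => (hint t ht e).2
  rw [integral_add (integrable_const _) (integrable_finsetSum _ hPX), hsum] at main
  simp only [integral_const, probReal_univ, one_smul] at main
  have := h.regret_le_regret_mix (y := q 1 ω₀) hpf (hqf 1 h1T ω₀) ⟨hε.le, hε1⟩
  linarith

end Tsallis

/-! ### Worst-case and self-bounding regret of the Tsallis algorithm -/

section TsallisBounds

variable {W : Type*} [Fintype W] [DecidableEq W] {G : STDag W} {T : ℕ}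
  {Ω : Type*} {mΩ : MeasurableSpace Ω}
  {μ : Measure Ω} {ℋ : Filtration ℕ mΩ} {ℓ q p : ℕ → Ω → G.Edge → ℝ} {c : ℕ → Ω → ℝ}
  {pstar : G.Edge → ℝ} {π : {v : W // v ≠ G.g} → G.Edge}
  {Δ : G.Edge → ℝ} {C : ℝ}

theorem sum_sqrt_flow_le {x : G.Edge → ℝ} (hx : x ∈ G.flows) : ∑ e, √(x e) ≤ √(G.m * G.L) := by
  refine (sum_sqrt_le _ fun e _ => (G.mem_Icc_of_mem_flows hx e).1).trans (Real.sqrt_le_sqrt ?_)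
  rw [Finset.card_univ, card_edge]
  exact mul_le_mul_of_nonneg_left (G.sum_le_L hx) (by positivity)

theorem tsallisTerm_le_sqrt {t : ℕ} (ht : 1 ≤ t) {b : ℝ} (hb : 0 ≤ b) {x : G.Edge → ℝ}
    (hx : x ∈ G.flows) (hx0 : ∀ e, 0 < x e) :
    G.tsallisTerm t b x ≤ 17 / 4 * √(G.m * G.L) * (1 / √(t : ℝ)) := by
  have hd := sqrt_sub_sqrt_mem t ht
  have h1 := sum_sqrt_flow_le hx
  have h0 : 0 ≤ ∑ e, √(x e) := Finset.sum_nonneg fun e _ => Real.sqrt_nonneg _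
  have hs : 0 ≤ 1 / √(t : ℝ) := by positivity
  have h2 : ∑ e, √(x e) * (1 - G.ratio x e) ≤ ∑ e, √(x e) := by
    refine Finset.sum_le_sum fun e _ => mul_le_of_le_one_right (Real.sqrt_nonneg _) ?_
    linarith [(G.ratio_mem hx0 e).1]
  rw [tsallisTerm, ← Finset.mul_sum]
  have h3 : (√(t : ℝ) - √((t : ℝ) - 1)) * (∑ e, √(x e) - b) ≤ 1 / √(t : ℝ) * √(G.m * G.L) := by
    refine (mul_le_mul_of_nonneg_left (by linarith : _ ≤ √(G.m * G.L)) hd.1).trans ?_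
    exact mul_le_mul_of_nonneg_right hd.2 (Real.sqrt_nonneg _)
  have h4 := mul_le_mul_of_nonneg_left (h2.trans h1) hs
  have h5 : 9 / 4 / √(t : ℝ) = 9 / 4 * (1 / √(t : ℝ)) := by ring
  rw [h5]
  linarith

/-- The variance sum is charged to `E'` at the price of a factor 2, whence `13/2 = 2 + 2 · 9/4`. The
`ε m` term comes from the factor `1 - ε` at the comparator. -/
theorem IsSelfBounding.tsallisTerm_le (hs : G.IsSelfBounding μ T ℓ p pstar π Δ C) {t : ℕ}
    (ht : 1 ≤ t) {ε : ℝ} (hε : 0 ≤ ε) {x : G.Edge → ℝ} (hx : x ∈ G.flows)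
    (hx0 : ∀ e, 0 < x e) :
    G.tsallisTerm t ((1 - ε) * ∑ e, pstar e) x ≤ 2 * (ε * G.m) * (√(t : ℝ) - √((t : ℝ) - 1))
      + 13 / 2 * (1 / √(t : ℝ) * (∑ e ∈ G.offPolicy π, √(x e)
        + G.n * √(∑ e ∈ G.exits pstar π, x e))) := by
  have hd := sqrt_sub_sqrt_mem t ht
  have h1 := G.sum_sqrt_sub_le hs.path_mem hs.consistent hx
  have h2 : ∑ e, √(x e) * (1 - G.ratio x e) ≤ 2 * ∑ e ∈ G.offPolicy π, √(x e) :=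
    G.sum_le_two_mul_offPolicy (fun e => Real.sqrt_nonneg _)
      (fun e => mul_le_of_le_one_right (Real.sqrt_nonneg _)
        (by linarith [(G.ratio_mem hx0 e).1])) (G.sqrt_mul_one_sub_ratio_le hx0)
  have h3 : ∑ e, pstar e ≤ G.m := by
    refine (Finset.sum_le_card_nsmul _ _ 1 fun e _ =>
      (G.mem_Icc_of_mem_flows (G.paths_subset_flows hs.path_mem) e).2).trans ?_
    rw [Finset.card_univ, card_edge, nsmul_eq_mul, mul_one]
  set A := G.n * √(∑ e ∈ G.exits pstar π, x e)
  set E := ∑ e ∈ G.offPolicy π, √(x e)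
  have hA : 0 ≤ A := by positivity
  have hE : 0 ≤ E := Finset.sum_nonneg fun e _ => Real.sqrt_nonneg _
  have hst : 0 ≤ 1 / √(t : ℝ) := by positivity
  rw [tsallisTerm, ← Finset.mul_sum]
  have h4 : (√(t : ℝ) - √((t : ℝ) - 1)) * (∑ e, √(x e) - (1 - ε) * ∑ e, pstar e)
      ≤ (√(t : ℝ) - √((t : ℝ) - 1)) * (ε * G.m) + 1 / √(t : ℝ) * (E + A) := by
    have h5 : ∑ e, √(x e) - (1 - ε) * ∑ e, pstar e ≤ ε * G.m + (E + A) := by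
      nlinarith
    refine (mul_le_mul_of_nonneg_left h5 hd.1).trans ?_
    rw [mul_add]
    gcongr
    exact hd.2
  have h6 := mul_le_mul_of_nonneg_left h2 hst
  have h7 : 9 / 4 / √(t : ℝ) = 9 / 4 * (1 / √(t : ℝ)) := by ring
  have h8 := mul_nonneg hst hA
  rw [h7]
  linarith

/-- Cauchy–Schwarz with the splitting `√(x/t) = √(1/(tΔ)) √(Δx)`, over rounds and edges for `E'` and
over rounds for the exits, where `Δ ≥ Δ*`. The harmonic sum is at most `3 log T`. -/
theorem IsSelfBounding.sum_sqrt_le (hs : G.IsSelfBounding μ T ℓ p pstar π Δ C) (hT : 2 ≤ T)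
    (hE : (G.offPolicy π).Nonempty) {x : ℕ → G.Edge → ℝ}
    (hx : ∀ t ∈ Finset.Icc 1 T, ∀ e, 0 ≤ x t e) :
    ∑ t ∈ Finset.Icc 1 T, 1 / √(t : ℝ) * (∑ e ∈ G.offPolicy π, √(x t e)
        + G.n * √(∑ e ∈ G.exits pstar π, x t e)) ≤
      2 * √(3 * (G.gapSum T π Δ + (G.n : ℝ) ^ 2 * Real.log T / G.gapStar pstar π Δ))
        * √(∑ t ∈ Finset.Icc 1 T, ∑ e ∈ G.offPolicy π, Δ e * x t e) := by
  have hl := Real.log_natCast_nonneg T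
  have hD := hs.gapStar_pos hE
  have hH := sum_one_div_le hT
  have hG := hs.gapSum_nonneg
  have hN : 0 ≤ (G.n : ℝ) ^ 2 * Real.log T / G.gapStar pstar π Δ := by positivity
  set Y := ∑ t ∈ Finset.Icc 1 T, ∑ e ∈ G.offPolicy π, Δ e * x t e with hY
  have p1 : ∑ t ∈ Finset.Icc 1 T, 1 / √(t : ℝ) * ∑ e ∈ G.offPolicy π, √(x t e)
      ≤ √(3 * G.gapSum T π Δ) * √Y := by
    have h1 := sum_mul_sqrt_le (Finset.Icc 1 T ×ˢ G.offPolicy π)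
      (a := fun i => 1 / (i.1 : ℝ) * (1 / Δ i.2)) (b := fun i => Δ i.2 * x i.1 i.2)
      (fun i hi => by
        have := hs.gap_pos _ (Finset.mem_product.1 hi).2
        positivity) (fun i hi => mul_nonneg (hs.gap_mem _).1
        (hx _ (Finset.mem_product.1 hi).1 _))
    rw [Finset.sum_product, Finset.sum_product, Finset.sum_product] at h1
    refine le_trans (le_of_eq ?_) (h1.trans ?_)
    · refine Finset.sum_congr rfl fun t ht => ?_
      rw [Finset.mul_sum]
      refine Finset.sum_congr rfl fun e he => ?_
      have h2 := hs.gap_pos e he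
      have h3 := Real.sqrt_pos.2 h2
      rw [Real.sqrt_mul (by positivity), Real.sqrt_mul h2.le, Real.sqrt_div zero_le_one,
        Real.sqrt_div zero_le_one, Real.sqrt_one]
      field_simp
    · refine mul_le_mul_of_nonneg_right (Real.sqrt_le_sqrt ?_) (Real.sqrt_nonneg _)
      simp only
      rw [← Finset.sum_mul_sum]
      have h4 : 0 ≤ ∑ e ∈ G.offPolicy π, 1 / Δ e :=
        Finset.sum_nonneg fun e he => (one_div_pos.2 (hs.gap_pos e he)).le
      refine (mul_le_mul_of_nonneg_right hH h4).trans (le_of_eq ?_)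
      rw [gapSum, mul_assoc, Finset.mul_sum]
      congr 1
      exact Finset.sum_congr rfl fun e _ => by ring
  have p2 : ∑ t ∈ Finset.Icc 1 T, 1 / √(t : ℝ) * (G.n * √(∑ e ∈ G.exits pstar π, x t e))
      ≤ √(3 * ((G.n : ℝ) ^ 2 * Real.log T / G.gapStar pstar π Δ)) * √Y := by
    have h1 := sum_mul_sqrt_le (Finset.Icc 1 T)
      (a := fun t => 1 / (t : ℝ) * ((G.n : ℝ) ^ 2 / G.gapStar pstar π Δ))
      (b := fun t => G.gapStar pstar π Δ * ∑ e ∈ G.exits pstar π, x t e)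
      (fun t _ => by positivity)
      (fun t ht => mul_nonneg hD.le (Finset.sum_nonneg fun e _ => hx t ht _))
    refine le_trans (le_of_eq ?_) (h1.trans ?_)
    · refine Finset.sum_congr rfl fun t ht => ?_
      have h3 := Real.sqrt_pos.2 hD
      rw [Real.sqrt_mul (by positivity), Real.sqrt_mul hD.le, Real.sqrt_div zero_le_one,
        Real.sqrt_div (by positivity), Real.sqrt_one, Real.sqrt_sq (by positivity)]
      field_simp
    · refine mul_le_mul (Real.sqrt_le_sqrt ?_) (Real.sqrt_le_sqrt ?_) (Real.sqrt_nonneg _)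
        (Real.sqrt_nonneg _)
      · rw [← Finset.sum_mul]
        refine (mul_le_mul_of_nonneg_right hH (by positivity)).trans (le_of_eq ?_)
        ring
      · refine Finset.sum_le_sum fun t ht => ?_
        rw [Finset.mul_sum]
        refine (Finset.sum_le_sum fun e he =>
          mul_le_mul_of_nonneg_right (IsSelfBounding.gapStar_le e he) (hx t ht e)).trans ?_
        exact Finset.sum_le_sum_of_subset_of_nonneg (Finset.filter_subset _ _)
          fun e _ _ => mul_nonneg (hs.gap_mem e).1 (hx t ht e)
  simp only [mul_add (1 / √_), Finset.sum_add_distrib]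
  have m1 : √(3 * G.gapSum T π Δ) ≤
      √(3 * (G.gapSum T π Δ + (G.n : ℝ) ^ 2 * Real.log T / G.gapStar pstar π Δ)) :=
    Real.sqrt_le_sqrt (by linarith)
  have m2 : √(3 * ((G.n : ℝ) ^ 2 * Real.log T / G.gapStar pstar π Δ)) ≤
      √(3 * (G.gapSum T π Δ + (G.n : ℝ) ^ 2 * Real.log T / G.gapStar pstar π Δ)) :=
    Real.sqrt_le_sqrt (by linarith)
  have m3 := mul_le_mul_of_nonneg_right m1 (Real.sqrt_nonneg Y)
  have m4 := mul_le_mul_of_nonneg_right m2 (Real.sqrt_nonneg Y)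
  linarith

variable [IsProbabilityMeasure μ]

theorem IsInteraction.integral_sqrt_gap_le (h : G.IsInteraction μ T ℋ ℓ q p c)
    (hs : G.IsSelfBounding μ T ℓ p pstar π Δ C)
    (hqf : ∀ t ∈ Finset.Icc 1 T, ∀ ω, q t ω ∈ G.flows)
    (hq0 : ∀ t ∈ Finset.Icc 1 T, ∀ ω e, 0 < q t ω e) :
    Integrable (fun ω => √(∑ t ∈ Finset.Icc 1 T, ∑ e ∈ G.offPolicy π, Δ e * q t ω e)) μ ∧
    ∫ ω, √(∑ t ∈ Finset.Icc 1 T, ∑ e ∈ G.offPolicy π, Δ e * q t ω e) ∂μ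
      ≤ √(G.regret μ T ℓ p pstar + C) := by
  have hm : Measurable fun ω => ∑ t ∈ Finset.Icc 1 T, ∑ e ∈ G.offPolicy π, Δ e * q t ω e :=
    Finset.measurable_sum _ fun t ht => Finset.measurable_sum _ fun e _ =>
      ((measurable_pi_apply e).comp (h.flow_measurable ht)).const_mul _
  have hB : ∀ ω, ∑ t ∈ Finset.Icc 1 T, ∑ e ∈ G.offPolicy π, Δ e * q t ω e ∈
      Set.Icc 0 (∑ _t ∈ Finset.Icc 1 T, ∑ _e ∈ G.offPolicy π, (1 : ℝ)) := fun ω => by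
    constructor
    · exact Finset.sum_nonneg fun t ht => Finset.sum_nonneg fun e _ =>
        mul_nonneg (hs.gap_mem e).1 (hq0 t ht ω e).le
    · exact Finset.sum_le_sum fun t ht => Finset.sum_le_sum fun e _ =>
        mul_le_one₀ (hs.gap_mem e).2 (hq0 t ht ω e).le (G.mem_Icc_of_mem_flows (hqf t ht ω) e).2
  refine ⟨integrable_of_abs_le hm.sqrt
    (B := √(∑ _t ∈ Finset.Icc 1 T, ∑ _e ∈ G.offPolicy π, (1 : ℝ))) fun ω => ?_, ?_⟩
  · rw [abs_of_nonneg (Real.sqrt_nonneg _)]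
    exact Real.sqrt_le_sqrt (hB ω).2
  · exact (integral_sqrt_le hm hB).trans (Real.sqrt_le_sqrt (hs.integral_le h hqf hq0))

theorem IsInteraction.tsallis_regret_le_sqrt (h : G.IsInteraction μ T ℋ ℓ q p c) (hT : 1 ≤ T)
    (hF : ∀ ω, G.IsTsallisFTRL T (fun t => p t ω) (fun t => q t ω) (fun t => c t ω))
    (hp : pstar ∈ G.paths) : G.regret μ T ℓ p pstar ≤ 15 * √(G.m * G.L * T) := by
  have hL := G.one_le_L ⟨_, hp⟩
  have hm : (1 : ℝ) ≤ G.m := by exact_mod_cast G.m_pos ⟨_, hp⟩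
  have hT1 : (1 : ℝ) ≤ T := by exact_mod_cast hT
  have hT0 : (0 : ℝ) < T := by linarith
  have hmL : (G.m : ℝ) ≤ G.m * G.L := le_mul_of_one_le_right (by linarith) hL
  -- For `T ≤ m` the trivial bound `T ≤ √(mLT)` suffices.
  rcases le_total (T : ℝ) G.m with hTm | hTm
  · have h1 := h.regret_le_horizon (G.paths_subset_flows hp)
    have h2 : (T : ℝ) ≤ √(G.m * G.L * T) := Real.le_sqrt_of_sq_le (by nlinarith)
    have h3 := Real.sqrt_nonneg (G.m * G.L * T)
    linarith
  have hqf : ∀ t ∈ Finset.Icc 1 T, ∀ ω, q t ω ∈ G.flows :=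
    fun t ht ω => ((hF ω).isHybridArgmin ht).1
  have hq0 : ∀ t ∈ Finset.Icc 1 T, ∀ ω e, 0 < q t ω e :=
    fun t ht ω => ((hF ω).isHybridArgmin ht).2.1
  -- With `ε = m/T` the mixing cost is `m`, and `m ln(T/m) ≤ 2√(mT)`, so no logarithm survives in
  -- the worst-case bound.
  have hε : (0 : ℝ) < G.m / T := by positivity
  have hε1 : (G.m : ℝ) / T ≤ 1 := (div_le_one hT0).2 hTm
  have h1 := h.tsallis_regret_le hT hF hp hε hε1
  have hb : 0 ≤ (1 - (G.m : ℝ) / T) * ∑ e, pstar e := mul_nonneg (by linarith)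
    (Finset.sum_nonneg fun e _ => (G.mem_Icc_of_mem_flows (G.paths_subset_flows hp) e).1)
  have h2 : ∫ ω, ∑ t ∈ Finset.Icc 1 T,
      G.tsallisTerm t ((1 - (G.m : ℝ) / T) * ∑ e, pstar e) (q t ω) ∂μ
      ≤ ∫ _, 17 / 2 * √(G.m * G.L * T) ∂μ := by
    refine integral_mono (integrable_finsetSum _ (h.integrable_tsallisTerm hqf hq0 _))
      (integrable_const _) fun ω => ?_
    refine (Finset.sum_le_sum fun t ht => tsallisTerm_le_sqrt (Finset.mem_Icc.1 ht).1 hb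
      (hqf t ht ω) (hq0 t ht ω)).trans ?_
    rw [← Finset.mul_sum, Real.sqrt_mul (by linarith : 0 ≤ G.m * G.L)]
    have := mul_le_mul_of_nonneg_left (sum_one_div_sqrt_le T)
      (by positivity : 0 ≤ 17 / 4 * √(G.m * G.L))
    linarith
  rw [integral_const, probReal_univ, one_smul] at h2
  have h3 : (G.m : ℝ) / T * T = G.m := by field_simp
  have h4 : (G.m : ℝ) ≤ √(G.m * G.L * T) := Real.le_sqrt_of_sq_le (by nlinarith)
  have h5 : (G.m : ℝ) * Real.log (1 / (G.m / T)) ≤ 2 * √(G.m * G.L * T) := by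
    have e1 : Real.log (1 / ((G.m : ℝ) / T)) ≤ 2 * √(T / G.m) := by
      rw [one_div_div]
      have hz : (0 : ℝ) < T / G.m := by positivity
      have := Real.log_le_sub_one_of_pos (Real.sqrt_pos.2 hz)
      rw [Real.log_sqrt hz.le] at this
      linarith
    refine (mul_le_mul_of_nonneg_left e1 (by linarith)).trans ?_
    have e2 : (G.m : ℝ) * √(T / G.m) ≤ √(G.m * G.L * T) := by
      refine Real.le_sqrt_of_sq_le ?_
      rw [mul_pow, Real.sq_sqrt (by positivity)]
      have : (G.m : ℝ) ^ 2 * (T / G.m) = G.m * T := by field_simp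
      rw [this]
      nlinarith
    linarith
  rw [h3] at h1
  have h6 := Real.sqrt_nonneg (G.m * G.L * T)
  linarith

theorem IsInteraction.tsallis_regret_le_of_isSelfBounding (h : G.IsInteraction μ T ℋ ℓ q p c)
    (hT : 2 ≤ T) (hF : ∀ ω, G.IsTsallisFTRL T (fun t => p t ω) (fun t => q t ω) (fun t => c t ω))
    (hs : G.IsSelfBounding μ T ℓ p pstar π Δ C) (hE : (G.offPolicy π).Nonempty)
    {U : ℝ} (hU : U = G.gapSum T π Δ + (G.n : ℝ) ^ 2 * Real.log T / G.gapStar pstar π Δ) :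
    G.regret μ T ℓ p pstar ≤ 2116 * (U + √(U * C)) := by
  have hp := hs.path_mem
  have hD := hs.gapStar_pos hE
  have hl := Real.log_natCast_nonneg T
  have hU0 : 0 ≤ U := by
    have := hs.gapSum_nonneg
    rw [hU]
    positivity
  have hm : (1 : ℝ) ≤ G.m := by exact_mod_cast G.m_pos ⟨_, hp⟩
  have hT0 : (1 : ℝ) ≤ T := by exact_mod_cast (by omega : 1 ≤ T)
  have hqf : ∀ t ∈ Finset.Icc 1 T, ∀ ω, q t ω ∈ G.flows :=
    fun t ht ω => ((hF ω).isHybridArgmin ht).1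
  have hq0 : ∀ t ∈ Finset.Icc 1 T, ∀ ω e, 0 < q t ω e :=
    fun t ht ω => ((hF ω).isHybridArgmin ht).2.1
  have hε : (0 : ℝ) < 1 / T := by positivity
  have h1 := h.tsallis_regret_le (by omega) hF hp hε ((div_le_one (by linarith)).2 hT0)
  obtain ⟨hYint, hY⟩ := h.integral_sqrt_gap_le hs hqf hq0
  have h2 : ∫ ω, ∑ t ∈ Finset.Icc 1 T,
      G.tsallisTerm t ((1 - 1 / (T : ℝ)) * ∑ e, pstar e) (q t ω) ∂μ
      ≤ ∫ ω, (2 * G.m + 13 * √(3 * U)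
        * √(∑ t ∈ Finset.Icc 1 T, ∑ e ∈ G.offPolicy π, Δ e * q t ω e)) ∂μ := by
    refine integral_mono (integrable_finsetSum _ (h.integrable_tsallisTerm hqf hq0 _))
      ((integrable_const _).add (hYint.const_mul _)) fun ω => ?_
    refine (Finset.sum_le_sum fun t ht => hs.tsallisTerm_le (Finset.mem_Icc.1 ht).1 hε.le
      (hqf t ht ω) (hq0 t ht ω)).trans ?_
    rw [Finset.sum_add_distrib, ← Finset.mul_sum, ← Finset.mul_sum, sum_sqrt_sub_sqrt]
    refine add_le_add ?_ ?_
    · have e1 : √(T : ℝ) ≤ T := Real.sqrt_le_iff.2 ⟨by linarith, by nlinarith⟩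
      calc 2 * (1 / (T : ℝ) * G.m) * √(T : ℝ) ≤ 2 * (1 / (T : ℝ) * G.m) * T := by gcongr
        _ = 2 * G.m := by field_simp
    · have e2 := hs.sum_sqrt_le hT hE (x := fun t => q t ω) fun t ht e => (hq0 t ht ω e).le
      rw [← hU] at e2
      linarith
  rw [integral_add (integrable_const _) (hYint.const_mul _), integral_const, probReal_univ,
    one_smul, integral_const_mul] at h2
  have h3 : 13 * √(3 * U) * √(G.regret μ T ℓ p pstar + C)
      ≤ 23 * √(U * (G.regret μ T ℓ p pstar + C)) := by
    rw [Real.sqrt_mul (by norm_num : (0 : ℝ) ≤ 3), Real.sqrt_mul hU0]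
    have e3 : √3 ≤ 23 / 13 := Real.sqrt_le_iff.2 ⟨by norm_num, by norm_num⟩
    have e4 : 0 ≤ √U * √(G.regret μ T ℓ p pstar + C) := by positivity
    nlinarith
  have h4 := mul_le_mul_of_nonneg_left hY (by positivity : 0 ≤ 13 * √(3 * U))
  have hgap1 : G.gapStar pstar π Δ ≤ 1 := by
    obtain ⟨e, he⟩ := G.exits_nonempty hp hs.consistent hE
    exact (IsSelfBounding.gapStar_le e he).trans (hs.gap_mem e).2
  have h5 := hs.m_mul_log_le hE hD hgap1
  rw [← hU] at h5
  have h6 := one_le_two_mul_log hT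
  have h7 : (G.m : ℝ) ≤ 2 * (G.m * Real.log T) := by nlinarith
  have h8 : 1 / (T : ℝ) * T = 1 := by field_simp
  rw [h8, one_div_one_div] at h1
  -- `23` covers both `13√3` and the additive terms, which sum to at most `8 m log T ≤ 16 U`.
  -- Solving with `D = U` gives `2 · 23² · 2 = 2116`.
  have h9 : G.regret μ T ℓ p pstar
      ≤ 23 * (√(U * (G.regret μ T ℓ p pstar + C)) + U) := by linarith
  have h10 := le_of_le_mul_sqrt hU0 hs.corruption_nonneg hU0 (by norm_num) h9
  have h11 := Real.sqrt_nonneg (U * C)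
  linarith

end TsallisBounds

end STDag

theorem sqrt_sum_le_sum_sqrt {ι : Type*} (s : Finset ι) {b : ι → ℝ} (hb : ∀ i ∈ s, 0 ≤ b i) :
    √(∑ i ∈ s, b i) ≤ ∑ i ∈ s, √(b i) := by
  rw [Real.sqrt_le_iff]
  refine ⟨Finset.sum_nonneg fun i _ => Real.sqrt_nonneg _, ?_⟩
  refine le_trans (le_of_eq ?_) (Finset.sum_sq_le_sq_sum_of_nonneg fun i _ => Real.sqrt_nonneg _)
  exact Finset.sum_congr rfl fun i hi => (Real.sq_sqrt (hb i hi)).symm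

/-- The sum of the stability terms under an adaptive learning rate. -/
theorem sum_div_sqrt_le {r : ℕ → ℝ} {n : ℕ} (hr : ∀ t ∈ Finset.Icc 1 n, r t ∈ Set.Icc (0 : ℝ) 1)
    {Λ : ℝ} (hΛ : 1 ≤ 4 * Λ) :
    ∑ t ∈ Finset.Icc 1 n, r t / √(4 + 1 / Λ * ∑ τ ∈ Finset.Ico 1 t, r τ)
      ≤ 2 * √(Λ * ∑ t ∈ Finset.Icc 1 n, r t) := by
  have hΛ0 : 0 < Λ := by linarith
  induction n with
  | zero => simp
  | succ n ih =>
    have hr' : ∀ t ∈ Finset.Icc 1 n, r t ∈ Set.Icc (0 : ℝ) 1 := fun t ht =>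
      hr t (Finset.Icc_subset_Icc_right (Nat.le_succ n) ht)
    have ih := ih hr'
    rw [Finset.sum_Icc_succ_top (by omega), Finset.sum_Icc_succ_top (by omega) r,
      Finset.Ico_add_one_right_eq_Icc]
    have hS : 0 ≤ ∑ t ∈ Finset.Icc 1 n, r t := Finset.sum_nonneg fun t ht => (hr' t ht).1
    set S := ∑ t ∈ Finset.Icc 1 n, r t
    obtain ⟨h0, h1⟩ := hr (n + 1) (by simp)
    set x := r (n + 1)
    rcases h0.eq_or_lt with hx | hx
    · rw [← hx]
      simpa using ih
    -- The constant 4 in the rate compensates for the missing current term, as `x ≤ 1 ≤ 4Λ`. The sum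
    -- then telescopes through `√(ΛS)`.
    have hden : (S + x) / Λ ≤ 4 + 1 / Λ * S := by
      have : x / Λ ≤ 4 := by
        rw [div_le_iff₀ hΛ0]
        linarith
      have e : (S + x) / Λ = 1 / Λ * S + x / Λ := by ring
      linarith
    have hpos : 0 < √(Λ * (S + x)) := Real.sqrt_pos.2 (by positivity)
    have hq : √(Λ * (S + x)) ≤ Λ * √(4 + 1 / Λ * S) := by
      have e : Λ * (S + x) = Λ ^ 2 * ((S + x) / Λ) := by field_simp
      rw [e, Real.sqrt_mul (by positivity), Real.sqrt_sq hΛ0.le]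
      exact mul_le_mul_of_nonneg_left (Real.sqrt_le_sqrt hden) hΛ0.le
    have hstep : x / √(4 + 1 / Λ * S) ≤ Λ * x / √(Λ * (S + x)) := by
      rw [div_le_div_iff₀ (Real.sqrt_pos.2 (by positivity)) hpos]
      nlinarith
    have hdiff : Λ * x / √(Λ * (S + x)) ≤ 2 * (√(Λ * (S + x)) - √(Λ * S)) := by
      rw [div_le_iff₀ hpos]
      nlinarith [Real.sq_sqrt (by positivity : 0 ≤ Λ * (S + x)),
        Real.sq_sqrt (by positivity : 0 ≤ Λ * S), sq_nonneg (√(Λ * (S + x)) - √(Λ * S))]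
    linarith

namespace STDag

/-! ### Regret of the log-barrier algorithm -/

section Barrier

variable {W : Type*} [Fintype W] [DecidableEq W] {G : STDag W} {T : ℕ}

theorem one_div_barrierRate (p q : ℕ → G.Edge → ℝ) (c : ℕ → ℝ)
    (hp : ∀ t ∈ Finset.Icc 1 T, p t ∈ G.paths) {t : ℕ} (ht : t ∈ Finset.Icc 1 T) (e : G.Edge) :
    1 / G.barrierRate T p q c t e
      = √(4 + 1 / Real.log T * ∑ τ ∈ Finset.Ico 1 t, G.rho (c τ) (p τ) (q τ) e) := by
  have h : 0 ≤ 4 + 1 / Real.log T * ∑ τ ∈ Finset.Ico 1 t, G.rho (c τ) (p τ) (q τ) e := by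
    have h1 := Real.log_natCast_nonneg T
    have h2 : 0 ≤ ∑ τ ∈ Finset.Ico 1 t, G.rho (c τ) (p τ) (q τ) e :=
      Finset.sum_nonneg fun τ hτ => G.rho_nonneg (hp τ (Finset.mem_Icc.2
        ⟨(Finset.mem_Ico.1 hτ).1, (Finset.mem_Ico.1 hτ).2.le.trans (Finset.mem_Icc.1 ht).2⟩)) _ e
    positivity
  rw [barrierRate, Real.rpow_neg h, one_div, inv_inv, ← Real.sqrt_eq_rpow]

theorem IsLogBarrierFTRL.isHybridArgmin {p q : ℕ → G.Edge → ℝ} {c : ℕ → ℝ}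
    (h : G.IsLogBarrierFTRL T p q c) {t : ℕ} (ht : t ∈ Finset.Icc 1 T) :
    IsHybridArgmin G.flows (G.cumLossEst p q c t) 0
      (fun e => 1 / G.barrierRate T p q c t e) (q t) := by
  obtain ⟨h1, h2, h3⟩ := h t ht
  have hreg : ∀ x, G.barrierReg T p q c t x
      = hybridReg 0 (fun e => 1 / G.barrierRate T p q c t e) x := fun x => by
    rw [barrierReg, hybridReg]
    ring
  refine ⟨h1, h2, fun y hy hy0 => ?_⟩
  have := h3 y hy hy0
  simp only [hreg] at this
  exact this

/-- The penalty is `2 log T` times the final weights, and the stability sum is controlled by the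
adaptive rate; both are of order `√(log T Σ ρ)` per edge. -/
theorem IsLogBarrierFTRL.sum_neg_dot_le {p q : ℕ → G.Edge → ℝ} {c : ℕ → ℝ}
    (h : G.IsLogBarrierFTRL T p q c) (hT : 2 ≤ T) (hp : ∀ t ∈ Finset.Icc 1 T, p t ∈ G.paths)
    (hc : ∀ t ∈ Finset.Icc 1 T, c t ∈ Set.Icc (0 : ℝ) 1)
    {y : G.Edge → ℝ} (hy : y ∈ G.flows) (hy0 : ∀ e, 0 < y e)
    (hyT : ∀ e, -Real.log (y e) ≤ 2 * Real.log T) :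
    ∑ t ∈ Finset.Icc 1 T, -G.dot (G.lossEst (c t) (p t) (q t)) y ≤
      4 * (G.m * Real.log T)
      + 6 * ∑ e, √(Real.log T * ∑ t ∈ Finset.Icc 1 T, G.rho (c t) (p t) (q t) e) := by
  have hT1 : 1 ≤ T := by omega
  have hl : 1 ≤ 2 * Real.log T := one_le_two_mul_log hT
  have hl0 : 0 < Real.log T := by linarith
  have hpos : ∀ t ∈ Finset.Icc 1 T, ∀ e, 0 < q t e := fun t ht => (h.isHybridArgmin ht).2.1
  have hsub : ∀ t ∈ Finset.Icc 1 T, ∀ τ ∈ Finset.Ico 1 t, τ ∈ Finset.Icc 1 T := fun t ht τ hτ =>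
    Finset.mem_Icc.2
      ⟨(Finset.mem_Ico.1 hτ).1, (Finset.mem_Ico.1 hτ).2.le.trans (Finset.mem_Icc.1 ht).2⟩
  set ρ : ℕ → G.Edge → ℝ := fun t e => G.rho (c t) (p t) (q t) e with hρ
  have hρ0 : ∀ t ∈ Finset.Icc 1 T, ∀ e, ρ t e ∈ Set.Icc (0 : ℝ) 1 := fun t ht e =>
    ⟨G.rho_nonneg (hp t ht) _ e, G.rho_le_one (hpos t ht) (hp t ht) (hc t ht) e⟩
  set w : ℕ → G.Edge → ℝ := fun t e =>
    √(4 + 1 / Real.log T * ∑ τ ∈ Finset.Ico 1 t, ρ τ e) with hw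
  have harg : ∀ t ∈ Finset.Icc 1 T,
      IsHybridArgmin G.flows (G.cumLossEst p q c t) 0 (w t) (q t) := fun t ht => by
    have := h.isHybridArgmin ht
    simp only [one_div_barrierRate p q c hp ht] at this
    exact this
  have hS0 : ∀ t ∈ Finset.Icc 1 T, ∀ e, 0 ≤ ∑ τ ∈ Finset.Ico 1 t, ρ τ e := fun t ht e =>
    Finset.sum_nonneg fun τ hτ => (hρ0 τ (hsub t ht τ hτ) e).1
  have hw2 : ∀ t ∈ Finset.Icc 1 T, ∀ e, 2 ≤ w t e := fun t ht e => by
    refine Real.le_sqrt_of_sq_le ?_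
    have := hS0 t ht e
    have : 0 ≤ 1 / Real.log T * ∑ τ ∈ Finset.Ico 1 t, ρ τ e := by positivity
    linarith
  have key := ftrl_regret G.convex_flows hT1 (g := fun t => G.lossEst (c t) (p t) (q t)) (q := q)
    (a := fun _ => 0) (w := w) (st := fun t => ∑ e, 2 * ρ t e / w t e)
    harg (fun t ht x hx => by
      have := barrier_stability_sum (hpos t ht) hx
        (fun e => G.abs_mul_lossEst_le_one (hpos t ht) (hp t ht) (hc t ht) e) (hw2 t ht)
      simpa only [G.sq_mul_lossEst (hpos t ht) (hp t ht)] using this) hy hy0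
  have h1 : ∑ t ∈ Finset.Icc 1 T, -G.dot (G.lossEst (c t) (p t) (q t)) y
      = ∑ t ∈ Finset.Icc 1 T, ∑ e, G.lossEst (c t) (p t) (q t) e * (q t e - y e) := by
    refine Finset.sum_congr rfl fun t ht => ?_
    have := G.dot_lossEst_self (hpos t ht) (c t) (p t)
    simp only [dot, mul_sub, Finset.sum_sub_distrib] at this ⊢
    rw [this, zero_sub]
  have hlq : ∀ t ∈ Finset.Icc 1 T, ∀ e, Real.log (q t e) ≤ 0 := fun t ht e =>
    Real.log_nonpos (hpos t ht e).le (G.mem_Icc_of_mem_flows (harg t ht).1 e).2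
  have h2 : 0 ≤ hybridReg 0 (w 1) (q 1) := by
    have h1T : 1 ∈ Finset.Icc 1 T := Finset.mem_Icc.2 ⟨le_rfl, hT1⟩
    have : ∑ e, w 1 e * Real.log (q 1 e) ≤ 0 := Finset.sum_nonpos fun e _ =>
      mul_nonpos_of_nonneg_of_nonpos (by linarith [hw2 1 h1T e]) (hlq 1 h1T e)
    simp only [hybridReg]
    linarith
  -- The weights increase in time and `-ln q ≥ 0`, so the regularizer only grows and the drift terms
  -- can be dropped.
  have h3 : ∑ t ∈ Finset.Ico 1 T, (hybridReg 0 (w t) (q (t + 1))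
      - hybridReg 0 (w (t + 1)) (q (t + 1))) ≤ 0 := by
    refine Finset.sum_nonpos fun t ht => ?_
    obtain ⟨ht1, ht2⟩ := Finset.mem_Ico.1 ht
    have ht' : t ∈ Finset.Icc 1 T := Finset.mem_Icc.2 ⟨ht1, ht2.le⟩
    have hts : t + 1 ∈ Finset.Icc 1 T := Finset.mem_Icc.2 ⟨by omega, ht2⟩
    have : ∑ e, w (t + 1) e * Real.log (q (t + 1) e) ≤ ∑ e, w t e * Real.log (q (t + 1) e) := by
      refine Finset.sum_le_sum fun e _ => mul_le_mul_of_nonpos_right ?_ (hlq _ hts e)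
      refine Real.sqrt_le_sqrt ?_
      rw [Finset.sum_Ico_succ_top ht1]
      have := (hρ0 t ht' e).1
      gcongr
      linarith
    simp only [hybridReg]
    linarith
  have h4 : hybridReg 0 (w T) y ≤ ∑ e, (4 * Real.log T
      + 2 * √(Real.log T * ∑ t ∈ Finset.Icc 1 T, ρ t e)) := by
    have hTT : T ∈ Finset.Icc 1 T := Finset.mem_Icc.2 ⟨hT1, le_rfl⟩
    have : hybridReg 0 (w T) y = ∑ e, w T e * -Real.log (y e) := by
      simp [hybridReg]
    rw [this]
    refine Finset.sum_le_sum fun e _ => ?_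
    -- `√(4 + X) ≤ 2 + √X`: the 2 becomes the `m log T` term, the root becomes the adaptive one.
    have hwT : w T e ≤ 2 + √(1 / Real.log T * ∑ t ∈ Finset.Icc 1 T, ρ t e) := by
      have hle : ∑ t ∈ Finset.Ico 1 T, ρ t e ≤ ∑ t ∈ Finset.Icc 1 T, ρ t e :=
        Finset.sum_le_sum_of_subset_of_nonneg (fun τ hτ => hsub T hTT τ hτ)
          fun t ht _ => (hρ0 t ht e).1
      have hS := (hS0 T hTT e).trans hle
      have hX : 0 ≤ 1 / Real.log T * ∑ t ∈ Finset.Icc 1 T, ρ t e := by positivity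
      rw [hw, Real.sqrt_le_iff]
      refine ⟨by positivity, ?_⟩
      have := mul_le_mul_of_nonneg_left hle (one_div_pos.2 hl0).le
      nlinarith [Real.sq_sqrt hX, Real.sqrt_nonneg (1 / Real.log T * ∑ t ∈ Finset.Icc 1 T, ρ t e)]
    have hS : 0 ≤ ∑ t ∈ Finset.Icc 1 T, ρ t e := Finset.sum_nonneg fun t ht => (hρ0 t ht e).1
    have e1 : Real.log T * √(1 / Real.log T * ∑ t ∈ Finset.Icc 1 T, ρ t e)
        = √(Real.log T * ∑ t ∈ Finset.Icc 1 T, ρ t e) := by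
      have e2 : Real.log T * ∑ t ∈ Finset.Icc 1 T, ρ t e
          = Real.log T ^ 2 * (1 / Real.log T * ∑ t ∈ Finset.Icc 1 T, ρ t e) := by
        field_simp
      rw [e2, Real.sqrt_mul (sq_nonneg (Real.log T)), Real.sqrt_sq hl0.le]
    have hw0 : 0 ≤ w T e := Real.sqrt_nonneg _
    have e3 := mul_le_mul_of_nonneg_left (hyT e) hw0
    have e4 := mul_le_mul_of_nonneg_right hwT (by linarith : 0 ≤ 2 * Real.log T)
    linarith
  have h5 : ∑ t ∈ Finset.Icc 1 T, ∑ e, 2 * ρ t e / w t e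
      ≤ ∑ e, 4 * √(Real.log T * ∑ t ∈ Finset.Icc 1 T, ρ t e) := by
    rw [Finset.sum_comm]
    refine Finset.sum_le_sum fun e _ => ?_
    have := sum_div_sqrt_le (r := fun t => ρ t e) (fun t ht => hρ0 t ht e)
      (by linarith : 1 ≤ 4 * Real.log T)
    simp only [mul_div_assoc, ← Finset.mul_sum]
    linarith
  have h6 : ∑ e : G.Edge, 4 * Real.log T = 4 * (G.m * Real.log T) := by
    rw [Finset.sum_const, Finset.card_univ, card_edge, nsmul_eq_mul]
    ring
  rw [Finset.sum_add_distrib, h6, ← Finset.mul_sum] at h4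
  rw [← Finset.mul_sum] at h5
  rw [h1]
  linarith

variable {Ω : Type*} {mΩ : MeasurableSpace Ω}
  {μ : Measure Ω} {ℋ : Filtration ℕ mΩ} {ℓ q p : ℕ → Ω → G.Edge → ℝ} {c : ℕ → Ω → ℝ}
  [IsProbabilityMeasure μ] {pstar : G.Edge → ℝ} {π : {v : W // v ≠ G.g} → G.Edge}
  {Δ : G.Edge → ℝ} {C : ℝ}

theorem IsInteraction.barrier_lower_bound (h : G.IsInteraction μ T ℋ ℓ q p c) (hT : 2 ≤ T)
    (hF : ∀ ω, G.IsLogBarrierFTRL T (fun t => p t ω) (fun t => q t ω) (fun t => c t ω)) :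
    ∀ t ∈ Finset.Icc 1 T, ∃ δ > 0, ∀ ω e, δ ≤ q t ω e := by
  have hl0 : 0 < Real.log T := by linarith [one_le_two_mul_log hT]
  refine h.exists_lower_bound (A := 0) (M := √(4 + 1 / Real.log T * T)) (a := fun _ => 0)
    (w := fun t ω e => 1 / G.barrierRate T (fun t => p t ω) (fun t => q t ω) (fun t => c t ω) t e)
    (fun t _ => ⟨le_rfl, le_rfl⟩) (fun t ht ω e => ?_)
    fun t ht ω => (hF ω).isHybridArgmin ht
  rw [one_div_barrierRate _ _ _ (fun t ht => h.path_mem t ht ω) ht]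
  have hmem : ∀ τ ∈ Finset.Ico 1 t, τ ∈ Finset.Icc 1 T := fun τ hτ => Finset.mem_Icc.2
    ⟨(Finset.mem_Ico.1 hτ).1, (Finset.mem_Ico.1 hτ).2.le.trans (Finset.mem_Icc.1 ht).2⟩
  have h0 : 0 ≤ ∑ τ ∈ Finset.Ico 1 t, G.rho (c τ ω) (p τ ω) (q τ ω) e :=
    Finset.sum_nonneg fun τ hτ => G.rho_nonneg (h.path_mem τ (hmem τ hτ) ω) _ e
  have h1 : ∑ τ ∈ Finset.Ico 1 t, G.rho (c τ ω) (p τ ω) (q τ ω) e ≤ T := by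
    refine (Finset.sum_le_card_nsmul _ _ 1 fun τ hτ => G.rho_le_one
      ((hF ω).isHybridArgmin (hmem τ hτ)).2.1 (h.path_mem τ (hmem τ hτ) ω)
      (h.feedback_mem τ (hmem τ hτ) ω) e).trans ?_
    rw [Nat.card_Ico, nsmul_eq_mul, mul_one]
    exact_mod_cast (Nat.sub_le t 1).trans (Finset.mem_Icc.1 ht).2
  constructor
  · rw [Real.one_le_sqrt]
    have : 0 ≤ 1 / Real.log T * ∑ τ ∈ Finset.Ico 1 t, G.rho (c τ ω) (p τ ω) (q τ ω) e := by
      positivity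
    linarith
  · gcongr

theorem IsInteraction.measurable_rho (h : G.IsInteraction μ T ℋ ℓ q p c) {t : ℕ}
    (ht : t ∈ Finset.Icc 1 T) (e : G.Edge) :
    Measurable fun ω => G.rho (c t ω) (p t ω) (q t ω) e := by
  have hp := h.path_measurable ht
  have hq := h.flow_measurable ht
  exact (((h.feedback_measurable ht).pow_const 2).mul (measurable_outflow hp _)).mul
    ((((measurable_pi_apply e).comp hp).sub (((measurable_pi_apply e).comp hq).div
      (measurable_outflow hq _))).pow_const 2)

theorem IsInteraction.sum_rho_mem (h : G.IsInteraction μ T ℋ ℓ q p c)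
    (hq0 : ∀ t ∈ Finset.Icc 1 T, ∀ ω e, 0 < q t ω e) (ω : Ω) (e : G.Edge) :
    ∑ t ∈ Finset.Icc 1 T, G.rho (c t ω) (p t ω) (q t ω) e ∈ Set.Icc (0 : ℝ) T := by
  refine ⟨Finset.sum_nonneg fun t ht => G.rho_nonneg (h.path_mem t ht ω) _ e, ?_⟩
  refine (Finset.sum_le_card_nsmul _ _ 1 fun t ht => G.rho_le_one
    (hq0 t ht ω) (h.path_mem t ht ω) (h.feedback_mem t ht ω) e).trans (by simp)

theorem IsInteraction.integrable_sqrt_sum_rho (h : G.IsInteraction μ T ℋ ℓ q p c)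
    (hq0 : ∀ t ∈ Finset.Icc 1 T, ∀ ω e, 0 < q t ω e) (e : G.Edge) :
    Integrable (fun ω => √(Real.log T * ∑ t ∈ Finset.Icc 1 T,
      G.rho (c t ω) (p t ω) (q t ω) e)) μ := by
  refine integrable_of_abs_le ((Finset.measurable_sum _ fun t ht =>
    h.measurable_rho ht e).const_mul _).sqrt (B := √(Real.log T * T)) fun ω => ?_
  rw [abs_of_nonneg (Real.sqrt_nonneg _)]
  exact Real.sqrt_le_sqrt (mul_le_mul_of_nonneg_left (h.sum_rho_mem hq0 ω e).2
    (Real.log_natCast_nonneg T))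

/-- The general regret bound for the log-barrier algorithm. -/
theorem IsInteraction.barrier_regret_le (h : G.IsInteraction μ T ℋ ℓ q p c) (hT : 2 ≤ T)
    (hF : ∀ ω, G.IsLogBarrierFTRL T (fun t => p t ω) (fun t => q t ω) (fun t => c t ω))
    (hp : pstar ∈ G.paths) :
    G.regret μ T ℓ p pstar ≤ 6 * (G.m * Real.log T) + 6 * ∫ ω, ∑ e, √(Real.log T *
      ∑ t ∈ Finset.Icc 1 T, G.rho (c t ω) (p t ω) (q t ω) e) ∂μ := by
  have hpf := G.paths_subset_flows hp
  have hl := one_le_two_mul_log hT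
  have hm : (1 : ℝ) ≤ G.m := by exact_mod_cast G.m_pos ⟨_, hp⟩
  have hT1 : (1 : ℝ) ≤ T := by exact_mod_cast (by omega : 1 ≤ T)
  have hml : (G.m : ℝ) ≤ 2 * (G.m * Real.log T) := by nlinarith
  rcases le_total (T : ℝ) G.m with hTm | hTm
  · have h1 := h.regret_le_horizon hpf
    have h2 : 0 ≤ ∫ ω, ∑ e, √(Real.log T *
        ∑ t ∈ Finset.Icc 1 T, G.rho (c t ω) (p t ω) (q t ω) e) ∂μ :=
      integral_nonneg fun ω => Finset.sum_nonneg fun e _ => Real.sqrt_nonneg _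
    linarith
  have hlow := h.barrier_lower_bound hT hF
  have hqf : ∀ t ∈ Finset.Icc 1 T, ∀ ω, q t ω ∈ G.flows :=
    fun t ht ω => ((hF ω).isHybridArgmin ht).1
  have hq0 : ∀ t ∈ Finset.Icc 1 T, ∀ ω e, 0 < q t ω e :=
    fun t ht ω => ((hF ω).isHybridArgmin ht).2.1
  obtain ⟨x, hx, hxm⟩ := G.exists_flow_ge ⟨_, hp⟩
  -- Mixing costs 1 in total, and since the flow has coordinates at least `1/m ≥ 1/T`, those of the
  -- comparator are at least `1/T²`.
  set ε : ℝ := 1 / T with hεdef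
  have hε : 0 < ε := by positivity
  have hε1 : ε ≤ 1 := (div_le_one (by linarith)).2 hT1
  set y := (1 - ε) • pstar + ε • x with hydef
  have hye : ∀ e, y e = (1 - ε) * pstar e + ε * x e := fun e => rfl
  have hy : y ∈ G.flows := G.convex_flows hpf hx (by linarith) hε.le (by ring)
  have hlb : ∀ e, 1 / (T : ℝ) ^ 2 ≤ y e := fun e => by
    have h1 : 0 ≤ (1 - ε) * pstar e :=
      mul_nonneg (by linarith) (G.mem_Icc_of_mem_flows hpf e).1
    have h2 : 1 / (T : ℝ) ≤ x e := le_trans (by gcongr) (hxm e)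
    have h3 := mul_le_mul_of_nonneg_left h2 hε.le
    have h4 : ε * (1 / (T : ℝ)) = 1 / (T : ℝ) ^ 2 := by
      rw [hεdef]
      field_simp
    rw [hye]
    linarith
  have hb0 : (0 : ℝ) < 1 / (T : ℝ) ^ 2 := by positivity
  have hy0 : ∀ e, 0 < y e := fun e => hb0.trans_le (hlb e)
  have hyT : ∀ e, -Real.log (y e) ≤ 2 * Real.log T := fun e => by
    have := Real.log_le_log hb0 (hlb e)
    rw [one_div, Real.log_inv, Real.log_pow] at this
    push_cast at this
    linarith
  have hneg : ∀ t ∈ Finset.Icc 1 T,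
      Integrable (fun ω => -G.dot (G.lossEst (c t ω) (p t ω) (q t ω)) y) μ :=
    fun t ht => (h.integrable_dot_lossEst hlow hy t ht).neg
  have hint : Integrable (fun ω => ∑ e, √(Real.log T *
      ∑ t ∈ Finset.Icc 1 T, G.rho (c t ω) (p t ω) (q t ω) e)) μ :=
    integrable_finsetSum _ fun e _ => h.integrable_sqrt_sum_rho hq0 e
  have main : G.regret μ T ℓ p y ≤ ∫ ω, (4 * (G.m * Real.log T) + 6 * ∑ e, √(Real.log T *
      ∑ t ∈ Finset.Icc 1 T, G.rho (c t ω) (p t ω) (q t ω) e)) ∂μ := by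
    rw [h.regret_eq hqf hlow hy]
    refine integral_mono (integrable_finsetSum _ hneg)
      ((integrable_const _).add (hint.const_mul _)) fun ω => ?_
    exact (hF ω).sum_neg_dot_le hT (fun t ht => h.path_mem t ht ω)
      (fun t ht => h.feedback_mem t ht ω) hy hy0 hyT
  rw [integral_add (integrable_const _) (hint.const_mul _), integral_const, probReal_univ,
    one_smul, integral_const_mul] at main
  have h1 := h.regret_le_regret_mix (y := x) hpf hx ⟨hε.le, hε1⟩
  have h2 : ε * T = 1 := by
    rw [hεdef]
    field_simp
  linarith

/-- Cauchy–Schwarz over the `m` edges and `Σ_e ρ_t(e) ≤ 2 L c_t²`; `3/2` bounds `√2`. -/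
theorem IsInteraction.barrier_regret_le_sq_feedback (h : G.IsInteraction μ T ℋ ℓ q p c)
    (hT : 2 ≤ T)
    (hF : ∀ ω, G.IsLogBarrierFTRL T (fun t => p t ω) (fun t => q t ω) (fun t => c t ω))
    (hp : pstar ∈ G.paths) :
    Integrable (fun ω =>
      √(G.m * G.L * (∑ t ∈ Finset.Icc 1 T, c t ω ^ 2) * Real.log T)) μ ∧
    G.regret μ T ℓ p pstar ≤
      9 * ((∫ ω, √(G.m * G.L * (∑ t ∈ Finset.Icc 1 T, c t ω ^ 2) * Real.log T) ∂μ)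
        + G.m * Real.log T) := by
  have hl := Real.log_natCast_nonneg T
  have hL : 0 ≤ G.L := by linarith [G.one_le_L ⟨_, hp⟩]
  have hq0 : ∀ t ∈ Finset.Icc 1 T, ∀ ω e, 0 < q t ω e :=
    fun t ht ω => ((hF ω).isHybridArgmin ht).2.1
  have hint : Integrable (fun ω =>
      √(G.m * G.L * (∑ t ∈ Finset.Icc 1 T, c t ω ^ 2) * Real.log T)) μ := by
    refine integrable_of_abs_le (((Finset.measurable_sum _ fun t ht =>
      (h.feedback_measurable ht).pow_const 2).const_mul _).mul_const _).sqrt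
      (B := √(G.m * G.L * T * Real.log T)) fun ω => ?_
    rw [abs_of_nonneg (Real.sqrt_nonneg _)]
    have : ∑ t ∈ Finset.Icc 1 T, c t ω ^ 2 ≤ T :=
      (Finset.sum_le_card_nsmul _ _ 1 fun t ht => pow_le_one₀ (h.feedback_mem t ht ω).1
        (h.feedback_mem t ht ω).2).trans (by simp)
    gcongr
  refine ⟨hint, ?_⟩
  have h1 : ∫ ω, ∑ e, √(Real.log T * ∑ t ∈ Finset.Icc 1 T, G.rho (c t ω) (p t ω) (q t ω) e) ∂μ
      ≤ ∫ ω, 3 / 2 * √(G.m * G.L * (∑ t ∈ Finset.Icc 1 T, c t ω ^ 2) * Real.log T) ∂μ := by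
    refine integral_mono (integrable_finsetSum _ fun e _ => h.integrable_sqrt_sum_rho hq0 e)
      (hint.const_mul _) fun ω => ?_
    refine (sum_sqrt_le _ fun e _ => mul_nonneg hl (h.sum_rho_mem hq0 ω e).1).trans ?_
    rw [← Finset.mul_sum, Finset.sum_comm, Finset.card_univ, card_edge]
    have h2 : ∑ t ∈ Finset.Icc 1 T, ∑ e, G.rho (c t ω) (p t ω) (q t ω) e
        ≤ 2 * G.L * ∑ t ∈ Finset.Icc 1 T, c t ω ^ 2 := by
      rw [Finset.mul_sum]
      exact Finset.sum_le_sum fun t ht =>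
        G.sum_rho_le ⟨_, hp⟩ (hq0 t ht ω) (h.path_mem t ht ω) _
    have hX : 0 ≤ G.m * G.L * (∑ t ∈ Finset.Icc 1 T, c t ω ^ 2) * Real.log T := by positivity
    rw [Real.sqrt_le_iff]
    refine ⟨by positivity, ?_⟩
    simp only [mul_pow]
    rw [Real.sq_sqrt hX]
    have h3 := mul_le_mul_of_nonneg_left h2 (by positivity : 0 ≤ (G.m : ℝ) * Real.log T)
    nlinarith
  rw [integral_const_mul] at h1
  have h2 := h.barrier_regret_le hT hF hp
  have h3 : 0 ≤ (G.m : ℝ) * Real.log T := by positivity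
  linarith

theorem IsInteraction.barrier_regret_le_sqrt (h : G.IsInteraction μ T ℋ ℓ q p c) (hT : 2 ≤ T)
    (hF : ∀ ω, G.IsLogBarrierFTRL T (fun t => p t ω) (fun t => q t ω) (fun t => c t ω))
    (hp : pstar ∈ G.paths) : G.regret μ T ℓ p pstar ≤ 18 * √(G.m * G.L * T * Real.log T) := by
  have hl := Real.log_natCast_nonneg T
  have hL := G.one_le_L ⟨_, hp⟩
  have hm : (1 : ℝ) ≤ G.m := by exact_mod_cast G.m_pos ⟨_, hp⟩
  have hml : (G.m : ℝ) * Real.log T ≤ G.m * G.L * Real.log T := by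
    have : (G.m : ℝ) ≤ G.m * G.L := le_mul_of_one_le_right (by linarith) hL
    gcongr
  have hml0 : 0 ≤ (G.m : ℝ) * Real.log T := by positivity
  have hT0 : (0 : ℝ) ≤ T := by positivity
  have hs := Real.sqrt_nonneg (G.m * G.L * T * Real.log T)
  -- If `T ≤ m log T`, the trivial bound `T` is below the root; otherwise the additive `m log T` is.
  rcases le_total (T : ℝ) (G.m * Real.log T) with hTm | hTm
  · have h1 := h.regret_le_horizon (G.paths_subset_flows hp)
    have h2 : (T : ℝ) ≤ √(G.m * G.L * T * Real.log T) := by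
      refine Real.le_sqrt_of_sq_le ?_
      have := mul_le_mul_of_nonneg_left (hTm.trans hml) hT0
      linarith
    linarith
  · obtain ⟨hint, h1⟩ := h.barrier_regret_le_sq_feedback hT hF hp
    have h2 : G.m * Real.log T ≤ √(G.m * G.L * T * Real.log T) := by
      refine Real.le_sqrt_of_sq_le ?_
      have e1 := mul_le_mul_of_nonneg_left hTm hml0
      have e2 := mul_le_mul_of_nonneg_left hml hT0
      linarith
    have h3 : ∫ ω, √(G.m * G.L * (∑ t ∈ Finset.Icc 1 T, c t ω ^ 2) * Real.log T) ∂μ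
        ≤ ∫ _, √(G.m * G.L * T * Real.log T) ∂μ := by
      refine integral_mono hint (integrable_const _) fun ω => ?_
      have : ∑ t ∈ Finset.Icc 1 T, c t ω ^ 2 ≤ T :=
        (Finset.sum_le_card_nsmul _ _ 1 fun t ht => pow_le_one₀ (h.feedback_mem t ht ω).1
          (h.feedback_mem t ht ω).2).trans (by simp)
      dsimp only
      have : 0 ≤ G.L := by linarith
      gcongr
    rw [integral_const, probReal_univ, one_smul] at h3
    linarith

/-- Since `c² ≤ c`, the expected sum of squares is at most the player's expected loss, that is,
regret plus the loss of `p*`. The resulting inequality is solved as in the self-bounding technique,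
with that loss in the role of `C`. -/
theorem IsInteraction.barrier_regret_le_loss (h : G.IsInteraction μ T ℋ ℓ q p c) (hT : 2 ≤ T)
    (hF : ∀ ω, G.IsLogBarrierFTRL T (fun t => p t ω) (fun t => q t ω) (fun t => c t ω))
    (hp : pstar ∈ G.paths) : G.regret μ T ℓ p pstar ≤
      324 * (√(G.m * G.L * Real.log T *
        ∫ ω, ∑ t ∈ Finset.Icc 1 T, G.dot (ℓ t ω) pstar ∂μ) + G.m * G.L * Real.log T) := by
  have hl := Real.log_natCast_nonneg T
  have hL := G.one_le_L ⟨_, hp⟩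
  have hL0 : 0 ≤ G.L := by linarith
  have hpf := G.paths_subset_flows hp
  have hB : 0 ≤ G.m * G.L * Real.log T := by positivity
  set bl := ∫ ω, ∑ t ∈ Finset.Icc 1 T, G.dot (ℓ t ω) pstar ∂μ with hbl
  have hbl0 : 0 ≤ bl := integral_nonneg fun ω => Finset.sum_nonneg fun t ht =>
    (h.dot_mem ht ω hpf).1
  have hcint : ∀ t ∈ Finset.Icc 1 T, Integrable (c t) μ := fun t ht =>
    integrable_of_abs_le (h.feedback_measurable ht) (B := 1) fun ω => by
      rw [abs_of_nonneg (h.feedback_mem t ht ω).1]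
      exact (h.feedback_mem t ht ω).2
  have hc2int : ∀ t ∈ Finset.Icc 1 T, Integrable (fun ω => c t ω ^ 2) μ := fun t ht =>
    integrable_of_abs_le ((h.feedback_measurable ht).pow_const 2) (B := 1) fun ω => by
      rw [abs_of_nonneg (sq_nonneg _)]
      exact pow_le_one₀ (h.feedback_mem t ht ω).1 (h.feedback_mem t ht ω).2
  have hsum : ∫ ω, ∑ t ∈ Finset.Icc 1 T, c t ω ^ 2 ∂μ ≤ G.regret μ T ℓ p pstar + bl := by
    rw [regret, integral_finsetSum _ (h.integrable_regret hpf), hbl, integral_finsetSum _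
      fun t ht => h.integrable_dot ht measurable_const fun _ => hpf, ← Finset.sum_add_distrib,
      integral_finsetSum _ hc2int]
    refine Finset.sum_le_sum fun t ht => ?_
    have i1 := h.integrable_dot ht (h.path_measurable ht)
      fun ω => G.paths_subset_flows (h.path_mem t ht ω)
    have i2 := h.integrable_dot ht (measurable_const (a := pstar)) fun _ => hpf
    have e1 := h.integral_feedback_mul ht (F := fun _ _ => 1) (fun _ _ => measurable_const)
      (B := 1) (fun _ _ _ => by simp)
    simp only [mul_one] at e1
    simp only [dot_sub]
    rw [integral_sub i1 i2, sub_add_cancel, ← e1]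
    refine integral_mono (hc2int t ht) (hcint t ht) fun ω => ?_
    have := h.feedback_mem t ht ω
    exact pow_le_of_le_one this.1 this.2 two_ne_zero
  obtain ⟨_, h1⟩ := h.barrier_regret_le_sq_feedback hT hF hp
  have h2 : ∫ ω, √(G.m * G.L * (∑ t ∈ Finset.Icc 1 T, c t ω ^ 2) * Real.log T) ∂μ
      ≤ √(G.m * G.L * Real.log T * (G.regret μ T ℓ p pstar + bl)) := by
    have e1 : ∀ ω, G.m * G.L * (∑ t ∈ Finset.Icc 1 T, c t ω ^ 2) * Real.log T
        = G.m * G.L * Real.log T * ∑ t ∈ Finset.Icc 1 T, c t ω ^ 2 := fun ω => by ring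
    simp only [e1]
    refine (integral_sqrt_le ((Finset.measurable_sum _ fun t ht =>
      (h.feedback_measurable ht).pow_const 2).const_mul _) (B := G.m * G.L * Real.log T * T)
      fun ω => ⟨by positivity, ?_⟩).trans (Real.sqrt_le_sqrt ?_)
    · have : ∑ t ∈ Finset.Icc 1 T, c t ω ^ 2 ≤ T :=
        (Finset.sum_le_card_nsmul _ _ 1 fun t ht => pow_le_one₀ (h.feedback_mem t ht ω).1
          (h.feedback_mem t ht ω).2).trans (by simp)
      gcongr
    · rw [integral_const_mul]
      exact mul_le_mul_of_nonneg_left hsum hB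
  have hml0 : 0 ≤ (G.m : ℝ) * Real.log T := by positivity
  have h3 := le_of_le_mul_sqrt hB hbl0 hml0 (by norm_num : (1 : ℝ) ≤ 9)
    (h1.trans (by linarith))
  have h4 : (G.m : ℝ) * Real.log T ≤ G.m * G.L * Real.log T := by
    have hm0 : (0 : ℝ) ≤ G.m := by positivity
    have : (G.m : ℝ) ≤ G.m * G.L := le_mul_of_one_le_right hm0 hL
    gcongr
  have h5 := Real.sqrt_nonneg (G.m * G.L * Real.log T * bl)
  linarith

/-- Jensen for each edge replaces `Σ ρ` by the expected variances, which are charged to `E'` only.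
As the sum over rounds stays inside the root, no `n²/Δ` term arises. -/
theorem IsInteraction.barrier_regret_le_of_isSelfBounding (h : G.IsInteraction μ T ℋ ℓ q p c)
    (hT : 2 ≤ T)
    (hF : ∀ ω, G.IsLogBarrierFTRL T (fun t => p t ω) (fun t => q t ω) (fun t => c t ω))
    (hs : G.IsSelfBounding μ T ℓ p pstar π Δ C) :
    G.regret μ T ℓ p pstar ≤
      288 * (G.gapSum T π Δ + √(G.gapSum T π Δ * C) + G.m * Real.log T) := by
  have hp := hs.path_mem
  have hl := Real.log_natCast_nonneg T
  have hU0 := hs.gapSum_nonneg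
  have hqf : ∀ t ∈ Finset.Icc 1 T, ∀ ω, q t ω ∈ G.flows :=
    fun t ht ω => ((hF ω).isHybridArgmin ht).1
  have hq0 : ∀ t ∈ Finset.Icc 1 T, ∀ ω e, 0 < q t ω e :=
    fun t ht ω => ((hF ω).isHybridArgmin ht).2.1
  have hqint : ∀ t ∈ Finset.Icc 1 T, ∀ e, Integrable (fun ω => q t ω e) μ := fun t ht e =>
    integrable_of_abs_le ((measurable_pi_apply e).comp (h.flow_measurable ht)) (B := 1)
      fun ω => by
        rw [abs_of_nonneg (hq0 t ht ω e).le]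
        exact (G.mem_Icc_of_mem_flows (hqf t ht ω) e).2
  set Q : G.Edge → ℝ := fun e => ∑ t ∈ Finset.Icc 1 T, ∫ ω, q t ω e ∂μ with hQ
  have hQ0 : ∀ e, 0 ≤ Q e := fun e => Finset.sum_nonneg fun t ht =>
    integral_nonneg fun ω => (hq0 t ht ω e).le
  set V : G.Edge → ℝ := fun e =>
    ∑ t ∈ Finset.Icc 1 T, ∫ ω, q t ω e * (1 - G.ratio (q t ω) e) ∂μ with hV
  have hVint : ∀ t ∈ Finset.Icc 1 T, ∀ e,
      Integrable (fun ω => q t ω e * (1 - G.ratio (q t ω) e)) μ := fun t ht e => by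
    refine (hqint t ht e).mul_bdd (c := 1) ?_ (Filter.Eventually.of_forall fun ω => ?_)
    · exact (measurable_const.sub (((measurable_pi_apply e).comp (h.flow_measurable ht)).div
        (measurable_outflow (h.flow_measurable ht) _))).aestronglyMeasurable
    · have := G.ratio_mem (hq0 t ht ω) e
      rw [Real.norm_of_nonneg (by linarith [this.2])]
      linarith [this.1]
  have hVQ : ∀ e, V e ≤ Q e := fun e => Finset.sum_le_sum fun t ht =>
    integral_mono (hVint t ht e) (hqint t ht e) fun ω =>
      mul_le_of_le_one_right (hq0 t ht ω e).le (by linarith [(G.ratio_mem (hq0 t ht ω) e).1])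
  have hVsib : ∀ e, V e ≤ ∑ e' with G.tail e' = G.tail e ∧ e' ≠ e, Q e' := fun e => by
    rw [hQ, Finset.sum_comm]
    refine Finset.sum_le_sum fun t ht => ?_
    rw [← integral_finsetSum _ fun e' _ => hqint t ht e']
    exact integral_mono (hVint t ht e) (integrable_finsetSum _ fun e' _ => hqint t ht e')
      fun ω => G.mul_one_sub_ratio_le (hq0 t ht ω) e
  have hρ : ∀ e, ∫ ω, √(Real.log T * ∑ t ∈ Finset.Icc 1 T, G.rho (c t ω) (p t ω) (q t ω) e) ∂μ
      ≤ √(Real.log T * V e) := by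
    intro e
    refine (integral_sqrt_le ((Finset.measurable_sum _ fun t ht =>
      h.measurable_rho ht e).const_mul _) (B := Real.log T * T) fun ω =>
      ⟨mul_nonneg hl (h.sum_rho_mem hq0 ω e).1,
        mul_le_mul_of_nonneg_left (h.sum_rho_mem hq0 ω e).2 hl⟩).trans (Real.sqrt_le_sqrt ?_)
    rw [integral_const_mul]
    refine mul_le_mul_of_nonneg_left ?_ hl
    have hρint : ∀ t ∈ Finset.Icc 1 T, Integrable
        (fun ω => G.rho (c t ω) (p t ω) (q t ω) e) μ := fun t ht =>
      integrable_of_abs_le (h.measurable_rho ht e) (B := 1) fun ω => by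
        rw [abs_of_nonneg (G.rho_nonneg (h.path_mem t ht ω) _ e)]
        exact G.rho_le_one (hq0 t ht ω) (h.path_mem t ht ω) (h.feedback_mem t ht ω) e
    rw [integral_finsetSum _ hρint]
    refine Finset.sum_le_sum fun t ht => ?_
    have e1 := h.integral_mul_sq ht (hqf t ht) (hq0 t ht) (a := fun _ => 1) measurable_const
      (B := 1) (fun _ => by simp) e
    have e2 := h.integrable_mul_sq ht (hq0 t ht) (a := fun _ => 1) measurable_const
      (B := 1) (fun _ => by simp) e
    simp only [one_mul] at e1 e2
    rw [← e1]
    exact integral_mono (hρint t ht) e2 fun ω =>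
      G.rho_le (h.path_mem t ht ω) (h.feedback_mem t ht ω) e
  -- The variance of an edge is bounded by the mass of its siblings, and subadditivity of the root
  -- splits this into one term per sibling.
  have hsum : ∑ e, √(Real.log T * V e) ≤ 2 * ∑ e ∈ G.offPolicy π, √(Real.log T * Q e) := by
    refine G.sum_le_two_mul_offPolicy (fun e => Real.sqrt_nonneg _)
      (fun e => Real.sqrt_le_sqrt (mul_le_mul_of_nonneg_left (hVQ e) hl)) fun e => ?_
    refine (Real.sqrt_le_sqrt (mul_le_mul_of_nonneg_left (hVsib e) hl)).trans ?_
    rw [Finset.mul_sum]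
    exact sqrt_sum_le_sum_sqrt _ fun e _ => mul_nonneg hl (hQ0 e)
  have hCS : ∑ e ∈ G.offPolicy π, √(Real.log T * Q e)
      ≤ √(G.gapSum T π Δ) * √(∑ e ∈ G.offPolicy π, Δ e * Q e) := by
    refine le_trans (le_of_eq (Finset.sum_congr rfl fun e he => ?_)) (sum_mul_sqrt_le _
      (fun e he => div_nonneg hl (hs.gap_pos e he).le)
      fun e _ => mul_nonneg (hs.gap_mem e).1 (hQ0 e))
    have := hs.gap_pos e he
    rw [← Real.sqrt_mul (by positivity)]
    congr 1
    field_simp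
  have hgap : ∑ e ∈ G.offPolicy π, Δ e * Q e ≤ G.regret μ T ℓ p pstar + C := by
    refine le_trans (le_of_eq ?_) (hs.integral_le h hqf hq0)
    rw [integral_finsetSum _ fun t ht => integrable_finsetSum _ fun e _ =>
      (hqint t ht e).const_mul (Δ e)]
    rw [Finset.sum_congr rfl fun t ht => integral_finsetSum _ fun e _ =>
      (hqint t ht e).const_mul (Δ e), Finset.sum_comm]
    simp only [integral_const_mul, hQ, Finset.mul_sum]
  have h1 := h.barrier_regret_le hT hF hp
  rw [integral_finsetSum _ fun e _ => h.integrable_sqrt_sum_rho hq0 e] at h1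
  have h2 := Finset.sum_le_sum fun e (_ : e ∈ Finset.univ) => hρ e
  have h3 := mul_le_mul_of_nonneg_left (Real.sqrt_le_sqrt hgap) (Real.sqrt_nonneg (G.gapSum T π Δ))
  rw [← Real.sqrt_mul hU0 (_ + C)] at h3
  have h4 : 0 ≤ (G.m : ℝ) * Real.log T := by positivity
  have h5 : G.regret μ T ℓ p pstar
      ≤ 12 * (√(G.gapSum T π Δ * (G.regret μ T ℓ p pstar + C)) + G.m * Real.log T) := by linarith
  have h6 := le_of_le_mul_sqrt hU0 hs.corruption_nonneg h4 (by norm_num) h5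
  linarith

end Barrier

end STDag

/-! ### The main theorem -/

theorem mainTheorem5 :
    ∃ K : ℝ, 0 < K ∧
      ∀ (W : Type*) [Fintype W] [DecidableEq W] (G : STDag W) (T : ℕ), 2 ≤ T →
      ∀ (Ω : Type*) (mΩ : MeasurableSpace Ω) (μ : Measure Ω) [IsProbabilityMeasure μ]
        (ℋ : Filtration ℕ mΩ) (ℓ q p : ℕ → Ω → G.Edge → ℝ) (c : ℕ → Ω → ℝ),
      G.IsInteraction μ T ℋ ℓ q p c →
      -- the Tsallis-entropy algorithm
      ((∀ ω, G.IsTsallisFTRL T (fun t => p t ω) (fun t => q t ω) (fun t => c t ω)) →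
        G.maxRegret μ T ℓ p ≤ K * (√(G.m * G.L * (G.n + T)) + G.n * Real.log T) ∧
        G.maxRegret μ T ℓ p ≤ K * (√(G.m * G.L * T) + G.m * Real.log T) ∧
        ∀ pstar π Δ C, G.IsSelfBounding μ T ℓ p pstar π Δ C →
          (∀ U, U = G.gapSum T π Δ + (G.n : ℝ) ^ 2 * Real.log T / G.gapMin π Δ →
            G.regret μ T ℓ p pstar ≤ K * (U + √(U * C))) ∧
          (∀ U, U = G.gapSum T π Δ + (G.n : ℝ) ^ 2 * Real.log T / G.gapStar pstar π Δ →
            G.regret μ T ℓ p pstar ≤ K * (U + √(U * C)))) ∧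
      -- the log-barrier algorithm
      ((∀ ω, G.IsLogBarrierFTRL T (fun t => p t ω) (fun t => q t ω) (fun t => c t ω)) →
        G.maxRegret μ T ℓ p ≤ K * √(G.m * G.L * (G.n + T) * Real.log T) ∧
        G.maxRegret μ T ℓ p ≤
          K * ((∫ ω, √(G.m * G.L * (∑ t ∈ Finset.Icc 1 T, c t ω ^ 2) * Real.log T) ∂μ)
            + G.m * Real.log T) ∧
        G.maxRegret μ T ℓ p ≤
          K * (√(G.m * G.L * Real.log T * G.bestLoss μ T ℓ) + G.m * G.L * Real.log T) ∧
        ∀ pstar π Δ C, G.IsSelfBounding μ T ℓ p pstar π Δ C →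
          ∀ U, U = G.gapSum T π Δ →
            G.regret μ T ℓ p pstar ≤ K * (U + √(U * C) + G.m * Real.log T)) := by
  -- The largest of the constants obtained above, from the Tsallis bound in the self-bounding
  -- regime.
  refine ⟨2116, by norm_num, ?_⟩
  intro W _ _ G T hT Ω mΩ μ _ ℋ ℓ q p c h
  have hP := h.paths_nonempty (by omega : 1 ≤ T)
  have : Nonempty G.paths := hP.to_subtype
  have hfin : Finite G.paths := G.finite_paths.to_subtype
  have hl := Real.log_natCast_nonneg T
  have hL : 0 ≤ G.L := by linarith [G.one_le_L hP]
  refine ⟨fun hF => ⟨?_, ?_, ?_⟩, fun hF => ⟨?_, ?_, ?_, ?_⟩⟩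
  · refine ciSup_le fun x => (h.tsallis_regret_le_sqrt (by omega) hF x.2).trans ?_
    have h1 : √(G.m * G.L * T) ≤ √(G.m * G.L * (G.n + T)) := by
      refine Real.sqrt_le_sqrt (mul_le_mul_of_nonneg_left ?_ (by positivity))
      linarith [Nat.cast_nonneg (α := ℝ) G.n]
    have h2 : 0 ≤ (G.n : ℝ) * Real.log T := by positivity
    have h3 := Real.sqrt_nonneg (G.m * G.L * T)
    linarith
  · refine ciSup_le fun x => (h.tsallis_regret_le_sqrt (by omega) hF x.2).trans ?_
    have h2 : 0 ≤ (G.m : ℝ) * Real.log T := by positivity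
    have h3 := Real.sqrt_nonneg (G.m * G.L * T)
    linarith
  · intro pstar π Δ C hs
    rcases (G.offPolicy π).eq_empty_or_nonempty with hE | hE
    · have h0 := hs.regret_eq_zero hE h.path_mem
      have hg : G.gapSum T π Δ = 0 := by simp [STDag.gapSum, hE]
      have hmin : G.gapMin π Δ = 0 := by
        have : IsEmpty {e // e ∈ G.offPolicy π} := ⟨fun e => by simpa [hE] using e.2⟩
        exact Real.iInf_of_isEmpty _
      have hstar : G.gapStar pstar π Δ = 0 := by
        have : IsEmpty {e // e ∈ G.offPolicy π ∧ G.outflow pstar (G.tail e) = 1} :=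
          ⟨fun e => by simpa [hE] using e.2.1⟩
        exact Real.iInf_of_isEmpty _
      constructor
      · rintro U rfl
        simp [h0, hg, hmin]
      · rintro U rfl
        simp [h0, hg, hstar]
    · refine ⟨?_, fun U hU => h.tsallis_regret_le_of_isSelfBounding hT hF hs hE hU⟩
      rintro U rfl
      refine (h.tsallis_regret_le_of_isSelfBounding hT hF hs hE rfl).trans ?_
      have h1 : (G.n : ℝ) ^ 2 * Real.log T / G.gapStar pstar π Δ
          ≤ (G.n : ℝ) ^ 2 * Real.log T / G.gapMin π Δ :=
        div_le_div_of_nonneg_left (by positivity) (hs.gapMin_pos hE) (hs.gapMin_le_gapStar hE)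
      have hC := hs.corruption_nonneg
      gcongr
  · refine ciSup_le fun x => (h.barrier_regret_le_sqrt hT hF x.2).trans ?_
    have h1 : √(G.m * G.L * T * Real.log T) ≤ √(G.m * G.L * (G.n + T) * Real.log T) := by
      refine Real.sqrt_le_sqrt (mul_le_mul_of_nonneg_right
        (mul_le_mul_of_nonneg_left ?_ (by positivity)) hl)
      linarith [Nat.cast_nonneg (α := ℝ) G.n]
    have h3 := Real.sqrt_nonneg (G.m * G.L * T * Real.log T)
    linarith
  · refine ciSup_le fun x => (h.barrier_regret_le_sq_feedback hT hF x.2).2.trans ?_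
    have h2 : 0 ≤ (G.m : ℝ) * Real.log T := by positivity
    have h3 : 0 ≤ ∫ ω, √(G.m * G.L * (∑ t ∈ Finset.Icc 1 T, c t ω ^ 2) * Real.log T) ∂μ :=
      integral_nonneg fun ω => Real.sqrt_nonneg _
    linarith
  · obtain ⟨x, hx⟩ := exists_eq_ciInf_of_finite (f := fun x : G.paths =>
      ∫ ω, ∑ t ∈ Finset.Icc 1 T, G.dot (ℓ t ω) x.1 ∂μ)
    -- The path of least expected loss maximizes the regret, since the player's own loss does not
    -- depend on the comparator.
    have hreg : ∀ y : G.paths, G.regret μ T ℓ p y.1 ≤ G.regret μ T ℓ p x.1 := by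
      intro y
      have key : ∀ z : G.paths, G.regret μ T ℓ p z.1 =
          ∫ ω, ∑ t ∈ Finset.Icc 1 T, G.dot (ℓ t ω) (p t ω) ∂μ
          - ∫ ω, ∑ t ∈ Finset.Icc 1 T, G.dot (ℓ t ω) z.1 ∂μ := fun z => by
        simp only [STDag.regret, STDag.dot_sub, Finset.sum_sub_distrib]
        exact integral_sub
          (integrable_finsetSum _ fun t ht => h.integrable_dot ht (h.path_measurable ht)
            fun ω => G.paths_subset_flows (h.path_mem t ht ω))
          (integrable_finsetSum _ fun t ht => h.integrable_dot ht measurable_const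
            fun _ => G.paths_subset_flows z.2)
      have hxy := ciInf_le (f := fun x : G.paths =>
        ∫ ω, ∑ t ∈ Finset.Icc 1 T, G.dot (ℓ t ω) x.1 ∂μ) (Set.finite_range _).bddBelow y
      rw [key, key]
      linarith
    refine ciSup_le fun y => (hreg y).trans ((h.barrier_regret_le_loss hT hF x.2).trans ?_)
    have hb : G.bestLoss μ T ℓ = ∫ ω, ∑ t ∈ Finset.Icc 1 T, G.dot (ℓ t ω) x.1 ∂μ := hx.symm
    rw [hb]
    gcongr
    norm_num
  · rintro pstar π Δ C hs U rfl
    refine (h.barrier_regret_le_of_isSelfBounding hT hF hs).trans ?_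
    have h1 := hs.gapSum_nonneg
    have h2 := Real.sqrt_nonneg (G.gapSum T π Δ * C)
    gcongr
    norm_num
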